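/- Let $k\ge 2$, let $U\subset\mathbb R\times\mathbb R^{k+1}$ be open and non-empty, and let $f\colon U\to\mathbb R$ be smooth. Consider the ordinary differential equation $y^{(k+1)}=f(x,y,y',\dots,y^{(k)})$ and let $M$ be the $(k+1)$-dimensional space of its maximal solutions, with the initial values at the points $x_0\in\mathbb R$ as charts. The tangent space $T_yM$ is the solution space of the linearization $z^{(k+1)}=\sum_{i=0}^k \frac{\partial f}{\partial y^{(i)}}z^{(i)}$ along $y$. Let $\gamma_y$ be the curve in $P(T_yM)$ that sends $x$ to the line of all $z$ with $z(x)=z'(x)=\dots=z^{(k-1)}(x)=0$, and let $\gamma_y^{(i)}$ be its osculating spaces, spanned by the derivatives of order at most $i$ of a lift of $\gamma_y$ to $T_yM$. *Structures.* A pseudo-conformal (pseudo-symplectic) structure on $M$ is a family of smooth fields of non-degenerate symmetric (skew-symmetric) bilinear forms on the tangent spaces, proportional to each other by non-zero functional factors. A $G_2$-structure, here taken up to a non-zero functional factor, is a smooth field of $3$-forms, each linearly equivalent to the form $\Omega(u,v,w)=B(\operatorname{Im}(uv),w)$ on the imaginary split octonions, where $B(u,v)$ is the scalar part of $uv$. ($M$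 may fail to be Hausdorff; these structures are smooth fields of lines of forms on $M$ that have a smooth generator on each chart, that is on the set of all solutions defined at a given $x_0$.) The structure is *natural* if for every solution $y$ it is compatible with $\gamma_y$: for bilinear forms $b$ this means $b(\gamma_y^{(i)},\gamma_y^{(k-1-i)})=0$ for $0\le i\le k-1$, and for $3$-forms $\Omega(\gamma_y,\gamma_y'',\cdot)=0$. *Invariants.* Let $X$ be the $(k+1)\times(k+1)$ matrix with $Xe_j=e_{j+1}$ for $0\le j<k$ and $Xe_k=0$, let $H=\operatorname{diag}(k,k-2,\dots,-k)$, and let $Y$ be the matrix with $Ye_j=j(k+1-j)e_{j-1}$ (and $Ye_0=0$). For a linear equation $v^{(k+1)}=p_0v+\dots+p_kv^{(k)}$ on an open interval, let $C$ be the matrix of its moving frame, $(v,\dots,v^{(k)})'=(v,\dots,v^{(k)})\,C$. There is a smooth invertible upper triangular $A$ with $A^{-1}CA+A^{-1}A'\equiv X+\sum_{i=2}^k\theta_{i+1}Y^i$ modulo $\langle H,Y\rangle$, and the functions $\theta_3,\dots,\theta_{k+1}$ do not depend on $A$; they are the Wilczynski invariants of the linear equation. The generalized Wilczynski invariants $\Theta_3,\dots,\Theta_{k+1}$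 of the given equation are those of its linearizations along all its solutions. **Theorem.** The solution space $M$ carries a natural 1. pseudo-conformal structure if and only if $k$ is even and all $\Theta_{2i+1}$ ($i\ge1$, $2i+1\le k+1$) vanish identically; 2. pseudo-symplectic structure if and only if $k$ is odd and all $\Theta_{2i+1}$ ($i\ge1$, $2i+1\le k+1$) vanish identically; 3. $G_2$-structure if and only if $k=6$ and $\Theta_3=\Theta_4=\Theta_5=\Theta_7=0$ identically. In each case the natural structure is unique (the $G_2$-structure up to a non-zero functional factor). -/

import Mathlib

open scoped ContDiff

noncomputable section

namespace ODEGeometry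

/-! ### Osculating spaces of a projective curve and compatible forms -/

section Curves

variable {V : Type*} [AddCommGroup V] [Module ℝ V]

/-- `v` has derivative `v'` at `t`. Here `V` carries no topology; for a finite-dimensional `V`
this (differentiability of all coordinates) is the usual notion. -/
def HasCoordDerivAt (v : ℝ → V) (v' : V) (t : ℝ) : Prop :=
  ∀ φ : Module.Dual ℝ V, HasDerivAt (fun s => φ (v s)) (φ v') t

/-- `v 0` is a curve of vectors spanning the lines `γ t`, `t ∈ I`, and `v (j + 1)` is the
derivative of `v j` on `I`. -/
def IsLift (I : Set ℝ) (γ : ℝ → Submodule ℝ V) (v : ℕ → ℝ → V) : Prop :=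
  (∀ t ∈ I, γ t = Submodule.span ℝ {v 0 t}) ∧
    ∀ j, ∀ t ∈ I, HasCoordDerivAt (v j) (v (j + 1) t) t

/-- The `i`-th osculating space `γ^{(i)}(t)`, spanned by the derivatives of order at most `i`
of the lifts of `γ`. -/
def osculating (I : Set ℝ) (γ : ℝ → Submodule ℝ V) (i : ℕ) (t : ℝ) : Submodule ℝ V :=
  Submodule.span ℝ {u | ∃ v, IsLift I γ v ∧ ∃ j ≤ i, u = v j t}

/-- Compatibility of a curve in `P(V)`, `dim V = k + 1`, with a bilinear form: the osculating
spaces `γ^{(i)}` (of dimension `i + 1`) and `γ^{(k-1-i)}` (of dimension `k - i`)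
are orthogonal. -/
def CompatibleBilin (k : ℕ) (I : Set ℝ) (γ : ℝ → Submodule ℝ V)
    (b : LinearMap.BilinForm ℝ V) : Prop :=
  ∀ t ∈ I, ∀ i j : ℕ, i + j + 1 = k →
    ∀ u ∈ osculating I γ i t, ∀ w ∈ osculating I γ j t, b u w = 0

/-- Compatibility of a curve with a 3-form: `Ω(γ, γ'', ·) = 0`. -/
def CompatibleThreeForm (I : Set ℝ) (γ : ℝ → Submodule ℝ V) (Ω : V [⋀^Fin 3]→ₗ[ℝ] ℝ) : Prop :=
  ∀ t ∈ I, ∀ u ∈ γ t, ∀ w ∈ osculating I γ 2 t, ∀ z : V, Ω ![u, w, z] = 0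

end Curves

/-! ### Split octonions and the 3-form of `G₂` -/

/-- A split octonion, as a Zorn vector matrix with diagonal `a, b` and off-diagonal
entries `v, w`. -/
structure SplitOctonion where
  a : ℝ
  b : ℝ
  v : Fin 3 → ℝ
  w : Fin 3 → ℝ

/-- Zorn's product. -/
def SplitOctonion.mul (x y : SplitOctonion) : SplitOctonion where
  a := x.a * y.a - x.v ⬝ᵥ y.w
  b := x.b * y.b - x.w ⬝ᵥ y.v
  v := x.a • y.v + y.b • x.v + crossProduct x.w y.w
  w := y.a • x.w + x.b • y.w + crossProduct x.v y.v

/-- The scalar part. -/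
def SplitOctonion.scalarPart (x : SplitOctonion) : ℝ := (x.a + x.b) / 2

/-- The 7-dimensional space of imaginary split octonions: those with `b = -a`. -/
abbrev ImOctonion : Type := ℝ × (Fin 3 → ℝ) × (Fin 3 → ℝ)

/-- The inclusion of imaginary split octonions. -/
def ImOctonion.incl (u : ImOctonion) : SplitOctonion := ⟨u.1, -u.1, u.2.1, u.2.2⟩

/-- The form `(u₁, u₂, u₃) ↦ B(Im(u₁ u₂), u₃)`, where `B(u, u')` is the scalar part of `u u'`.
This is the scalar part of `(u₁ u₂) u₃`. -/
def splitForm (u₁ u₂ u₃ : ImOctonion) : ℝ :=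
  ((u₁.incl.mul u₂.incl).mul u₃.incl).scalarPart

/-- A 3-form on a vector space `V` is a (split) `G₂`-structure if some linear isomorphism of `V`
with the imaginary split octonions takes it to the standard form `splitForm`. -/
def IsG2Form {V : Type*} [AddCommGroup V] [Module ℝ V] (Ω : V [⋀^Fin 3]→ₗ[ℝ] ℝ) : Prop :=
  ∃ e : V ≃ₗ[ℝ] ImOctonion, ∀ u₁ u₂ u₃ : V, Ω ![u₁, u₂, u₃] = splitForm (e u₁) (e u₂) (e u₃)

/-! ### Wilczynski invariants of a linear equation -/

/-- The matrix `x` of the irreducible representation of `sl₂` of dimension `k + 1`. -/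
def slX (k : ℕ) : Matrix (Fin (k + 1)) (Fin (k + 1)) ℝ :=
  Matrix.of fun i j => if (i : ℕ) = j + 1 then 1 else 0

/-- The matrix `h`. -/
def slH (k : ℕ) : Matrix (Fin (k + 1)) (Fin (k + 1)) ℝ :=
  Matrix.diagonal fun i => (k : ℝ) - 2 * (i : ℕ)

/-- The matrix `y`. -/
def slY (k : ℕ) : Matrix (Fin (k + 1)) (Fin (k + 1)) ℝ :=
  Matrix.of fun i j => if (j : ℕ) = i + 1 then ((j : ℕ) : ℝ) * ((k : ℝ) + 1 - (j : ℕ)) else 0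

/-- The matrix `C` with `(v₀', …, v_k') = (v₀, …, v_k) C` when `v_i' = v_{i+1}` for `i < k` and
`v_k' = p₀ v₀ + ⋯ + p_k v_k`. -/
def companion (k : ℕ) (p : Fin (k + 1) → ℝ) : Matrix (Fin (k + 1)) (Fin (k + 1)) ℝ :=
  slX k + Matrix.of fun i j => if j = Fin.last k then p i else 0

/-- `θ 3, …, θ (k + 1)` are the Wilczynski invariants, in the parameter `t ∈ I`, of the linear
equation `v^{(k+1)} = p₀ v + p₁ v' + ⋯ + p_k v^{(k)}`: the moving frame `(v, v', …, v^{(k)})`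
can be changed by a smooth upper triangular matrix `A` (rescaling of `v` included) to a
canonical frame, that is to one with Maurer-Cartan matrix
`x + ∑_{i=2}^k θ_{i+1} y^i` modulo `h` and `y`. -/
def IsWilczynskiSystem {k : ℕ} (I : Set ℝ) (p : Fin (k + 1) → ℝ → ℝ) (θ : ℕ → ℝ → ℝ) : Prop :=
  ∃ (A : ℝ → Matrix (Fin (k + 1)) (Fin (k + 1)) ℝ) (α β : ℝ → ℝ),
    (∀ i j, ContDiffOn ℝ ∞ (fun t => A t i j) I) ∧
    ∀ t ∈ I, (A t).BlockTriangular id ∧ (A t).det ≠ 0 ∧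
      (A t)⁻¹ * companion k (fun i => p i t) * A t
          + (A t)⁻¹ * Matrix.of (fun i j => deriv (fun s => A s i j) t)
        = slX k + α t • slH k + β t • slY k + ∑ i ∈ Finset.Icc 2 k, θ (i + 1) t • slY k ^ i

/-- The Wilczynski invariants `θ_j`, `3 ≤ j ≤ k + 1`. For smooth `p` on an open interval `I`
a system as above exists, and on `I` its members `θ 3, …, θ (k + 1)` are determined by `p`. -/
def wilczynski {k : ℕ} (I : Set ℝ) (p : Fin (k + 1) → ℝ → ℝ) : ℕ → ℝ → ℝ :=
  Classical.epsilon fun θ => IsWilczynskiSystem I p θ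

/-! ### The equation, its solution space and the linearization -/

section Equation

variable {k : ℕ}

/-- `c = (y, y', …, y^{(k)})` is the jet of a solution of `y^{(k+1)} = f(x, y, …, y^{(k)})`
on the open interval `I`, the equation being defined on the domain `U` of the jet space. -/
def IsSolutionOn (f : ℝ × (Fin (k + 1) → ℝ) → ℝ) (U : Set (ℝ × (Fin (k + 1) → ℝ)))
    (I : Set ℝ) (c : ℝ → Fin (k + 1) → ℝ) : Prop :=
  IsOpen I ∧ I.OrdConnected ∧ I.Nonempty ∧
    ∀ x ∈ I, (x, c x) ∈ U ∧
      (∀ i : Fin k, HasDerivAt (fun s => c s i.castSucc) (c x i.succ) x) ∧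
      HasDerivAt (fun s => c s (Fin.last k)) (f (x, c x)) x

/-- A point of the solution space: a maximal solution, given by its interval `dom` and its jet
(put equal to zero outside `dom`). -/
structure Solution (f : ℝ × (Fin (k + 1) → ℝ) → ℝ) (U : Set (ℝ × (Fin (k + 1) → ℝ))) where
  dom : Set ℝ
  jet : ℝ → Fin (k + 1) → ℝ
  isSolution : IsSolutionOn f U dom jet
  jet_off : ∀ x, x ∉ dom → jet x = 0
  maximal : ∀ (J : Set ℝ) (c : ℝ → Fin (k + 1) → ℝ),
    IsSolutionOn f U J c → dom ⊆ J → Set.EqOn c jet dom → J = dom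

/-- The initial values at `x₀`: an open subset of `ℝ^{k+1}`, which is a chart of the solution
space (of its open subset formed by the solutions that are defined at `x₀`). -/
def initialValues (U : Set (ℝ × (Fin (k + 1) → ℝ))) (x₀ : ℝ) : Set (Fin (k + 1) → ℝ) :=
  {a | (x₀, a) ∈ U}

variable {f : ℝ × (Fin (k + 1) → ℝ) → ℝ} {U : Set (ℝ × (Fin (k + 1) → ℝ))}

namespace Solution

/-- The coefficients `∂f/∂y^{(i)}` of the linearization along `y`. -/
def linCoeff (y : Solution f U) (i : Fin (k + 1)) (x : ℝ) : ℝ :=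
  fderiv ℝ f (x, y.jet x) (0, Pi.single i 1)

/-- The tangent space of the solution space at `y`: the space of solutions `z` on `y.dom` of the
linearization `z^{(k+1)} = ∑ ∂f/∂y^{(i)} z^{(i)}`, given by their jets
`w = (z, z', …, z^{(k)})` (put equal to zero outside `y.dom`). -/
def tangent (y : Solution f U) : Submodule ℝ (ℝ → Fin (k + 1) → ℝ) where
  carrier := {w |
    (∀ x ∈ y.dom,
      (∀ i : Fin k, HasDerivAt (fun s => w s i.castSucc) (w x i.succ) x) ∧
      HasDerivAt (fun s => w s (Fin.last k)) (∑ i, y.linCoeff i x * w x i) x) ∧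
    ∀ x, x ∉ y.dom → w x = 0}
  zero_mem' := by
    refine ⟨fun x _ => ⟨fun i => ?_, ?_⟩, fun x _ => rfl⟩
    · simpa using hasDerivAt_const x (0 : ℝ)
    · simpa using hasDerivAt_const x (0 : ℝ)
  add_mem' := by
    rintro a b ⟨ha, ha0⟩ ⟨hb, hb0⟩
    refine ⟨fun x hx => ⟨fun i => ?_, ?_⟩, fun x hx => ?_⟩
    · simpa using ((ha x hx).1 i).fun_add ((hb x hx).1 i)
    · have h := (ha x hx).2.fun_add (hb x hx).2
      simpa [mul_add, Finset.sum_add_distrib] using h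
    · simp [ha0 x hx, hb0 x hx]
  smul_mem' := by
    rintro r a ⟨ha, ha0⟩
    refine ⟨fun x hx => ⟨fun i => ?_, ?_⟩, fun x hx => ?_⟩
    · simpa using ((ha x hx).1 i).const_mul r
    · have h := (ha x hx).2.const_mul r
      simpa [Finset.mul_sum, mul_left_comm] using h
    · simp [ha0 x hx]

/-- The coordinates on the tangent space at `y` in the chart of initial values at `x₀ ∈ y.dom`:
the derivative of a one-parameter family of solutions corresponds to the derivative of its
initial values. -/
def coord (y : Solution f U) (x₀ : ℝ) : y.tangent →ₗ[ℝ] (Fin (k + 1) → ℝ) :=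
  (LinearMap.proj x₀).comp y.tangent.subtype

/-- The curve `γ` in the projectivized tangent space at `y` that is defined by the linearization:
`γ(x)` is the line of all solutions `z` of the linearization with
`z(x) = z'(x) = ⋯ = z^{(k-1)}(x) = 0`. -/
def curve (y : Solution f U) (x : ℝ) : Submodule ℝ y.tangent where
  carrier := {w | ∀ i : Fin k, w.1 x i.castSucc = 0}
  zero_mem' := fun _ => rfl
  add_mem' := by
    intro a b ha hb i
    simp [ha i, hb i]
  smul_mem' := by
    intro r a ha i
    simp [ha i]

end Solution

/-- The generalized Wilczynski invariant `Θ_j`, restricted to a solution `y`. -/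
def genWilczynski (y : Solution f U) (j : ℕ) (x : ℝ) : ℝ :=
  wilczynski y.dom y.linCoeff j x

variable (f U) in
/-- `Θ_j` vanishes identically. -/
def GenWilczynskiVanishes (j : ℕ) : Prop :=
  ∀ y : Solution f U, ∀ x ∈ y.dom, genWilczynski y j x = 0

/-! ### Geometric structures on the solution space

A family of tensor fields proportional to each other by non-zero functional factors is given by
the line that its members span at each point. On every chart (initial values at `x₀`) the family
has to contain a smooth tensor field `g`. -/

variable (f U) in
/-- A pseudo-conformal structure on the solution space. -/
@[ext]
structure PseudoConformalStructure where
  line : ∀ y : Solution f U, Submodule ℝ (LinearMap.BilinForm ℝ y.tangent)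
  exists_metric : ∀ x₀ : ℝ, ∃ g : (Fin (k + 1) → ℝ) → LinearMap.BilinForm ℝ (Fin (k + 1) → ℝ),
    (∀ u w, ContDiffOn ℝ ∞ (fun a => g a u w) (initialValues U x₀)) ∧
    (∀ a ∈ initialValues U x₀, (g a).IsSymm ∧ (g a).Nondegenerate) ∧
    ∀ y : Solution f U, x₀ ∈ y.dom →
      line y = Submodule.span ℝ {(g (y.jet x₀)).comp (y.coord x₀) (y.coord x₀)}

variable (f U) in
/-- A pseudo-symplectic structure on the solution space. -/
@[ext]
structure PseudoSymplecticStructure where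
  line : ∀ y : Solution f U, Submodule ℝ (LinearMap.BilinForm ℝ y.tangent)
  exists_twoForm : ∀ x₀ : ℝ, ∃ g : (Fin (k + 1) → ℝ) → LinearMap.BilinForm ℝ (Fin (k + 1) → ℝ),
    (∀ u w, ContDiffOn ℝ ∞ (fun a => g a u w) (initialValues U x₀)) ∧
    (∀ a ∈ initialValues U x₀, (g a).IsAlt ∧ (g a).Nondegenerate) ∧
    ∀ y : Solution f U, x₀ ∈ y.dom →
      line y = Submodule.span ℝ {(g (y.jet x₀)).comp (y.coord x₀) (y.coord x₀)}

variable (f U) in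
/-- A `G₂`-structure on the solution space, up to a non-zero functional factor. -/
@[ext]
structure G2Structure where
  line : ∀ y : Solution f U, Submodule ℝ (y.tangent [⋀^Fin 3]→ₗ[ℝ] ℝ)
  exists_threeForm : ∀ x₀ : ℝ, ∃ Ω : (Fin (k + 1) → ℝ) → (Fin (k + 1) → ℝ) [⋀^Fin 3]→ₗ[ℝ] ℝ,
    (∀ u, ContDiffOn ℝ ∞ (fun a => Ω a u) (initialValues U x₀)) ∧
    (∀ a ∈ initialValues U x₀, IsG2Form (Ω a)) ∧
    ∀ y : Solution f U, x₀ ∈ y.dom →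
      line y = Submodule.span ℝ {(Ω (y.jet x₀)).compLinearMap (y.coord x₀)}

/-- A structure is natural if at each solution it is compatible with the curve defined by the
linearization. -/
def PseudoConformalStructure.IsNatural (S : PseudoConformalStructure f U) : Prop :=
  ∀ y, ∀ b ∈ S.line y, CompatibleBilin k y.dom y.curve b

/-- Naturality of a pseudo-symplectic structure. -/
def PseudoSymplecticStructure.IsNatural (S : PseudoSymplecticStructure f U) : Prop :=
  ∀ y, ∀ b ∈ S.line y, CompatibleBilin k y.dom y.curve b

/-- Naturality of a `G₂`-structure. -/
def G2Structure.IsNatural (S : G2Structure f U) : Prop :=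
  ∀ y, ∀ Ω ∈ S.line y, CompatibleThreeForm y.dom y.curve Ω

end Equation

end ODEGeometry

end

open scoped ContDiff

noncomputable section

namespace ODEGeometry

open Set Filter Topology

/-! ### Linear first order systems: uniqueness and uniform local existence -/

section LinearODE

variable {n : Type*} [Fintype n]

/-! Fix a solution y and put V = T_yM. Evaluating jets at x identifies V with ℝ^{k+1}, and as x
varies this is a moving frame of V* whose Maurer-Cartan matrix is the companion matrix of the
linearization. An upper triangular gauge brings it to N = X + αH + Σ κ_i Y^i without moving the
osculating flag of γ, since the last i + 1 vectors ε_a of the dual frame span γ^{(i)}. In a frame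
that realizes the Wilczynski invariants, κ_0 = 0 and κ_i = Θ_{i+1} for i ≥ 2. A form on V does not
depend on x, but its components in the dual frame do, and they satisfy a linear equation governed by
N. Naturality says that certain components vanish for all x.

Bilinear forms. Compatibility makes the matrix β of b vanish below the antidiagonal. Let J be the
sl₂-invariant antidiagonal form. Then B = βJ is upper triangular and satisfies B' = BN^σ − NB, where
N^σ is N with the κ_i of even i negated: X, H and odd powers of Y are skew for J, even powers are
self-adjoint. So B is a possibly degenerate gauge transformation between two canonical matrices with
the same α. By `gauge_rigidity` it is a scalar c, and c(κ^σ_i − κ_i) = 0 for i ≥ 1. Hence b is a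
multiple of J, which gives uniqueness, the parity of k (as Jᵀ = (−1)^k J) and Θ_{2i+1} = 0.
Conversely, if these invariants vanish, N is skew for J, and J in the frame is constant along y
(`IsMovingFrame.antidiag_const`).

3-forms. A G₂-form forces k + 1 = 7. Grade the component (a, b, c) by the weight a + b + c.
Compatibility kills enough components of high weight for the structure equations to determine the
others by descending weight (`eq_mul_invCoeff`): the form is a multiple of the sl₂-invariant one,
and κ_2, κ_3, κ_4, κ_6 must vanish. The coefficients κ_1 and κ_5 stay free because Y and Y^5
annihilate the form: under the principal sl₂ the algebra g₂ splits into modules of dimensions 3 and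
11, generated by Y and Y^5. The same annihilation gives the converse
(`IsMovingFrame.invariantForm_const`).

Smoothness on M. Allowing a scalar term κ_0 in N makes the reduction to canonical form purely
algebraic (`exists_canonical_gauge`): it runs on the jet space, with the total derivative in place
of d/dx, and yields one smooth gauge for all solutions. Removing κ_0 needs an integration along each
solution, which is harmless because rigidity holds in every canonical frame and forms matter only up
to a factor. Thus the Wilczynski frame detects the invariants and the universal frame supplies
smooth generators of the same line. -/

theorem lipschitzWith_mulVec (M : Matrix n n ℝ) (K : NNReal) (h : ∀ i, ∑ j, |M i j| ≤ K) :
    LipschitzWith K (fun w : n → ℝ => M.mulVec w) := by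
  refine LipschitzWith.of_dist_le_mul fun u w => ?_
  refine (dist_pi_le_iff (by positivity)).2 fun i => ?_
  rw [Real.dist_eq, ← Pi.sub_apply, ← Matrix.mulVec_sub]
  calc |∑ j, M i j * (u - w) j| ≤ ∑ j, |M i j * (u - w) j| := Finset.abs_sum_le_sum_abs _ _
    _ ≤ ∑ j, |M i j| * dist u w := by
        refine Finset.sum_le_sum fun j _ => ?_
        rw [abs_mul]
        gcongr
        rw [dist_eq_norm]
        exact norm_le_pi_norm (u - w) j
    _ ≤ K * dist u w := by rw [← Finset.sum_mul]; gcongr; exact h i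

theorem exists_bound_of_continuousAt {M : ℝ → Matrix n n ℝ} {t : ℝ}
    (hM : ∀ i j, ContinuousAt (fun s => M s i j) t) :
    ∃ K : NNReal, ∀ᶠ s in 𝓝 t, ∀ i, ∑ j, |M s i j| ≤ K := by
  refine ⟨⟨∑ i, ∑ j, |M t i j| + 1, by positivity⟩, ?_⟩
  rw [eventually_all]
  intro i
  have hc : ContinuousAt (fun s => ∑ j, |M s i j|) t :=
    tendsto_finsetSum _ fun j _ => (hM i j).abs
  have hlt : ∑ j, |M t i j| < ∑ i, ∑ j, |M t i j| + 1 := by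
    have := Finset.single_le_sum (f := fun i => ∑ j, |M t i j|)
      (fun i _ => by positivity) (Finset.mem_univ i)
    linarith
  exact (hc.eventually (gt_mem_nhds hlt)).mono fun s hs => le_of_lt hs

/-- Solutions of a linear system that agree at one point agree on the whole interval. -/
theorem eqOn_of_linear_system {M : ℝ → Matrix n n ℝ} {I : Set ℝ} (hI : IsOpen I)
    (hc : I.OrdConnected) (hM : ∀ i j, ContinuousOn (fun s => M s i j) I)
    {u w : ℝ → n → ℝ} (hu : ∀ t ∈ I, HasDerivAt u ((M t).mulVec (u t)) t)
    (hw : ∀ t ∈ I, HasDerivAt w ((M t).mulVec (w t)) t) {s : ℝ} (hs : s ∈ I) (h : u s = w s) :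
    EqOn u w I := by
  have key : ∀ t ∈ I, u t = w t → u =ᶠ[𝓝 t] w := by
    intro t ht htt
    obtain ⟨K, hK⟩ := exists_bound_of_continuousAt (M := M) (t := t)
      fun i j => (hM i j).continuousAt (hI.mem_nhds ht)
    refine ODE_solution_unique_of_eventually (v := fun t w => (M t).mulVec w) (K := K)
      (s := fun _ => univ) ?_ ?_ ?_ htt
    · exact hK.mono fun s hs => (lipschitzWith_mulVec _ K hs).lipschitzOnWith
    · exact (hI.eventually_mem ht).mono fun s hs => ⟨hu s hs, trivial⟩
    · exact (hI.eventually_mem ht).mono fun s hs => ⟨hw s hs, trivial⟩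
  -- The set of points where the two germs agree is open by definition. It is closed in I because
  -- equality passes to limits and equality at a point gives equality of germs.
  have := hc.isPreconnected.subset_of_closure_inter_subset (u := {t | u =ᶠ[𝓝 t] w})
    (isOpen_setOfPred_eventually_nhds) ⟨s, hs, key s hs h⟩ ?_
  · exact fun t ht => (this ht).self_of_nhds
  · rintro t ⟨ht, htI⟩
    refine key t htI ?_
    have hcl : ∃ᶠ x in 𝓝 t, u x = w x :=
      (mem_closure_iff_frequently.1 ht).mono fun x hx => hx.self_of_nhds
    have h1 : ∃ᶠ x in 𝓝 t, u x - w x = 0 := hcl.mono fun x hx => sub_eq_zero.2 hx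
    have h2 : Tendsto (fun x => u x - w x) (𝓝 t) (𝓝 (u t - w t)) :=
      ((hu t htI).continuousAt.sub (hw t htI).continuousAt)
    have := isClosed_singleton.mem_of_frequently_of_tendsto (s := {(0 : n → ℝ)}) h1 h2
    exact sub_eq_zero.1 this

/-- Near every point a linear system has solutions with arbitrary initial values at arbitrary
points, all on the same interval. -/
theorem exists_local_solution_linear_system {M : ℝ → Matrix n n ℝ} {I : Set ℝ} (hI : IsOpen I)
    (hM : ∀ i j, ContinuousOn (fun s => M s i j) I) {T : ℝ} (hT : T ∈ I) :
    ∃ δ > 0, Ioo (T - δ) (T + δ) ⊆ I ∧ ∀ s ∈ Ioo (T - δ) (T + δ), ∀ a : n → ℝ,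
      ∃ w : ℝ → n → ℝ, w s = a ∧
        ∀ t ∈ Ioo (T - δ) (T + δ), HasDerivAt w ((M t).mulVec (w t)) t := by
  obtain ⟨K, hK⟩ := exists_bound_of_continuousAt (M := M) (t := T)
      fun i j => (hM i j).continuousAt (hI.mem_nhds hT)
  obtain ⟨ε, hε, hball⟩ := Metric.eventually_nhds_iff_ball.1 (hK.and (hI.mem_nhds hT))
  -- The ball of radius ‖a‖ about a is used: there the speed is at most 2K‖a‖, and within time 2δ
  -- the solution moves by at most 4Kδ‖a‖ ≤ ‖a‖. A radius proportional to ‖a‖ makes δ independent of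
  -- a and of the initial time.
  set δ : ℝ := min (ε / 2) (1 / (4 * (K + 1))) with hδ
  have hKpos : (0 : ℝ) < 4 * (K + 1) := by positivity
  have hδ0 : 0 < δ := by positivity
  have hδ1 : δ ≤ ε / 2 := min_le_left _ _
  have hδ2 : δ * (4 * (K + 1)) ≤ 1 := by
    have := min_le_right (ε / 2) (1 / (4 * ((K : ℝ) + 1)))
    rwa [← hδ, le_div_iff₀ hKpos] at this
  have hsub : Icc (T - δ) (T + δ) ⊆ Metric.ball T ε := by
    intro t ht
    rw [Real.ball_eq_Ioo]
    exact ⟨by linarith [ht.1], by linarith [ht.2]⟩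
  refine ⟨δ, hδ0, fun t ht => (hball t (hsub (Ioo_subset_Icc_self ht))).2, fun s hs a => ?_⟩
  have hlip : ∀ t ∈ Icc (T - δ) (T + δ), LipschitzWith K (fun w : n → ℝ => (M t).mulVec w) :=
    fun t ht => lipschitzWith_mulVec _ K (hball t (hsub ht)).1
  have hpl : IsPicardLindelof (fun t w => (M t).mulVec w)
      (⟨s, Ioo_subset_Icc_self hs⟩ : Icc (T - δ) (T + δ)) a ‖a‖₊ 0 (K * (2 * ‖a‖₊)) K := by
    refine ⟨fun t ht => (hlip t ht).lipschitzOnWith, fun x _ => ?_, fun t ht x hx => ?_, ?_⟩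
    · refine continuousOn_pi.2 fun i => ?_
      refine continuousOn_finsetSum _ fun j _ => ?_
      exact ((hM i j).mono fun t ht => (hball t (hsub ht)).2).mul continuousOn_const
    · have h := (hlip t ht).dist_le_mul x 0
      rw [dist_eq_norm, Matrix.mulVec_zero, sub_zero, dist_zero_right] at h
      refine h.trans ?_
      push_cast
      gcongr
      have : ‖x‖ ≤ ‖x - a‖ + ‖a‖ := by simpa using norm_add_le (x - a) a
      rw [mem_closedBall_iff_norm] at hx
      simp only [coe_nnnorm] at hx
      linarith
    · have hmax : max (T + δ - s) (s - (T - δ)) ≤ 2 * δ :=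
        max_le (by linarith [hs.1]) (by linarith [hs.2])
      push_cast
      calc (K : ℝ) * (2 * ‖a‖) * max (T + δ - s) (s - (T - δ))
          ≤ (K : ℝ) * (2 * ‖a‖) * (2 * δ) := by gcongr
        _ = ‖a‖ * (δ * (4 * K)) := by ring
        _ ≤ ‖a‖ * 1 := by gcongr; linarith
        _ = ‖a‖ - 0 := by ring
  obtain ⟨w, hw0, hw⟩ := hpl.exists_eq_forall_mem_Icc_hasDerivWithinAt₀
  exact ⟨w, hw0, fun t ht =>
    (hw t (Ioo_subset_Icc_self ht)).hasDerivAt (Icc_mem_nhds ht.1 ht.2)⟩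

end LinearODE

/-! ### Maximal solutions and global solvability of linear equations -/

section Existence

variable {k : ℕ} {f : ℝ × (Fin (k + 1) → ℝ) → ℝ} {U : Set (ℝ × (Fin (k + 1) → ℝ))}

theorem IsSolutionOn.congr {J : Set ℝ} {c d : ℝ → Fin (k + 1) → ℝ}
    (h : IsSolutionOn f U J c) (hcd : EqOn c d J) : IsSolutionOn f U J d := by
  obtain ⟨ho, hc, hn, hs⟩ := h
  refine ⟨ho, hc, hn, fun x hx => ?_⟩
  obtain ⟨h1, h2, h3⟩ := hs x hx
  have he : ∀ i, (fun s => d s i) =ᶠ[𝓝 x] fun s => c s i := fun i =>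
    (ho.eventually_mem hx).mono fun s hs => by simp only [hcd hs]
  rw [← hcd hx]
  exact ⟨h1, fun i => (h2 i).congr_of_eventuallyEq (he _), h3.congr_of_eventuallyEq (he _)⟩

/-- A function that agrees with a solution near every point of an interval is a solution. -/
theorem isSolutionOn_of_locally {J : Set ℝ} {c : ℝ → Fin (k + 1) → ℝ} (ho : IsOpen J)
    (hc : J.OrdConnected) (hn : J.Nonempty)
    (h : ∀ x ∈ J, ∃ J' d, IsSolutionOn f U J' d ∧ x ∈ J' ∧ EqOn d c J') :
    IsSolutionOn f U J c := by
  refine ⟨ho, hc, hn, fun x hx => ?_⟩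
  obtain ⟨J', d, hd, hx', he⟩ := h x hx
  exact (hd.congr he).2.2.2 x hx'

/-- Every solution extends to a maximal one. -/
theorem exists_solution_extending {J : Set ℝ} {c : ℝ → Fin (k + 1) → ℝ}
    (h : IsSolutionOn f U J c) : ∃ y : Solution f U, J ⊆ y.dom ∧ EqOn c y.jet J := by
  classical
  let S : Type := {s : Set ℝ × (ℝ → Fin (k + 1) → ℝ) //
    IsSolutionOn f U s.1 s.2 ∧ J ⊆ s.1 ∧ EqOn c s.2 J}
  -- Only a preorder, because jets are unconstrained off their interval; hence Zorn's lemma in its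
  -- preorder form.
  let r : S → S → Prop := fun s t => s.1.1 ⊆ t.1.1 ∧ EqOn s.1.2 t.1.2 s.1.1
  have hr : ∀ {a b c : S}, r a b → r b c → r a c := fun {a b c} hab hbc =>
    ⟨hab.1.trans hbc.1, fun x hx => (hab.2 hx).trans (hbc.2 (hab.1 hx))⟩
  have hrefl : ∀ a : S, r a a := fun a => ⟨subset_rfl, fun x _ => rfl⟩
  have : Nonempty S := ⟨⟨(J, c), h, subset_rfl, fun x _ => rfl⟩⟩
  obtain ⟨m, hm⟩ : ∃ m : S, ∀ a, r m a → r a m := by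
    refine exists_maximal_of_nonempty_chains_bounded (r := r) (fun C hC hne => ?_) hr
    obtain ⟨s₀, hs₀⟩ := hne
    have htot : ∀ a ∈ C, ∀ b ∈ C, r a b ∨ r b a := fun a ha b hb => by
      by_cases hab : a = b
      · exact Or.inl (hab ▸ hrefl a)
      · exact hC ha hb hab
    let D : Set ℝ := ⋃ s ∈ C, s.1.1
    let d : ℝ → Fin (k + 1) → ℝ := fun x =>
      if hx : ∃ s ∈ C, x ∈ s.1.1 then hx.choose.1.2 x else 0
    have hd : ∀ s ∈ C, EqOn s.1.2 d s.1.1 := by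
      intro s hs x hx
      have hex : ∃ s ∈ C, x ∈ s.1.1 := ⟨s, hs, hx⟩
      simp only [d, dif_pos hex]
      obtain ⟨h1, h2⟩ := hex.choose_spec
      rcases htot s hs _ h1 with h | h
      · exact h.2 hx
      · exact (h.2 h2).symm
    have hsub : ∀ s ∈ C, s.1.1 ⊆ D := fun s hs => subset_biUnion_of_mem (u := fun s : S => s.1.1) hs
    have hD : IsSolutionOn f U D d := by
      refine isSolutionOn_of_locally (isOpen_biUnion fun s _ => s.2.1.1) ⟨?_⟩
        (s₀.2.1.2.2.1.mono (hsub s₀ hs₀)) ?_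
      · intro x hx z hz
        obtain ⟨s, hs, hxs⟩ := mem_iUnion₂.1 hx
        obtain ⟨t, ht, hzt⟩ := mem_iUnion₂.1 hz
        rcases htot s hs t ht with h | h
        · exact (t.2.1.2.1.out (h.1 hxs) hzt).trans (hsub t ht)
        · exact (s.2.1.2.1.out hxs (h.1 hzt)).trans (hsub s hs)
      · intro x hx
        obtain ⟨s, hs, hxs⟩ := mem_iUnion₂.1 hx
        exact ⟨s.1.1, s.1.2, s.2.1, hxs, hd s hs⟩
    exact ⟨⟨(D, d), hD, s₀.2.2.1.trans (hsub s₀ hs₀), fun x hx =>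
      (s₀.2.2.2 hx).trans (hd s₀ hs₀ (s₀.2.2.1 hx))⟩, fun s hs => ⟨hsub s hs, hd s hs⟩⟩
  obtain ⟨⟨D, d⟩, hD, hJD, hcd⟩ := m
  -- The maximal element is reset to zero off its interval, the normalization that `Solution`
  -- demands.
  have hj : EqOn d (fun x => if x ∈ D then d x else 0) D := fun x hx => by simp [hx]
  refine ⟨⟨D, fun x => if x ∈ D then d x else 0, hD.congr hj, fun x hx => by simp [hx],
    fun J' c' hJ' hsub he => ?_⟩, hJD, fun x hx => (hcd hx).trans (hj (hJD hx))⟩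
  have hdc : EqOn d c' D := fun x hx => (hj hx).trans (he hx).symm
  exact (hm ⟨(J', c'), hJ', hJD.trans hsub, fun x hx => (hcd hx).trans (hdc (hJD hx))⟩
    ⟨hsub, hdc⟩).1.antisymm hsub

/-- Through every point of the domain there is a maximal solution. -/
theorem exists_solution_through (hU : IsOpen U) (hf : ContDiffOn ℝ ∞ f U) {x₀ : ℝ}
    {a : Fin (k + 1) → ℝ} (ha : (x₀, a) ∈ U) :
    ∃ y : Solution f U, x₀ ∈ y.dom ∧ y.jet x₀ = a := by
  -- The equation is made autonomous: x becomes a coordinate of speed 1, which `ht1` later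
  -- identifies with time.
  let v : ℝ × (Fin (k + 1) → ℝ) → ℝ × (Fin (k + 1) → ℝ) :=
    fun q => (1, Fin.snoc (fun i : Fin k => q.2 i.succ) (f q))
  have hfa : ContDiffAt ℝ 1 f (x₀, a) := (hf.contDiffAt (hU.mem_nhds ha)).of_le (by norm_cast)
  have hv : ContDiffAt ℝ 1 v (x₀, a) := by
    refine contDiffAt_const.prodMk (contDiffAt_pi.2 fun i => ?_)
    refine Fin.lastCases ?_ (fun i => ?_) i
    · simpa using hfa
    · simp only [Fin.snoc_castSucc]
      fun_prop
  obtain ⟨u, hu0, ε, hε, hu⟩ :=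
    hv.exists_forall_mem_closedBall_exists_eq_forall_mem_Ioo_hasDerivAt₀ x₀
  have h1 : ∀ t ∈ Ioo (x₀ - ε) (x₀ + ε), HasDerivAt (fun s => (u s).1) 1 t := fun t ht =>
    (hu t ht).fst
  have h2 : ∀ t ∈ Ioo (x₀ - ε) (x₀ + ε), HasDerivAt (fun s => (u s).2) (v (u t)).2 t :=
    fun t ht => (hu t ht).snd
  have hmem : x₀ ∈ Ioo (x₀ - ε) (x₀ + ε) := ⟨by linarith, by linarith⟩
  have ht1 : ∀ t ∈ Ioo (x₀ - ε) (x₀ + ε), (u t).1 = t := by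
    intro t ht
    have := isOpen_Ioo.eqOn_of_deriv_eq isPreconnected_Ioo
      (f := fun s => (u s).1) (g := id) (s := Ioo (x₀ - ε) (x₀ + ε))
      (fun s hs => (h1 s hs).differentiableAt.differentiableWithinAt)
      differentiableOn_id (fun s hs => by rw [(h1 s hs).deriv, deriv_id]) hmem (by simp [hu0])
    exact this ht
  have hcont : ContinuousAt u x₀ := (hu x₀ hmem).continuousAt
  have hev : ∀ᶠ t in 𝓝 x₀, u t ∈ U := hcont.eventually_mem (by rw [hu0]; exact hU.mem_nhds ha)
  obtain ⟨η, hη, hηU⟩ := Metric.eventually_nhds_iff_ball.1 hev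
  set δ := min ε η with hδ
  have hδ0 : 0 < δ := lt_min hε hη
  have hsub : Ioo (x₀ - δ) (x₀ + δ) ⊆ Ioo (x₀ - ε) (x₀ + ε) :=
    Ioo_subset_Ioo (by linarith [min_le_left ε η]) (by linarith [min_le_left ε η])
  have hsol : IsSolutionOn f U (Ioo (x₀ - δ) (x₀ + δ)) (fun t => (u t).2) := by
    refine ⟨isOpen_Ioo, ordConnected_Ioo, ⟨x₀, by linarith, by linarith⟩, fun x hx => ?_⟩
    have he : (x, (u x).2) = u x := Prod.ext (ht1 x (hsub hx)).symm rfl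
    have hd := hasDerivAt_pi.1 (h2 x (hsub hx))
    refine ⟨?_, fun i => ?_, ?_⟩
    · rw [he]
      refine hηU x ?_
      rw [Real.ball_eq_Ioo]
      exact ⟨by linarith [hx.1, min_le_right ε η], by linarith [hx.2, min_le_right ε η]⟩
    · simpa [v] using hd i.castSucc
    · rw [he]
      simpa [v] using hd (Fin.last k)
  obtain ⟨y, hy, hyc⟩ := exists_solution_extending hsol
  have hx₀ : x₀ ∈ Ioo (x₀ - δ) (x₀ + δ) := ⟨by linarith, by linarith⟩
  exact ⟨y, hy hx₀, by rw [← hyc hx₀]; simp only [hu0]⟩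

/-- The linear equation `v^{(k+1)} = p₀ v + ⋯ + p_k v^{(k)}` as a first order system. -/
theorem hasDerivAt_companion_iff {p : Fin (k + 1) → ℝ} {w : ℝ → Fin (k + 1) → ℝ} {x : ℝ} :
    HasDerivAt w ((companion k p).transpose.mulVec (w x)) x ↔
      (∀ i : Fin k, HasDerivAt (fun s => w s i.castSucc) (w x i.succ) x) ∧
      HasDerivAt (fun s => w s (Fin.last k)) (∑ i, p i * w x i) x := by
  have h1 : ∀ i : Fin k, ((companion k p).transpose.mulVec (w x)) i.castSucc = w x i.succ := by
    intro i
    simp only [Matrix.mulVec, dotProduct, Matrix.transpose_apply, companion, slX, Matrix.add_apply,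
      Matrix.of_apply]
    rw [Finset.sum_eq_single i.succ]
    · simp [(Fin.castSucc_lt_last i).ne]
    · intro b _ hb
      have : ¬ (b : ℕ) = i + 1 := fun h => hb (Fin.ext (by simpa using h))
      simp [this, (Fin.castSucc_lt_last i).ne]
    · simp
  have h2 : ((companion k p).transpose.mulVec (w x)) (Fin.last k) = ∑ i, p i * w x i := by
    simp only [Matrix.mulVec, dotProduct, Matrix.transpose_apply, companion, slX, Matrix.add_apply,
      Matrix.of_apply]
    refine Finset.sum_congr rfl fun b _ => ?_
    have : ¬ (b : ℕ) = k + 1 := by have := b.2; omega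
    simp [this]
  rw [hasDerivAt_pi]
  constructor
  · exact fun h => ⟨fun i => h1 i ▸ h i.castSucc, h2 ▸ h (Fin.last k)⟩
  · rintro ⟨ha, hb⟩ i
    refine Fin.lastCases ?_ (fun i => ?_) i
    · rw [h2]; exact hb
    · rw [h1]; exact ha i

theorem continuousOn_companion {I : Set ℝ} {p : Fin (k + 1) → ℝ → ℝ}
    (hp : ∀ i, ContinuousOn (p i) I) (i j : Fin (k + 1)) :
    ContinuousOn (fun s => (companion k fun i => p i s) i j) I := by
  simp only [companion, Matrix.add_apply, Matrix.of_apply]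
  split_ifs
  · exact continuousOn_const.add (hp i)
  · exact continuousOn_const

/-- A linear equation with continuous coefficients on an open interval has solutions on the whole
interval with arbitrary initial values. -/
theorem exists_solution_linear_equation {I : Set ℝ} (hI : IsOpen I) (hc : I.OrdConnected)
    {p : Fin (k + 1) → ℝ → ℝ} (hp : ∀ i, ContinuousOn (p i) I) {s : ℝ} (hs : s ∈ I)
    (a : Fin (k + 1) → ℝ) :
    ∃ w : ℝ → Fin (k + 1) → ℝ, w s = a ∧
      ∀ t ∈ I, HasDerivAt w ((companion k fun i => p i t).transpose.mulVec (w t)) t := by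
  classical
  have hloc := fun T hT => exists_local_solution_linear_system hI
    (M := fun t => (companion k fun i => p i t).transpose)
    (fun i j => continuousOn_companion hp j i) (T := T) hT
  -- Viewing the linear equation as an equation of the general type over I × ℝ^{k+1} provides a
  -- maximal solution, and it remains to see that its interval is all of I.
  let F : ℝ × (Fin (k + 1) → ℝ) → ℝ := fun q => ∑ i, p i q.1 * q.2 i
  have hiff : ∀ {J : Set ℝ} {w : ℝ → Fin (k + 1) → ℝ}, IsOpen J → J.OrdConnected → J.Nonempty →
      (IsSolutionOn F (I ×ˢ univ) J w ↔ J ⊆ I ∧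
        ∀ t ∈ J, HasDerivAt w ((companion k fun i => p i t).transpose.mulVec (w t)) t) := by
    intro J w h1 h2 h3
    constructor
    · rintro ⟨-, -, -, h⟩
      exact ⟨fun t ht => (h t ht).1.1, fun t ht => hasDerivAt_companion_iff.2 (h t ht).2⟩
    · rintro ⟨h, h'⟩
      exact ⟨h1, h2, h3, fun t ht => ⟨⟨h ht, trivial⟩, hasDerivAt_companion_iff.1 (h' t ht)⟩⟩
  obtain ⟨δ, hδ, hsub, hex⟩ := hloc s hs
  have hsm : s ∈ Ioo (s - δ) (s + δ) := ⟨by linarith, by linarith⟩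
  obtain ⟨w, hw0, hw⟩ := hex s hsm a
  obtain ⟨y, hy, hyw⟩ := exists_solution_extending
    ((hiff isOpen_Ioo ordConnected_Ioo ⟨s, hsm⟩).2 ⟨hsub, hw⟩)
  obtain ⟨ho, hcy, hny, -⟩ := y.isSolution
  obtain ⟨hyI, hyd⟩ := (hiff ho hcy hny).1 y.isSolution
  suffices hIy : I ⊆ y.dom from
    ⟨y.jet, by rw [← hyw hsm, hw0], fun t ht => hyd t (hIy ht)⟩
  -- The interval is open, so it suffices that it is closed in I. At a boundary point T, the uniform
  -- local existence interval about T contains a point r where the solution is already defined.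
  -- Restarting from r and gluing extends the solution past T, against maximality.
  refine hc.isPreconnected.subset_of_closure_inter_subset ho ⟨s, hs, hy hsm⟩ ?_
  rintro T ⟨hT, hTI⟩
  obtain ⟨η, hη, hηI, hηex⟩ := hloc T hTI
  have hTm : T ∈ Ioo (T - η) (T + η) := ⟨by linarith, by linarith⟩
  obtain ⟨r, hr, hry⟩ := mem_closure_iff.1 hT _ isOpen_Ioo hTm
  obtain ⟨u, hu0, hu⟩ := hηex r hr (y.jet r)
  have hinter : EqOn u y.jet (y.dom ∩ Ioo (T - η) (T + η)) :=
    eqOn_of_linear_system (M := fun t => (companion k fun i => p i t).transpose)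
      (ho.inter isOpen_Ioo) (hcy.inter ordConnected_Ioo)
      (fun i j => (continuousOn_companion hp j i).mono fun t ht => hyI ht.1)
      (fun t ht => hu t ht.2) (fun t ht => hyd t ht.1) ⟨hry, hr⟩ hu0
  let g : ℝ → Fin (k + 1) → ℝ := fun t => if t ∈ y.dom then y.jet t else u t
  have hg1 : EqOn y.jet g y.dom := fun t ht => by simp [g, ht]
  have hg2 : EqOn u g (Ioo (T - η) (T + η)) := fun t ht => by
    by_cases h : t ∈ y.dom
    · simp [g, h, hinter ⟨h, ht⟩]
    · simp [g, h]
  have hun : IsSolutionOn F (I ×ˢ univ) (y.dom ∪ Ioo (T - η) (T + η)) g := by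
    refine isSolutionOn_of_locally (ho.union isOpen_Ioo) ?_ (hny.mono subset_union_left) ?_
    · exact (hcy.isPreconnected.union r hry hr isPreconnected_Ioo).ordConnected
    · rintro x (hx | hx)
      · exact ⟨_, _, y.isSolution, hx, hg1⟩
      · exact ⟨_, _, (hiff isOpen_Ioo ordConnected_Ioo ⟨r, hr⟩).2 ⟨hηI, hu⟩, hx, hg2⟩
  have := y.maximal _ g hun subset_union_left hg1.symm
  rw [← this]
  exact Or.inr hTm

end Existence

/-! ### The grading by superdiagonals, commutators with X, and rigidity of canonical matrices -/

section Grading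

variable {k : ℕ}

/-- The entries of `M` vanish below the `d`-th superdiagonal. -/
def UpperDeg (d : ℤ) (M : Matrix (Fin (k + 1)) (Fin (k + 1)) ℝ) : Prop :=
  ∀ i j : Fin (k + 1), (j : ℤ) < i + d → M i j = 0

namespace UpperDeg

variable {d e : ℤ} {M N : Matrix (Fin (k + 1)) (Fin (k + 1)) ℝ}

theorem mono (h : UpperDeg d M) (hde : e ≤ d) : UpperDeg e M :=
  fun i j hij => h i j (by omega)

theorem zero : UpperDeg d (0 : Matrix (Fin (k + 1)) (Fin (k + 1)) ℝ) := fun _ _ _ => rfl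

theorem add (hM : UpperDeg d M) (hN : UpperDeg d N) : UpperDeg d (M + N) :=
  fun i j h => by simp [hM i j h, hN i j h]

theorem sub (hM : UpperDeg d M) (hN : UpperDeg d N) : UpperDeg d (M - N) :=
  fun i j h => by simp [hM i j h, hN i j h]

theorem neg (hM : UpperDeg d M) : UpperDeg d (-M) :=
  fun i j h => by simp [hM i j h]

theorem smul (c : ℝ) (hM : UpperDeg d M) : UpperDeg d (c • M) :=
  fun i j h => by simp [hM i j h]

theorem sum {ι : Type*} {s : Finset ι} {F : ι → Matrix (Fin (k + 1)) (Fin (k + 1)) ℝ}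
    (h : ∀ i ∈ s, UpperDeg d (F i)) : UpperDeg d (∑ i ∈ s, F i) :=
  Finset.sum_induction _ (UpperDeg d) (fun _ _ => add) zero h

theorem mul (hM : UpperDeg d M) (hN : UpperDeg e N) : UpperDeg (d + e) (M * N) := by
  intro i j h
  rw [Matrix.mul_apply]
  refine Finset.sum_eq_zero fun l _ => ?_
  by_cases hl : (l : ℤ) < i + d
  · rw [hM i l hl, zero_mul]
  · rw [hN l j (by omega), mul_zero]

theorem one : UpperDeg 0 (1 : Matrix (Fin (k + 1)) (Fin (k + 1)) ℝ) :=
  fun i j h => Matrix.one_apply_ne (by rintro rfl; omega)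

theorem eq_zero (h : UpperDeg (k + 1) M) : M = 0 := by
  ext i j
  exact h i j (by have := j.2; omega)

theorem of_slX : UpperDeg (-1) (slX k) := fun i j h => by
  simp only [slX, Matrix.of_apply, ite_eq_right_iff]
  omega

theorem of_slH : UpperDeg 0 (slH k) := fun i j h =>
  Matrix.diagonal_apply_ne _ (by rintro rfl; omega)

end UpperDeg

theorem upperDeg_zero_iff {M : Matrix (Fin (k + 1)) (Fin (k + 1)) ℝ} :
    UpperDeg 0 M ↔ M.BlockTriangular id := by
  constructor
  · exact fun h i j hij => h i j (by have : (j : ℕ) < i := hij; omega)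
  · exact fun h i j hij => h (show j < i from by rw [Fin.lt_def]; omega)

/-- Positivity is what matters later: sums of entries of `slY k ^ d` along its superdiagonal cannot
cancel, whereas for commutators with X they telescope to zero. -/
theorem slY_pow_apply (d : ℕ) (i j : Fin (k + 1)) :
    ((j : ℕ) ≠ i + d → (slY k ^ d) i j = 0) ∧ ((j : ℕ) = i + d → 0 < (slY k ^ d) i j) := by
  induction d generalizing j with
  | zero =>
    refine ⟨fun h => ?_, fun h => ?_⟩
    · exact Matrix.one_apply_ne (by rintro rfl; simp at h)
    · have : i = j := Fin.ext (by omega)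
      subst this
      simp
  | succ d ih =>
    rw [pow_succ, Matrix.mul_apply]
    refine ⟨fun h => Finset.sum_eq_zero fun l _ => ?_, fun h => ?_⟩
    · by_cases hl : (l : ℕ) = i + d
      · have : ¬ (j : ℕ) = l + 1 := by omega
        simp [slY, this]
      · rw [(ih l).1 hl, zero_mul]
    · have hj := j.2
      set l₀ : Fin (k + 1) := ⟨i + d, by omega⟩
      rw [Finset.sum_eq_single l₀]
      · refine mul_pos ((ih l₀).2 rfl) ?_
        have h1 : (j : ℕ) = (l₀ : ℕ) + 1 := by simp only [l₀]; omega
        simp only [slY, Matrix.of_apply, if_pos h1]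
        have h2 : ((j : ℕ) : ℝ) < (k : ℝ) + 1 := by exact_mod_cast hj
        have h3 : (0 : ℝ) < ((j : ℕ) : ℝ) := by exact_mod_cast (by omega : 0 < (j : ℕ))
        exact mul_pos h3 (by linarith)
      · intro l _ hl
        rw [(ih l).1 fun h => hl (Fin.ext h), zero_mul]
      · simp

theorem UpperDeg.slY_pow (d : ℕ) : UpperDeg d (slY k ^ d) := fun i j h =>
  (slY_pow_apply d i j).1 (by omega)

/-- The entries of a matrix, extended by zero. -/
def entry (M : Matrix (Fin (k + 1)) (Fin (k + 1)) ℝ) (a b : ℕ) : ℝ :=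
  if h : a < k + 1 ∧ b < k + 1 then M ⟨a, h.1⟩ ⟨b, h.2⟩ else 0

@[simp] theorem entry_val (M : Matrix (Fin (k + 1)) (Fin (k + 1)) ℝ) (i j : Fin (k + 1)) :
    entry M i j = M i j :=
  dif_pos ⟨i.2, j.2⟩

theorem entry_of_lt (M : Matrix (Fin (k + 1)) (Fin (k + 1)) ℝ) {a b : ℕ} (ha : a < k + 1)
    (hb : b < k + 1) : entry M a b = M ⟨a, ha⟩ ⟨b, hb⟩ := by simp [entry, ha, hb]

theorem entry_of_not_lt (M : Matrix (Fin (k + 1)) (Fin (k + 1)) ℝ) {a b : ℕ}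
    (hb : ¬ b < k + 1) : entry M a b = 0 := by simp [entry, hb]

theorem slX_mul_apply_zero (M : Matrix (Fin (k + 1)) (Fin (k + 1)) ℝ) {i : Fin (k + 1)}
    (hi : (i : ℕ) = 0) (j : Fin (k + 1)) : (slX k * M) i j = 0 := by
  rw [Matrix.mul_apply]
  refine Finset.sum_eq_zero fun l _ => ?_
  simp [slX, hi]

theorem slX_mul_apply_succ (M : Matrix (Fin (k + 1)) (Fin (k + 1)) ℝ) {i : Fin (k + 1)} {a : ℕ}
    (hi : (i : ℕ) = a + 1) (j : Fin (k + 1)) : (slX k * M) i j = entry M a j := by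
  have ha : a < k + 1 := by have := i.2; omega
  rw [Matrix.mul_apply, Finset.sum_eq_single (⟨a, ha⟩ : Fin (k + 1))]
  · rw [entry_of_lt M ha j.2]; simp [slX, hi]
  · intro l _ hl
    have : ¬ (i : ℕ) = l + 1 := fun h => hl (Fin.ext (by simp; omega))
    simp [slX, this]
  · simp

theorem mul_slX_apply (M : Matrix (Fin (k + 1)) (Fin (k + 1)) ℝ) (i j : Fin (k + 1)) :
    (M * slX k) i j = entry M i (j + 1) := by
  rw [Matrix.mul_apply]
  by_cases hj : (j : ℕ) + 1 < k + 1
  · rw [Finset.sum_eq_single (⟨j + 1, hj⟩ : Fin (k + 1))]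
    · rw [entry_of_lt M i.2 hj]; simp [slX]
    · intro l _ hl
      have : ¬ (l : ℕ) = j + 1 := fun h => hl (Fin.ext h)
      simp [slX, this]
    · simp
  · rw [entry_of_not_lt M hj]
    refine Finset.sum_eq_zero fun l _ => ?_
    have : ¬ (l : ℕ) = j + 1 := by have := l.2; omega
    simp [slX, this]

/-- On strictly upper triangular matrices of degree `d + 1` the map `B ↦ [x, B]` is injective and
its image does not contain `y ^ d`. -/
theorem UpperDeg.of_commutator_slX {d : ℕ} {B : Matrix (Fin (k + 1)) (Fin (k + 1)) ℝ} {κ : ℝ}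
    (hB : UpperDeg (d + 1 : ℕ) B)
    (h : UpperDeg (d + 1 : ℕ) (slX k * B - B * slX k - κ • slY k ^ d)) :
    UpperDeg (d + 2 : ℕ) B ∧ (d ≤ k → κ = 0) := by
  have hrec : ∀ i j : Fin (k + 1), (j : ℕ) = i + d →
      (slX k * B) i j = entry B i (j + 1) + κ * (slY k ^ d) i j := by
    intro i j hij
    have := h i j (by push_cast; omega)
    rw [Matrix.sub_apply, Matrix.sub_apply, mul_slX_apply, Matrix.smul_apply, smul_eq_mul] at this
    linarith
  -- Reading the d-th superdiagonal row by row expresses the entries of B as −κ times partial sums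
  -- of the positive entries of Y^d. In row k − d the entry of B lies outside the matrix and is
  -- zero, which forces κ = 0, and then all these entries vanish.
  have hb : ∀ a : ℕ, a + d < k + 1 → ∃ s : ℝ, 0 < s ∧ entry B a (a + d + 1) = -(κ * s) := by
    intro a
    induction a with
    | zero =>
      intro ha
      have h1 := hrec ⟨0, by omega⟩ ⟨0 + d, ha⟩ rfl
      rw [slX_mul_apply_zero B rfl] at h1
      exact ⟨_, (slY_pow_apply d ⟨0, by omega⟩ ⟨0 + d, ha⟩).2 rfl, by linarith⟩
    | succ a ih =>
      intro ha
      obtain ⟨s, hs, he⟩ := ih (by omega)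
      have h1 := hrec ⟨a + 1, by omega⟩ ⟨a + 1 + d, ha⟩ rfl
      rw [slX_mul_apply_succ B (a := a) rfl] at h1
      refine ⟨s + _, add_pos hs ((slY_pow_apply d ⟨a + 1, by omega⟩ ⟨a + 1 + d, ha⟩).2 rfl), ?_⟩
      have e1 : a + d + 1 = a + 1 + d := by omega
      simp only [e1] at he h1
      linarith
  have hκ : d ≤ k → κ = 0 := by
    intro hd
    obtain ⟨s, hs, he⟩ := hb (k - d) (by omega)
    rw [entry_of_not_lt B (by omega)] at he
    have : κ * s = 0 := by linarith
    exact (mul_eq_zero.1 this).resolve_right hs.ne'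
  refine ⟨fun i j hij => ?_, hκ⟩
  by_cases hlt : (j : ℤ) < i + (d + 1 : ℕ)
  · exact hB i j hlt
  · have hj : (j : ℕ) = i + d + 1 := by omega
    obtain ⟨s, -, he⟩ := hb i (by have := j.2; omega)
    rw [← hj, entry_val] at he
    rw [he, hκ (by have := j.2; omega), zero_mul, neg_zero]

/-- An upper triangular matrix whose commutator with `x` is upper triangular has a constant
diagonal. -/
theorem UpperDeg.sub_diag_of_commutator_slX {B : Matrix (Fin (k + 1)) (Fin (k + 1)) ℝ}
    (hB : UpperDeg 0 B) (h : UpperDeg 0 (slX k * B - B * slX k)) :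
    UpperDeg 1 (B - B 0 0 • (1 : Matrix (Fin (k + 1)) (Fin (k + 1)) ℝ)) := by
  have hb : ∀ a : ℕ, a < k + 1 → entry B a a = B 0 0 := by
    intro a
    induction a with
    | zero => intro _; exact entry_val B 0 0
    | succ a ih =>
      intro ha
      have h1 := h ⟨a + 1, ha⟩ ⟨a, by omega⟩ (by simp)
      rw [Matrix.sub_apply, mul_slX_apply, slX_mul_apply_succ B (a := a) rfl, ih (by omega)] at h1
      simp only at h1
      linarith
  intro i j hij
  by_cases hlt : (j : ℤ) < i + 0
  · rw [Matrix.sub_apply, hB i j hlt, Matrix.smul_apply, Matrix.one_apply_ne (by rintro rfl; omega)]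
    simp
  · have hj : i = j := Fin.ext (by omega)
    subst hj
    have := hb i i.2
    rw [entry_val] at this
    simp [this]

/-- The sum of the entries on the `d`-th superdiagonal. -/
def superTrace (k d : ℕ) : Matrix (Fin (k + 1)) (Fin (k + 1)) ℝ →ₗ[ℝ] ℝ where
  toFun M := ∑ a ∈ Finset.range (k + 1), entry M a (a + d)
  map_add' M N := by
    rw [← Finset.sum_add_distrib]
    refine Finset.sum_congr rfl fun a _ => ?_
    simp only [entry]; split_ifs <;> simp
  map_smul' c M := by
    rw [RingHom.id_apply, smul_eq_mul, Finset.mul_sum]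
    refine Finset.sum_congr rfl fun a _ => ?_
    simp only [entry]; split_ifs <;> simp

/-- The matrix on the `(d + 1)`-st superdiagonal formed by the partial sums of the `d`-th one. -/
def partialSums (k d : ℕ) : Matrix (Fin (k + 1)) (Fin (k + 1)) ℝ →ₗ[ℝ]
    Matrix (Fin (k + 1)) (Fin (k + 1)) ℝ where
  toFun M := Matrix.of fun i j =>
    if (j : ℕ) = i + d + 1 then ∑ a ∈ Finset.range (i + 1), entry M a (a + d) else 0
  map_add' M N := by
    ext i j
    simp only [Matrix.of_apply, Matrix.add_apply]
    split_ifs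
    · rw [← Finset.sum_add_distrib]
      refine Finset.sum_congr rfl fun a _ => ?_
      simp only [entry]; split_ifs <;> simp
    · simp
  map_smul' c M := by
    ext i j
    simp only [Matrix.of_apply, Matrix.smul_apply, RingHom.id_apply, smul_eq_mul]
    split_ifs
    · rw [Finset.mul_sum]
      refine Finset.sum_congr rfl fun a _ => ?_
      simp only [entry]; split_ifs <;> simp
    · simp

/-- This makes Y^d span a complement to the commutators with X in degree d, which have zero sum
along the d-th superdiagonal. -/
theorem superTrace_slY_pow_pos {d : ℕ} (hd : d ≤ k) : 0 < superTrace k d (slY k ^ d) := by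
  have hterm : ∀ a ∈ Finset.range (k + 1), 0 ≤ entry (slY k ^ d) a (a + d) := by
    intro a _
    simp only [entry]
    split_ifs with h
    · exact ((slY_pow_apply d ⟨a, h.1⟩ ⟨a + d, h.2⟩).2 rfl).le
    · exact le_rfl
  refine Finset.sum_pos' hterm ⟨0, by simp, ?_⟩
  rw [entry_of_lt _ (by omega) (by omega)]
  exact (slY_pow_apply d ⟨0, by omega⟩ ⟨0 + d, by omega⟩).2 rfl

/-- Modulo `y ^ d`, every matrix of degree `d` is up to higher degree a commutator with `x`. -/
theorem exists_solve_commutator_slX {d : ℕ} (hd : d ≤ k) :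
    ∃ (S : Matrix (Fin (k + 1)) (Fin (k + 1)) ℝ →ₗ[ℝ] Matrix (Fin (k + 1)) (Fin (k + 1)) ℝ)
      (κ : Matrix (Fin (k + 1)) (Fin (k + 1)) ℝ →ₗ[ℝ] ℝ), ∀ M, UpperDeg (d + 1 : ℕ) (S M) ∧
        (UpperDeg d M →
          UpperDeg (d + 1 : ℕ) (slX k * S M - S M * slX k + M - κ M • slY k ^ d)) := by
  set τ := superTrace k d with hτ
  have hpos := superTrace_slY_pow_pos hd
  let κ : Matrix (Fin (k + 1)) (Fin (k + 1)) ℝ →ₗ[ℝ] ℝ := (τ (slY k ^ d))⁻¹ • τ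
  let π : Matrix (Fin (k + 1)) (Fin (k + 1)) ℝ →ₗ[ℝ] Matrix (Fin (k + 1)) (Fin (k + 1)) ℝ :=
    LinearMap.id - κ.smulRight (slY k ^ d)
  have hπ : ∀ M, π M = M - κ M • slY k ^ d := fun M => rfl
  have hτπ : ∀ M, τ (π M) = 0 := by
    intro M
    have : τ (slY k ^ d) ≠ 0 := hpos.ne'
    rw [hπ, map_sub, map_smul]
    simp only [κ, LinearMap.smul_apply, smul_eq_mul]
    field_simp
    ring
  have hdeg : ∀ M, UpperDeg (d + 1 : ℕ) (partialSums k d M) := by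
    intro M i j hij
    have : ¬ (j : ℕ) = i + d + 1 := by omega
    simp [partialSums, this]
  refine ⟨(partialSums k d).comp π, κ, fun M => ⟨hdeg _, fun hM i j hij => ?_⟩⟩
  have hpi : UpperDeg d (π M) := hM.sub ((UpperDeg.slY_pow d).smul _)
  rw [add_sub_assoc, ← hπ, LinearMap.comp_apply]
  set P := π M with hP
  by_cases hlt : (j : ℤ) < i + (d : ℕ)
  · have h1 : UpperDeg ((d + 1 : ℕ) + (-1)) (partialSums k d P * slX k) :=
      (hdeg P).mul UpperDeg.of_slX
    have h2 : UpperDeg (-1 + (d + 1 : ℕ)) (slX k * partialSums k d P) :=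
      UpperDeg.of_slX.mul (hdeg P)
    rw [Matrix.add_apply, Matrix.sub_apply, h1 i j (by push_cast; omega),
      h2 i j (by push_cast; omega), hpi i j hlt]
    simp
  · have hj : (j : ℕ) = i + d := by omega
    -- Right multiplication by X gives the partial sum through row i, left multiplication the one
    -- through row i − 1, so the commutator is −P. In the last admissible row the partial sum would
    -- have to sit outside the matrix; it is the total sum, zero because Y^d has been projected out.
    have hBX : (partialSums k d P * slX k) i j =
        ∑ a ∈ Finset.range (i + 1), entry P a (a + d) := by
      rw [mul_slX_apply]
      by_cases hj1 : (j : ℕ) + 1 < k + 1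
      · rw [entry_of_lt _ i.2 hj1]
        simp [partialSums, hj]
      · rw [entry_of_not_lt _ hj1, ← hτπ M]
        have hik : (i : ℕ) + 1 ≤ k + 1 := by have := i.2; omega
        rw [hτ]
        change ∑ a ∈ Finset.range (k + 1), entry P a (a + d) = _
        refine (Finset.sum_subset (Finset.range_subset_range.2 hik) fun a ha hai => ?_).symm
        simp only [Finset.mem_range] at ha hai
        exact entry_of_not_lt _ (by omega)
    have hXB : (slX k * partialSums k d P) i j =
        ∑ a ∈ Finset.range i, entry P a (a + d) := by
      rcases Nat.eq_zero_or_pos (i : ℕ) with h0 | h0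
      · rw [slX_mul_apply_zero _ h0, h0]; simp
      · obtain ⟨a, ha⟩ : ∃ a, (i : ℕ) = a + 1 := ⟨i - 1, by omega⟩
        rw [slX_mul_apply_succ _ ha, entry_of_lt _ (by have := i.2; omega) j.2,
          congrArg Finset.range ha]
        have : (j : ℕ) = a + d + 1 := by omega
        simp [partialSums, this]
    rw [Matrix.add_apply, Matrix.sub_apply, hBX, hXB, Finset.sum_range_succ, ← hj, entry_val]
    ring

/-- The Maurer-Cartan matrix of a canonical frame: `x` plus a multiple of `h` plus a polynomial
in `y`. -/
def canonicalMatrix (k : ℕ) (α : ℝ) (κ : ℕ → ℝ) : Matrix (Fin (k + 1)) (Fin (k + 1)) ℝ :=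
  slX k + α • slH k + ∑ i ∈ Finset.range (k + 1), κ i • slY k ^ i

theorem upperDeg_sum_slY_pow (κ : ℕ → ℝ) :
    UpperDeg 0 (∑ i ∈ Finset.range (k + 1), κ i • slY k ^ i) :=
  UpperDeg.sum fun i _ => ((UpperDeg.slY_pow i).smul _).mono (by omega)

/-- A gauge transformation between two canonical matrices with the same coefficient of `h` is
a scalar. -/
theorem gauge_rigidity {I : Set ℝ} (hI : IsOpen I)
    {B B' : ℝ → Matrix (Fin (k + 1)) (Fin (k + 1)) ℝ} {α : ℝ → ℝ} {κ κ' : ℕ → ℝ → ℝ}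
    (hB : ∀ t ∈ I, ∀ i j, HasDerivAt (fun s => B s i j) (B' t i j) t)
    (hup : ∀ t ∈ I, UpperDeg 0 (B t))
    (heq : ∀ t ∈ I, B' t = B t * canonicalMatrix k (α t) (fun i => κ' i t) -
      canonicalMatrix k (α t) (fun i => κ i t) * B t) :
    ∀ t ∈ I, B t = B t 0 0 • (1 : Matrix (Fin (k + 1)) (Fin (k + 1)) ℝ) ∧
      ∀ i, 1 ≤ i → i ≤ k → B t 0 0 * (κ' i t - κ i t) = 0 := by
  -- Entries that vanish on the open set I have vanishing derivative, so B' inherits every degree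
  -- bound obtained for B.
  have hB'deg : ∀ d : ℤ, (∀ t ∈ I, UpperDeg d (B t - B t 0 0 • 1)) →
      ∀ t ∈ I, UpperDeg d (B' t - B' t 0 0 • 1) := by
    intro d h t ht i j hij
    have h1 : HasDerivAt (fun s => (B s - B s 0 0 • (1 : Matrix (Fin (k + 1)) (Fin (k + 1)) ℝ)) i j)
        ((B' t - B' t 0 0 • (1 : Matrix (Fin (k + 1)) (Fin (k + 1)) ℝ)) i j) t := by
      simp only [Matrix.sub_apply, Matrix.smul_apply, smul_eq_mul]
      exact (hB t ht i j).sub ((hB t ht 0 0).mul_const _)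
    refine h1.unique ((hasDerivAt_const t (0 : ℝ)).congr_of_eventuallyEq ?_)
    exact (hI.eventually_mem ht).mono fun s hs => h s hs i j hij
  have hB'0 : ∀ t ∈ I, UpperDeg 0 (B' t) := by
    intro t ht i j hij
    refine (hB t ht i j).unique ((hasDerivAt_const t (0 : ℝ)).congr_of_eventuallyEq ?_)
    exact (hI.eventually_mem ht).mono fun s hs => hup s hs i j hij
  -- With B = c + B₁, the scalar part of the equation contributes e_i to the coefficient of Y^i.
  -- Only e_0 involves c', so for i ≥ 1 the vanishing of e_i is the asserted obstruction.
  let e : ℕ → ℝ → ℝ := fun i t => B t 0 0 * (κ' i t - κ i t) - if i = 0 then B' t 0 0 else 0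
  have key : ∀ m : ℕ, ∀ t ∈ I, UpperDeg (m + 1 : ℕ) (B t - B t 0 0 • 1) ∧
      ∀ i, i < m → i ≤ k → e i t = 0 := by
    intro m
    induction m with
    | zero =>
      intro t ht
      refine ⟨?_, fun i hi => absurd hi (Nat.not_lt_zero i)⟩
      refine (hup t ht).sub_diag_of_commutator_slX ?_
      have : slX k * B t - B t * slX k =
          -B' t + α t • (B t * slH k - slH k * B t)
            + B t * (∑ i ∈ Finset.range (k + 1), κ' i t • slY k ^ i)
            - (∑ i ∈ Finset.range (k + 1), κ i t • slY k ^ i) * B t := by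
        rw [heq t ht, canonicalMatrix, canonicalMatrix]
        simp only [mul_add, add_mul, smul_sub, Matrix.mul_smul, Matrix.smul_mul]
        abel
      rw [this]
      have hu := hup t ht
      have h1 := hu.mul UpperDeg.of_slH
      have h2 := UpperDeg.of_slH.mul hu
      have h3 := hu.mul (upperDeg_sum_slY_pow (k := k) fun i => κ' i t)
      have h4 := (upperDeg_sum_slY_pow (k := k) fun i => κ i t).mul hu
      rw [add_zero] at h1 h2 h3 h4
      exact (((hB'0 t ht).neg.add ((h1.sub h2).smul _)).add h3).sub h4
    | succ m ih =>
      intro t ht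
      obtain ⟨hu, he⟩ := ih t ht
      have hu' := hB'deg (m + 1 : ℕ) (fun s hs => (ih s hs).1) t ht
      set B₁ := B t - B t 0 0 • (1 : Matrix (Fin (k + 1)) (Fin (k + 1)) ℝ) with hB₁
      have hBt : B t = B₁ + B t 0 0 • 1 := by rw [hB₁]; abel
      have hsum : ∑ i ∈ Finset.range (k + 1), e i t • slY k ^ i =
          B t 0 0 • (∑ i ∈ Finset.range (k + 1), κ' i t • slY k ^ i
            - ∑ i ∈ Finset.range (k + 1), κ i t • slY k ^ i) - B' t 0 0 • 1 := by
        simp only [e, sub_smul, ite_smul, zero_smul, Finset.sum_sub_distrib]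
        congr 1
        · rw [smul_sub, Finset.smul_sum, Finset.smul_sum, ← Finset.sum_sub_distrib]
          refine Finset.sum_congr rfl fun i _ => ?_
          rw [smul_smul, smul_smul, ← sub_smul]
          congr 1; ring
        · rw [Finset.sum_ite_eq' (Finset.range (k + 1)) 0]
          simp
      -- Everything except the commutator with X and the leading term e_m Y^m has degree at least m
      -- + 1. In particular the α terms enter only through [B₁, H], because both canonical matrices
      -- have the same α. The `if` covers m > k, where the sum has no such term.
      have hcomm : slX k * B₁ - B₁ * slX k - (if m ≤ k then e m t else 0) • slY k ^ m =
          -(B' t - B' t 0 0 • 1) + α t • (B₁ * slH k - slH k * B₁)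
            + B₁ * (∑ i ∈ Finset.range (k + 1), κ' i t • slY k ^ i)
            - (∑ i ∈ Finset.range (k + 1), κ i t • slY k ^ i) * B₁
            + (∑ i ∈ Finset.range (k + 1), e i t • slY k ^ i
              - (if m ≤ k then e m t else 0) • slY k ^ m) := by
        rw [hsum, heq t ht, canonicalMatrix, canonicalMatrix]
        generalize (∑ i ∈ Finset.range (k + 1), κ' i t • slY k ^ i) = T'
        generalize (∑ i ∈ Finset.range (k + 1), κ i t • slY k ^ i) = T
        generalize B' t 0 0 = c'
        generalize B t 0 0 = c at hBt
        rw [hBt]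
        simp only [mul_add, add_mul, smul_sub, Matrix.mul_smul, Matrix.smul_mul,
          one_mul, mul_one, smul_comm c (α t)]
        abel
      have hrest : UpperDeg (m + 1 : ℕ) (∑ i ∈ Finset.range (k + 1), e i t • slY k ^ i
              - (if m ≤ k then e m t else 0) • slY k ^ m) := by
        have : (if m ≤ k then e m t else 0) • slY k ^ m =
            ∑ i ∈ Finset.range (k + 1), if i = m then e i t • slY k ^ i else 0 := by
          rw [Finset.sum_ite_eq']
          simp only [Finset.mem_range, Nat.lt_succ_iff]
          split_ifs <;> simp
        rw [this, ← Finset.sum_sub_distrib]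
        refine UpperDeg.sum fun i hi => ?_
        rcases lt_trichotomy i m with h | h | h
        · rw [he i h (by simpa [Nat.lt_succ_iff] using hi)]
          simpa [h.ne] using UpperDeg.zero
        · simpa [h] using UpperDeg.zero
        · simpa [h.ne'] using ((UpperDeg.slY_pow i).smul _).mono (by omega)
      have h1 := hu.mul UpperDeg.of_slH
      have h2 := UpperDeg.of_slH.mul hu
      have h3 := hu.mul (upperDeg_sum_slY_pow (k := k) fun i => κ' i t)
      have h4 := (upperDeg_sum_slY_pow (k := k) fun i => κ i t).mul hu
      simp only [add_zero, zero_add] at h1 h2 h3 h4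
      have := hu.of_commutator_slX (d := m) (κ := if m ≤ k then e m t else 0) (by
        rw [hcomm]
        exact (((hu'.neg.add ((h1.sub h2).smul _)).add h3).sub h4).add hrest)
      refine ⟨this.1, fun i hi hik => ?_⟩
      rcases Nat.lt_succ_iff_lt_or_eq.1 hi with h | h
      · exact he i h hik
      · subst h
        simpa [hik] using this.2 hik
  intro t ht
  obtain ⟨h1, h2⟩ := key (k + 1) t ht
  refine ⟨?_, fun i hi hik => ?_⟩
  · exact sub_eq_zero.1 (UpperDeg.eq_zero (h1.mono (by push_cast; omega)))
  · have := h2 i (by omega) hik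
    simpa [e, Nat.one_le_iff_ne_zero.1 hi] using this

end Grading

/-! ### Reduction of companion matrices to canonical form, smoothly on the jet space -/

section CanonicalGauge

variable {k : ℕ} {E : Type*} [NormedAddCommGroup E] [NormedSpace ℝ E] {U : Set E}

theorem contDiffOn_matrix_mul {n : WithTop ℕ∞} {M N : E → Matrix (Fin (k + 1)) (Fin (k + 1)) ℝ}
    (hM : ∀ i j, ContDiffOn ℝ n (fun q => M q i j) U)
    (hN : ∀ i j, ContDiffOn ℝ n (fun q => N q i j) U) (i j : Fin (k + 1)) :
    ContDiffOn ℝ n (fun q => (M q * N q) i j) U := by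
  simp only [Matrix.mul_apply]
  exact ContDiffOn.sum fun l _ => (hM i l).mul (hN l j)

theorem contDiffOn_matrix_linearMap {n : WithTop ℕ∞}
    {M : E → Matrix (Fin (k + 1)) (Fin (k + 1)) ℝ}
    (hM : ∀ i j, ContDiffOn ℝ n (fun q => M q i j) U)
    (L : Matrix (Fin (k + 1)) (Fin (k + 1)) ℝ →ₗ[ℝ] ℝ) :
    ContDiffOn ℝ n (fun q => L (M q)) U := by
  have : ∀ q, L (M q) = ∑ i, ∑ j, M q i j * L (Matrix.single i j 1) := by
    intro q
    conv_lhs => rw [Matrix.matrix_eq_sum_single (M q)]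
    simp only [map_sum]
    refine Finset.sum_congr rfl fun i _ => Finset.sum_congr rfl fun j _ => ?_
    rw [← smul_eq_mul, ← map_smul, Matrix.smul_single, smul_eq_mul, mul_one]
  simp only [this]
  exact ContDiffOn.sum fun i _ => ContDiffOn.sum fun j _ => (hM i j).mul contDiffOn_const

theorem contDiffOn_companion {n : WithTop ℕ∞} {p : Fin (k + 1) → E → ℝ}
    (hp : ∀ i, ContDiffOn ℝ n (p i) U) (i j : Fin (k + 1)) :
    ContDiffOn ℝ n (fun q => (companion k fun i => p i q) i j) U := by
  simp only [companion, Matrix.add_apply, Matrix.of_apply]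
  split_ifs
  · exact contDiffOn_const.add (hp i)
  · exact contDiffOn_const

theorem contDiffOn_canonicalMatrix {n : WithTop ℕ∞} {κ : ℕ → E → ℝ}
    (hκ : ∀ i, ContDiffOn ℝ n (κ i) U) (i j : Fin (k + 1)) :
    ContDiffOn ℝ n (fun q => canonicalMatrix k 0 (fun i => κ i q) i j) U := by
  simp only [canonicalMatrix, Matrix.add_apply, Matrix.sum_apply, Matrix.smul_apply, smul_eq_mul]
  exact contDiffOn_const.add (ContDiffOn.sum fun i _ => (hκ i).mul contDiffOn_const)

/-- The entrywise derivative of a matrix function along a vector field. -/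
def lieDerivMatrix (v : E → E) (A : E → Matrix (Fin (k + 1)) (Fin (k + 1)) ℝ) (q : E) :
    Matrix (Fin (k + 1)) (Fin (k + 1)) ℝ :=
  Matrix.of fun i j => fderiv ℝ (fun r => A r i j) q (v q)

theorem upperDeg_companion_sub (p : Fin (k + 1) → ℝ) : UpperDeg 0 (companion k p - slX k) := by
  intro i j hij
  have : j ≠ Fin.last k := by rintro rfl; simp at hij; have := i.2; omega
  simp [companion, this]

/-- Along a vector field, the companion matrix of a linear equation of order `k + 1` can be
reduced to canonical form by a smooth unipotent gauge transformation. -/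
theorem exists_canonical_gauge (hU : IsOpen U) {v : E → E} (hv : ContDiffOn ℝ ∞ v U)
    {p : Fin (k + 1) → E → ℝ} (hp : ∀ i, ContDiffOn ℝ ∞ (p i) U) :
    ∃ (A : E → Matrix (Fin (k + 1)) (Fin (k + 1)) ℝ) (κ : ℕ → E → ℝ),
      (∀ i j, ContDiffOn ℝ ∞ (fun q => A q i j) U) ∧ (∀ i, ContDiffOn ℝ ∞ (κ i) U) ∧
      (∀ q, UpperDeg 1 (A q - 1)) ∧
      ∀ q ∈ U, companion k (fun i => p i q) * A q + lieDerivMatrix v A q =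
        A q * canonicalMatrix k 0 (fun i => κ i q) := by
  have key : ∀ d : ℕ, d ≤ k + 1 →
      ∃ (A : E → Matrix (Fin (k + 1)) (Fin (k + 1)) ℝ) (κ : ℕ → E → ℝ),
      (∀ i j, ContDiffOn ℝ ∞ (fun q => A q i j) U) ∧ (∀ i, ContDiffOn ℝ ∞ (κ i) U) ∧
      (∀ q, UpperDeg 1 (A q - 1)) ∧
      ∀ q ∈ U, UpperDeg d (companion k (fun i => p i q) * A q + lieDerivMatrix v A q -
        A q * canonicalMatrix k 0 (fun i => κ i q)) := by
    intro d
    induction d with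
    | zero =>
      intro _
      refine ⟨fun _ => 1, fun _ _ => 0, fun _ _ => contDiffOn_const, fun _ => contDiffOn_const,
        fun q => by simpa using UpperDeg.zero, fun q _ => ?_⟩
      have h1 : lieDerivMatrix (k := k) v (fun _ => 1) q = 0 := by
        ext i j
        simp [lieDerivMatrix]
      have h2 : canonicalMatrix k 0 (fun _ => 0) = slX k := by simp [canonicalMatrix]
      rw [h1, h2, mul_one, one_mul, add_zero]
      exact upperDeg_companion_sub _
    | succ d ih =>
      intro hd
      obtain ⟨A, κ, hA, hκ, hA1, hres⟩ := ih (by omega)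
      set R : E → Matrix (Fin (k + 1)) (Fin (k + 1)) ℝ := fun q =>
        companion k (fun i => p i q) * A q + lieDerivMatrix v A q -
          A q * canonicalMatrix k 0 (fun i => κ i q) with hR
      have hRs : ∀ i j, ContDiffOn ℝ ∞ (fun q => R q i j) U := by
        intro i j
        simp only [hR, Matrix.sub_apply, Matrix.add_apply]
        refine ((contDiffOn_matrix_mul (contDiffOn_companion hp) hA i j).add ?_).sub
          (contDiffOn_matrix_mul hA (contDiffOn_canonicalMatrix hκ) i j)
        exact ((hA i j).fderiv_of_isOpen hU (m := ∞) (by simp)).clm_apply hv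
      -- The correction of A and the new coefficient are fixed linear functions of the residual R.
      -- No differential equation is solved, so smoothness on U is preserved.
      obtain ⟨S, μ, hS⟩ := exists_solve_commutator_slX (k := k) (d := d) (by omega)
      have hBs : ∀ i j, ContDiffOn ℝ ∞ (fun q => S (R q) i j) U := fun i j =>
        contDiffOn_matrix_linearMap hRs ((Matrix.entryLinearMap ℝ ℝ i j).comp S)
      refine ⟨fun q => A q + S (R q), fun i q => κ i q + if i = d then μ (R q) else 0,
        fun i j => (hA i j).add (hBs i j), fun i => (hκ i).add ?_, fun q => ?_, fun q hq => ?_⟩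
      · split_ifs
        · exact contDiffOn_matrix_linearMap hRs μ
        · exact contDiffOn_const
      · rw [add_sub_right_comm]
        exact (hA1 q).add ((hS (R q)).1.mono (by push_cast; omega))
      · have hcan : canonicalMatrix k 0 (fun i => κ i q + if i = d then μ (R q) else 0) =
            canonicalMatrix k 0 (fun i => κ i q) + μ (R q) • slY k ^ d := by
          simp only [canonicalMatrix, add_smul, ite_smul, zero_smul, Finset.sum_add_distrib]
          rw [Finset.sum_ite_eq' (Finset.range (k + 1)) d, if_pos (by simp; omega)]
          abel
        have hlie : lieDerivMatrix v (fun q => A q + S (R q)) q =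
            lieDerivMatrix v A q + lieDerivMatrix v (fun q => S (R q)) q := by
          ext i j
          have h1 := ((hA i j).differentiableOn (by simp)).differentiableAt (hU.mem_nhds hq)
          have h2 := ((hBs i j).differentiableOn (by simp)).differentiableAt (hU.mem_nhds hq)
          simp only [lieDerivMatrix, Matrix.of_apply, Matrix.add_apply]
          rw [fderiv_fun_add h1 h2]
          rfl
        -- The degree bound on S(R) holds at all points, even off U, so these entries are
        -- identically zero functions and differentiation respects the degree.
        have hlieB : UpperDeg (d + 1 : ℕ) (lieDerivMatrix v (fun q => S (R q)) q) := by
          intro i j hij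
          have : (fun r => S (R r) i j) = fun _ => 0 := funext fun r => (hS (R r)).1 i j hij
          simp [lieDerivMatrix, this]
        obtain ⟨hB, hsol⟩ := hS (R q)
        have hcan0 : UpperDeg 0 (canonicalMatrix k 0 (fun i => κ i q) - slX k) := by
          simpa [canonicalMatrix] using upperDeg_sum_slY_pow (k := k) fun i => κ i q
        -- The new residual: the first bracket has degree d + 1 by the choice of S and μ. In the
        -- other products one factor has degree d + 1 and the other degree 0 or more, or A − 1 of
        -- degree 1 meets Y^d of degree d.
        have hsplit : companion k (fun i => p i q) * (A q + S (R q)) +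
              (lieDerivMatrix v A q + lieDerivMatrix v (fun q => S (R q)) q) -
              (A q + S (R q)) * (canonicalMatrix k 0 (fun i => κ i q) + μ (R q) • slY k ^ d) =
            (slX k * S (R q) - S (R q) * slX k + R q - μ (R q) • slY k ^ d)
            + (companion k (fun i => p i q) - slX k) * S (R q)
            + lieDerivMatrix v (fun q => S (R q)) q
            - S (R q) * (canonicalMatrix k 0 (fun i => κ i q) - slX k)
            - μ (R q) • ((A q - 1) * slY k ^ d) - μ (R q) • (S (R q) * slY k ^ d) := by
          have hRq : R q = companion k (fun i => p i q) * A q + lieDerivMatrix v A q -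
            A q * canonicalMatrix k 0 (fun i => κ i q) := rfl
          generalize S (R q) = B
          generalize μ (R q) = m
          rw [hRq]
          simp only [mul_add, add_mul, mul_sub, sub_mul, smul_sub, Matrix.mul_smul, one_mul]
          abel
        rw [hcan, hlie, hsplit]
        have h1 := (upperDeg_companion_sub fun i => p i q).mul hB
        have h2 := hB.mul hcan0
        have h3 := (hA1 q).mul (UpperDeg.slY_pow d)
        have h4 := hB.mul (UpperDeg.slY_pow d)
        refine (((((hsol (hres q hq)).add (h1.mono ?_)).add hlieB).sub (h2.mono ?_)).sub
          ((h3.mono ?_).smul _)).sub ((h4.mono ?_).smul _) <;> push_cast <;> omega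
  obtain ⟨A, κ, hA, hκ, hA1, hres⟩ := key (k + 1) le_rfl
  exact ⟨A, κ, hA, hκ, hA1, fun q hq => sub_eq_zero.1 ((hres q hq).mono (by simp)).eq_zero⟩

end CanonicalGauge

/-! ### Smooth dependence on time and integrating factors -/

section Smoothness

/-- Solutions of a smooth first order system are smooth. -/
theorem contDiffOn_of_hasDerivAt {n : Type*} [Fintype n] {W : Set (ℝ × (n → ℝ))}
    {G : n → ℝ × (n → ℝ) → ℝ} (hG : ∀ i, ContDiffOn ℝ ∞ (G i) W) {I : Set ℝ} (hI : IsOpen I)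
    {u : ℝ → n → ℝ} (hu : ∀ t ∈ I, (t, u t) ∈ W)
    (hd : ∀ t ∈ I, ∀ i, HasDerivAt (fun s => u s i) (G i (t, u t)) t) :
    ContDiffOn ℝ ∞ u I := by
  refine contDiffOn_infty.2 fun m => ?_
  induction m with
  | zero =>
    refine contDiffOn_zero.2 (continuousOn_pi.2 fun i => ?_)
    exact fun t ht => (hd t ht i).continuousAt.continuousWithinAt
  | succ m ih =>
    refine contDiffOn_pi.2 fun i => ?_
    push_cast
    refine (contDiffOn_succ_iff_deriv_of_isOpen hI).2 ⟨fun t ht =>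
      (hd t ht i).differentiableAt.differentiableWithinAt, by simp, ?_⟩
    refine ContDiffOn.congr (f := fun t => G i (t, u t)) ?_ fun t ht => (hd t ht i).deriv
    exact ((hG i).of_le (by exact_mod_cast le_top)).comp (contDiffOn_id.prodMk ih) hu

theorem contDiffOn_of_linear_system {n : Type*} [Fintype n] {I : Set ℝ} (hI : IsOpen I)
    {M : ℝ → Matrix n n ℝ} (hM : ∀ i j, ContDiffOn ℝ ∞ (fun t => M t i j) I)
    {u : ℝ → n → ℝ} (hu : ∀ t ∈ I, HasDerivAt u ((M t).mulVec (u t)) t) :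
    ContDiffOn ℝ ∞ u I := by
  refine contDiffOn_of_hasDerivAt (W := I ×ˢ univ) (G := fun i q => ∑ j, M q.1 i j * q.2 j)
    (fun i => ?_) hI (fun t ht => ⟨ht, trivial⟩) fun t ht => hasDerivAt_pi.1 (hu t ht)
  refine ContDiffOn.sum fun j _ => ContDiffOn.mul ?_ (by fun_prop)
  exact (hM i j).comp contDiffOn_fst fun q hq => hq.1

/-- A smooth function on an open interval has a nowhere vanishing smooth integrating factor. -/
theorem exists_integrating_factor {I : Set ℝ} (hI : IsOpen I) (hc : I.OrdConnected)
    (hn : I.Nonempty) {a : ℝ → ℝ} (ha : ContDiffOn ℝ ∞ a I) :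
    ∃ g : ℝ → ℝ, ContDiffOn ℝ ∞ g I ∧ ∀ t ∈ I, g t ≠ 0 ∧ HasDerivAt g (a t * g t) t := by
  obtain ⟨s, hs⟩ := hn
  -- The scalar equation g' = a g is the case k = 0; a zero of g would make it the zero solution by
  -- uniqueness.
  obtain ⟨w, hw0, hw⟩ := exists_solution_linear_equation (k := 0) hI hc (p := fun _ => a)
    (fun _ => ha.continuousOn) hs (fun _ => 1)
  have hcd := contDiffOn_of_linear_system hI
    (fun i j => contDiffOn_companion (fun _ => ha) j i) hw
  refine ⟨fun t => w t 0, contDiffOn_pi.1 hcd 0, fun t ht => ⟨fun h0 => ?_, ?_⟩⟩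
  · have hzero : ∀ t ∈ I, HasDerivAt (fun _ : ℝ => (0 : Fin (0 + 1) → ℝ))
        ((companion 0 fun _ => a t).transpose.mulVec 0) t := fun t _ => by
      rw [Matrix.mulVec_zero]; exact hasDerivAt_const t _
    have := eqOn_of_linear_system hI hc
      (fun i j => continuousOn_companion (fun _ => ha.continuousOn) j i) hw
      (w := fun _ => 0) hzero ht
      (by ext i; fin_cases i; exact h0) hs
    rw [hw0] at this
    simpa using congrFun this 0
  · simpa using (hasDerivAt_companion_iff.1 (hw t ht)).2

end Smoothness

/-! ### Moving frames of the dual of a space without topology -/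

section MovingFrames

variable {k : ℕ}

theorem contDiffOn_det {m : Type*} [Fintype m] [DecidableEq m] {E : Type*}
    [NormedAddCommGroup E] [NormedSpace ℝ E] {I : Set E} {M : E → Matrix m m ℝ}
    (hM : ∀ i j, ContDiffOn ℝ ∞ (fun t => M t i j) I) :
    ContDiffOn ℝ ∞ (fun t => (M t).det) I := by
  simp only [Matrix.det_apply]
  exact ContDiffOn.sum fun σ _ => (contDiffOn_prod fun i _ => hM _ _).const_smul _

theorem contDiffOn_matrix_inv {m : Type*} [Fintype m] [DecidableEq m] {I : Set ℝ}
    {M : ℝ → Matrix m m ℝ} (hM : ∀ i j, ContDiffOn ℝ ∞ (fun t => M t i j) I)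
    (hdet : ∀ t ∈ I, (M t).det ≠ 0) (i j : m) : ContDiffOn ℝ ∞ (fun t => (M t)⁻¹ i j) I := by
  simp only [Matrix.inv_def, Ring.inverse_eq_inv', Matrix.smul_apply, smul_eq_mul,
    Matrix.adjugate_apply]
  refine ((contDiffOn_det hM).inv hdet).mul (contDiffOn_det fun a b => ?_)
  simp only [Matrix.updateRow_apply]
  split_ifs
  · exact contDiffOn_const
  · exact hM a b

variable {V : Type*} [AddCommGroup V] [Module ℝ V]

/-- The components of `e t : V → ℝ ^ (k + 1)`, `t ∈ I`, form a smooth moving frame of the dual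
space of `V` with Maurer-Cartan matrix `N`. -/
structure IsMovingFrame (I : Set ℝ) (N : ℝ → Matrix (Fin (k + 1)) (Fin (k + 1)) ℝ)
    (e : ℝ → V →ₗ[ℝ] (Fin (k + 1) → ℝ)) : Prop where
  bijective : ∀ t ∈ I, Function.Bijective (e t)
  smooth : ∀ w, ContDiffOn ℝ ∞ (fun t => e t w) I
  hasDerivAt : ∀ w, ∀ t ∈ I, HasDerivAt (fun s => e s w) ((N t).transpose.mulVec (e t w)) t

/-- The basis of `V` dual to a frame. -/
def dualFrame (e : ℝ → V →ₗ[ℝ] (Fin (k + 1) → ℝ)) (t : ℝ) (a : Fin (k + 1)) : V :=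
  Function.invFun (e t) (Pi.single a 1)

namespace IsMovingFrame

variable {I : Set ℝ} {N : ℝ → Matrix (Fin (k + 1)) (Fin (k + 1)) ℝ}
  {e : ℝ → V →ₗ[ℝ] (Fin (k + 1) → ℝ)}

theorem apply_dualFrame (h : IsMovingFrame I N e) {t : ℝ} (ht : t ∈ I) (a : Fin (k + 1)) :
    e t (dualFrame e t a) = Pi.single a 1 :=
  Function.invFun_eq ((h.bijective t ht).2 _)

theorem sum_dualFrame (h : IsMovingFrame I N e) {t : ℝ} (ht : t ∈ I) (w : V) :
    ∑ a, e t w a • dualFrame e t a = w := by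
  apply (h.bijective t ht).1
  rw [map_sum]
  simp only [map_smul, h.apply_dualFrame ht]
  ext i
  simp [Finset.sum_apply, Pi.single_apply]

/-- Compare with a fixed time t₀: e t = Φ(t) ∘ e t₀ with Φ a smooth invertible matrix, and the dual
frame is read off from Φ⁻¹, which is smooth by the adjugate formula. -/
theorem contDiffOn_dualFrame (h : IsMovingFrame I N e) (φ : Module.Dual ℝ V) (a : Fin (k + 1)) :
    ContDiffOn ℝ ∞ (fun t => φ (dualFrame e t a)) I := by
  rcases I.eq_empty_or_nonempty with rfl | ⟨t₀, ht₀⟩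
  · exact contDiffOn_empty
  let Φ : ℝ → Matrix (Fin (k + 1)) (Fin (k + 1)) ℝ := fun t =>
    Matrix.of fun i j => e t (dualFrame e t₀ j) i
  have hΦ : ∀ i j, ContDiffOn ℝ ∞ (fun t => Φ t i j) I := fun i j =>
    contDiffOn_pi.1 (h.smooth (dualFrame e t₀ j)) i
  have happ : ∀ t w, (Φ t).mulVec (e t₀ w) = e t w := by
    intro t w
    conv_rhs => rw [← h.sum_dualFrame ht₀ w]
    rw [map_sum]
    ext i
    simp [Φ, Matrix.mulVec, dotProduct, mul_comm]
  have hdet : ∀ t ∈ I, (Φ t).det ≠ 0 := by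
    intro t ht
    have hinj : Function.Injective (Φ t).mulVec := by
      intro u w huw
      obtain ⟨u, rfl⟩ := (h.bijective t₀ ht₀).2 u
      obtain ⟨w, rfl⟩ := (h.bijective t₀ ht₀).2 w
      rw [happ, happ] at huw
      rw [(h.bijective t ht).1 huw]
    exact ((Matrix.isUnit_iff_isUnit_det _).1 (Matrix.mulVec_injective_iff_isUnit.1 hinj)).ne_zero
  have hdual : ∀ t ∈ I, φ (dualFrame e t a) =
      ∑ j, (Φ t)⁻¹ j a * φ (dualFrame e t₀ j) := by
    intro t ht
    have h1 : e t₀ (dualFrame e t a) = (Φ t)⁻¹.mulVec (Pi.single a 1) := by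
      rw [← h.apply_dualFrame ht a, ← happ t, Matrix.mulVec_mulVec,
        Matrix.nonsing_inv_mul _ (isUnit_iff_ne_zero.2 (hdet t ht)), Matrix.one_mulVec]
    conv_lhs => rw [← h.sum_dualFrame ht₀ (dualFrame e t a), h1]
    simp
  refine ContDiffOn.congr (ContDiffOn.sum fun j _ => ?_) hdual
  exact (contDiffOn_matrix_inv hΦ hdet j a).mul contDiffOn_const

/-- Freeze w = ε_a(t) and differentiate the constant φ(w) = Σ e_m(s)(w) φ(ε_m(s)) at s = t. There
e(w) is the a-th unit vector, so the derivative of φ(ε_a) is balanced by the Maurer-Cartan term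
alone. -/
theorem hasDerivAt_dualFrame (h : IsMovingFrame I N e) (hI : IsOpen I) {t : ℝ} (ht : t ∈ I)
    (a : Fin (k + 1)) : HasCoordDerivAt (fun s => dualFrame e s a)
      (-∑ m, N t a m • dualFrame e t m) t := by
  intro φ
  have hdiff : ∀ m, HasDerivAt (fun s => φ (dualFrame e s m))
      (deriv (fun s => φ (dualFrame e s m)) t) t := fun m =>
    (((h.contDiffOn_dualFrame φ m).differentiableOn (by simp)).differentiableAt
      (hI.mem_nhds ht)).hasDerivAt
  set w := dualFrame e t a with hw
  have h1 : HasDerivAt (fun s => ∑ m, e s w m * φ (dualFrame e s m))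
      (∑ m, ((N t).transpose.mulVec (e t w) m * φ (dualFrame e t m) +
        e t w m * deriv (fun s => φ (dualFrame e s m)) t)) t :=
    HasDerivAt.fun_sum fun m _ => (hasDerivAt_pi.1 (h.hasDerivAt w t ht) m).mul (hdiff m)
  have h2 : HasDerivAt (fun s => ∑ m, e s w m * φ (dualFrame e s m)) 0 t := by
    refine (hasDerivAt_const t (φ w)).congr_of_eventuallyEq ?_
    refine (hI.eventually_mem ht).mono fun s hs => ?_
    conv_rhs => rw [← h.sum_dualFrame hs w]
    simp
  have h3 := h1.unique h2
  rw [Finset.sum_add_distrib, hw, h.apply_dualFrame ht] at h3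
  simp only [Pi.single_apply, ite_mul, one_mul, zero_mul, Finset.sum_ite_eq', Finset.mem_univ,
    if_true, Matrix.mulVec_single_one, Matrix.col_transpose, Matrix.row] at h3
  convert hdiff a using 1
  simp only [map_neg, map_sum, map_smul, smul_eq_mul]
  linarith

/-- The gauge law N' = A⁻¹NA + A⁻¹A', multiplied by A. The coordinates form a row of covectors,
which A multiplies from the right, hence the transpose. -/
theorem change (h : IsMovingFrame I N e) {A : ℝ → Matrix (Fin (k + 1)) (Fin (k + 1)) ℝ}
    {N' A' : ℝ → Matrix (Fin (k + 1)) (Fin (k + 1)) ℝ}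
    (hA : ∀ i j, ContDiffOn ℝ ∞ (fun t => A t i j) I)
    (hA' : ∀ t ∈ I, ∀ i j, HasDerivAt (fun s => A s i j) (A' t i j) t)
    (hdet : ∀ t ∈ I, (A t).det ≠ 0) (heq : ∀ t ∈ I, N t * A t + A' t = A t * N' t) :
    IsMovingFrame I N' fun t => (Matrix.mulVecLin (A t).transpose).comp (e t) where
  bijective t ht := by
    refine Function.Bijective.comp (g := (A t).transpose.mulVec) ?_ (h.bijective t ht)
    have hu : IsUnit (A t).transpose :=
      (Matrix.isUnit_iff_isUnit_det _).2 (by simpa using hdet t ht)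
    exact ⟨Matrix.mulVec_injective_iff_isUnit.2 hu, Matrix.mulVec_surjective_iff_isUnit.2 hu⟩
  smooth w := by
    refine contDiffOn_pi.2 fun i => ?_
    change ContDiffOn ℝ ∞ (fun t => ∑ j, A t j i * e t w j) I
    refine ContDiffOn.sum fun j _ => (hA j i).mul ?_
    exact contDiffOn_pi.1 (h.smooth w) j
  hasDerivAt w t ht := by
    have : (N' t).transpose.mulVec ((A t).transpose.mulVec (e t w)) =
        (A' t).transpose.mulVec (e t w) +
          (A t).transpose.mulVec ((N t).transpose.mulVec (e t w)) := by
      rw [Matrix.mulVec_mulVec, Matrix.mulVec_mulVec, ← Matrix.transpose_mul, ← heq t ht,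
        Matrix.transpose_add, Matrix.add_mulVec, Matrix.transpose_mul]
      exact add_comm _ _
    refine hasDerivAt_pi.2 fun i => ?_
    simp only [LinearMap.comp_apply, Matrix.mulVecLin_apply]
    rw [this]
    simp only [Matrix.mulVec, dotProduct, Pi.add_apply, Matrix.transpose_apply]
    rw [← Finset.sum_add_distrib]
    refine HasDerivAt.fun_sum fun j _ => ?_
    exact (hA' t ht j i).mul (hasDerivAt_pi.1 (h.hasDerivAt w t ht) j)

end IsMovingFrame

/-- Product rule for a bilinear form along curves in a space with a moving frame. -/
theorem HasCoordDerivAt.bilin {I : Set ℝ} {N : ℝ → Matrix (Fin (k + 1)) (Fin (k + 1)) ℝ}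
    {e : ℝ → V →ₗ[ℝ] (Fin (k + 1) → ℝ)} (h : IsMovingFrame I N e)
    {u w : ℝ → V} {u' w' : V} {t : ℝ} (ht : t ∈ I) (hu : HasCoordDerivAt u u' t)
    (hw : HasCoordDerivAt w w' t) (b : LinearMap.BilinForm ℝ V) :
    HasDerivAt (fun s => b (u s) (w s)) (b u' (w t) + b (u t) w') t := by
  -- Expanding the first argument in the frame frozen at t leaves products of real functions, to
  -- which the ordinary product rule applies.
  have hexp : ∀ x z : V, b x z = ∑ i, e t x i * b (dualFrame e t i) z := by
    intro x z
    conv_lhs => rw [← h.sum_dualFrame ht x]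
    simp
  have hcomp : ∀ i, HasDerivAt (fun s => e t (u s) i) (e t u' i) t := fun i =>
    hu ((LinearMap.proj i).comp (e t))
  have := HasDerivAt.fun_sum (u := Finset.univ) fun i _ =>
    (hcomp i).mul (hw (b (dualFrame e t i)))
  rw [Finset.sum_add_distrib, ← hexp, ← hexp] at this
  exact this.congr_of_eventuallyEq (Eventually.of_forall fun s => hexp _ _)

end MovingFrames

/-! ### The sl₂-invariant bilinear form J and its rigidity -/

section AntidiagonalForm

variable (k : ℕ)

/-- The antidiagonal matrix with alternating signs: the invariant bilinear form of the irreducible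
representation of `sl₂`. -/
def antidiag : Matrix (Fin (k + 1)) (Fin (k + 1)) ℝ :=
  Matrix.of fun i j => if i = j.rev then (-1) ^ (i : ℕ) else 0

variable {k}

theorem mul_antidiag_apply (M : Matrix (Fin (k + 1)) (Fin (k + 1)) ℝ) (i j : Fin (k + 1)) :
    (M * antidiag k) i j = M i j.rev * (-1) ^ (j.rev : ℕ) := by
  rw [Matrix.mul_apply, Finset.sum_eq_single j.rev]
  · simp [antidiag]
  · intro l _ hl; simp [antidiag, hl]
  · simp

theorem antidiag_mul_apply (M : Matrix (Fin (k + 1)) (Fin (k + 1)) ℝ) (i j : Fin (k + 1)) :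
    (antidiag k * M) i j = (-1) ^ (i : ℕ) * M i.rev j := by
  rw [Matrix.mul_apply, Finset.sum_eq_single i.rev]
  · simp [antidiag]
  · intro l _ hl
    have : i ≠ l.rev := by rintro rfl; simp at hl
    simp [antidiag, this]
  · simp

theorem antidiag_mul_antidiag :
    antidiag k * antidiag k = (-1 : ℝ) ^ k • (1 : Matrix (Fin (k + 1)) (Fin (k + 1)) ℝ) := by
  ext i j
  rw [mul_antidiag_apply, Matrix.smul_apply, Matrix.one_apply]
  by_cases h : i = j
  · subst h
    have hi := i.2
    have : antidiag k i i.rev = (-1) ^ (i : ℕ) := by simp [antidiag]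
    rw [this, ← pow_add, if_pos rfl, smul_eq_mul, mul_one, Fin.val_rev]
    congr 1; omega
  · have : i ≠ j.rev.rev := by simpa using h
    simp [antidiag, h]

/-- X shifts the index by one and the signs of J alternate, so X is skew for J; Y and H follow
below, which makes J invariant under sl₂. -/
theorem transpose_slX_mul_antidiag : (slX k).transpose * antidiag k = -(antidiag k * slX k) := by
  ext i j
  have hi := i.2
  have hj := j.2
  rw [mul_antidiag_apply, Matrix.neg_apply, antidiag_mul_apply]
  simp only [slX, Matrix.transpose_apply, Matrix.of_apply, Fin.val_rev]
  by_cases h : (i : ℕ) + j + 1 = k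
  · rw [if_pos (by omega), if_pos (by omega)]
    have : k + 1 - ((j : ℕ) + 1) = i + 1 := by omega
    rw [this, pow_succ]; ring
  · rw [if_neg (by omega), if_neg (by omega)]; simp

/-- Besides the alternating signs this uses that the entry j(k + 1 − j) is unchanged by the reversal
j ↦ k + 1 − j. -/
theorem transpose_slY_mul_antidiag : (slY k).transpose * antidiag k = -(antidiag k * slY k) := by
  ext i j
  have hi := i.2
  have hj := j.2
  rw [mul_antidiag_apply, Matrix.neg_apply, antidiag_mul_apply]
  simp only [slY, Matrix.transpose_apply, Matrix.of_apply, Fin.val_rev]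
  by_cases h : (i : ℕ) + j = k + 1
  · rw [if_pos (by omega), if_pos (by omega)]
    have e1 : k + 1 - ((j : ℕ) + 1) + 1 = i := by omega
    have e2 : ((i : ℕ) : ℝ) + (j : ℕ) = (k : ℝ) + 1 := by exact_mod_cast h
    have e3 : ((-1 : ℝ)) ^ (i : ℕ) = -(-1) ^ (k + 1 - ((j : ℕ) + 1)) := by
      conv_lhs => rw [← e1, pow_succ]
      ring
    rw [e3, ← e2]; ring
  · rw [if_neg (by omega), if_neg (by omega)]; simp

theorem transpose_slH_mul_antidiag : (slH k).transpose * antidiag k = -(antidiag k * slH k) := by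
  ext i j
  have hi := i.2
  have hj := j.2
  rw [mul_antidiag_apply, Matrix.neg_apply, antidiag_mul_apply, slH, Matrix.diagonal_transpose,
    Matrix.diagonal_apply, Matrix.diagonal_apply]
  by_cases h : i = j.rev
  · subst h
    have e : (((k - (j : ℕ) : ℕ)) : ℝ) = (k : ℝ) - (j : ℕ) := Nat.cast_sub (by omega)
    simp [Fin.val_rev, e]
    ring
  · have h' : ¬ i.rev = j := by rintro rfl; simp at h
    simp [h, h']

/-- Each factor contributes one sign: odd powers of Y are skew for J, even powers self-adjoint. This
is where the invariants of odd index are singled out. -/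
theorem transpose_slY_pow_mul_antidiag (n : ℕ) :
    (slY k ^ n).transpose * antidiag k = (-1 : ℝ) ^ n • (antidiag k * slY k ^ n) := by
  induction n with
  | zero => simp
  | succ n ih =>
    rw [pow_succ', Matrix.transpose_mul, Matrix.mul_assoc, transpose_slY_mul_antidiag,
      Matrix.mul_neg, ← Matrix.mul_assoc, ih, Matrix.smul_mul, Matrix.mul_assoc, ← pow_succ,
      ← pow_succ', pow_succ (-1 : ℝ)]
    simp

/-- The negative J-adjoint of a canonical matrix is again canonical with the same α, which is what
brings compatible forms within the reach of `gauge_rigidity`. -/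
theorem transpose_canonicalMatrix_mul_antidiag (α : ℝ) (κ : ℕ → ℝ) :
    (canonicalMatrix k α κ).transpose * antidiag k =
      -(antidiag k * canonicalMatrix k α fun i => (-1) ^ (i + 1) * κ i) := by
  simp only [canonicalMatrix, Matrix.transpose_add, Matrix.transpose_smul, Matrix.transpose_sum,
    add_mul, mul_add, Matrix.smul_mul, Matrix.mul_smul, Finset.sum_mul, Finset.mul_sum,
    transpose_slX_mul_antidiag, transpose_slH_mul_antidiag, transpose_slY_pow_mul_antidiag, neg_add,
    smul_neg, ← Finset.sum_neg_distrib]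
  congr 1
  refine Finset.sum_congr rfl fun i _ => ?_
  rw [smul_smul, ← neg_smul]
  congr 1; ring

variable {V : Type*} [AddCommGroup V] [Module ℝ V]

/-- A bilinear form on `V` that is antitriangular in a canonical frame is proportional to the
antidiagonal form, and the invariants of even index are obstructions. -/
theorem IsMovingFrame.bilin_rigidity {I : Set ℝ} (hI : IsOpen I) {α : ℝ → ℝ} {κ : ℕ → ℝ → ℝ}
    {e : ℝ → V →ₗ[ℝ] (Fin (k + 1) → ℝ)}
    (h : IsMovingFrame I (fun t => canonicalMatrix k (α t) fun i => κ i t) e)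
    {b : LinearMap.BilinForm ℝ V}
    (hb : ∀ t ∈ I, ∀ i j : Fin (k + 1), k < (i : ℕ) + j →
      b (dualFrame e t i) (dualFrame e t j) = 0) {t : ℝ} (ht : t ∈ I) :
    ∃ c : ℝ, (∀ u w, b u w = c * (e t u ⬝ᵥ (antidiag k).mulVec (e t w))) ∧
      ∀ i, 1 ≤ i → i ≤ k → Even i → c * κ i t = 0 := by
  let β : ℝ → Matrix (Fin (k + 1)) (Fin (k + 1)) ℝ := fun t =>
    Matrix.of fun i j => b (dualFrame e t i) (dualFrame e t j)
  let N : ℝ → Matrix (Fin (k + 1)) (Fin (k + 1)) ℝ := fun t =>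
    canonicalMatrix k (α t) fun i => κ i t
  have hβ : ∀ t ∈ I, ∀ i j, HasDerivAt (fun s => β s i j)
      ((-(N t * β t + β t * (N t).transpose)) i j) t := by
    intro t ht i j
    have := HasCoordDerivAt.bilin h ht (h.hasDerivAt_dualFrame hI ht i)
      (h.hasDerivAt_dualFrame hI ht j) b
    refine this.congr_deriv (Eq.symm ?_)
    change -(∑ m, N t i m * β t m j + ∑ m, β t i m * N t j m) = _
    simp only [map_neg, map_sum, map_smul, LinearMap.neg_apply, LinearMap.sum_apply,
      LinearMap.smul_apply, smul_eq_mul, neg_add]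
    congr 2
    exact Finset.sum_congr rfl fun m _ => mul_comm _ _
  -- Reversing the columns turns the antitriangular β into the upper triangular βJ. From β' = −(Nβ +
  -- βNᵀ) and NᵀJ = −JN^σ it follows that (βJ)' = (βJ)N^σ − N(βJ).
  have key := gauge_rigidity hI (B := fun t => β t * antidiag k)
    (B' := fun t => -(N t * β t + β t * (N t).transpose) * antidiag k) (α := α) (κ := κ)
    (κ' := fun i t => (-1) ^ (i + 1) * κ i t) (fun t ht i j => ?_) (fun t ht i j hij => ?_)
    (fun t ht => ?_) t ht
  · obtain ⟨h1, h2⟩ := key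
    set c := (β t * antidiag k) 0 0
    have hβt : β t = ((-1) ^ k * c) • antidiag k := by
      have h3 := congrArg (· * antidiag k) h1
      simp only [Matrix.mul_assoc, antidiag_mul_antidiag, Matrix.smul_mul, one_mul,
        Matrix.mul_smul, mul_one] at h3
      have h4 := congrArg (fun M => (-1 : ℝ) ^ k • M) h3
      simpa [smul_smul, ← mul_pow] using h4
    refine ⟨(-1) ^ k * c, fun u w => ?_, fun i hi hik hev => ?_⟩
    · conv_lhs => rw [← h.sum_dualFrame ht u, ← h.sum_dualFrame ht w]
      have h5 : ∀ i j, b (dualFrame e t i) (dualFrame e t j) =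
          ((-1) ^ k * c) * antidiag k i j := fun i j => congrFun (congrFun hβt i) j
      simp only [map_sum, map_smul, LinearMap.sum_apply, LinearMap.smul_apply, smul_eq_mul, h5,
        dotProduct, Matrix.mulVec, Finset.mul_sum]
      refine Finset.sum_comm.trans
        (Finset.sum_congr rfl fun i _ => Finset.sum_congr rfl fun j _ => ?_)
      ring
    · have := h2 i hi hik
      rw [pow_succ, hev.neg_one_pow] at this
      have : c * κ i t = 0 := by linarith
      rw [mul_assoc, this, mul_zero]
  · simp only [Matrix.mul_apply]
    exact HasDerivAt.fun_sum fun l _ => (hβ t ht i l).mul_const _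
  · rw [mul_antidiag_apply]
    have hj := j.2
    have : β t i j.rev = 0 := hb t ht i j.rev (by rw [Fin.val_rev]; omega)
    rw [this, zero_mul]
  · simp only [Matrix.mul_assoc, neg_mul, add_mul, N, transpose_canonicalMatrix_mul_antidiag,
      Matrix.mul_neg, neg_add, neg_neg]
    abel

/-- If the invariants of even index vanish, the antidiagonal form in a canonical frame is
constant. -/
theorem IsMovingFrame.antidiag_const {I : Set ℝ} (hI : IsOpen I) (hc : I.OrdConnected)
    {α : ℝ → ℝ} {κ : ℕ → ℝ → ℝ} {e : ℝ → V →ₗ[ℝ] (Fin (k + 1) → ℝ)}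
    (h : IsMovingFrame I (fun t => canonicalMatrix k (α t) fun i => κ i t) e)
    (hκ : ∀ t ∈ I, ∀ i, i ≤ k → Even i → κ i t = 0) {s t : ℝ} (hs : s ∈ I) (ht : t ∈ I) (u w : V) :
    e s u ⬝ᵥ (antidiag k).mulVec (e s w) = e t u ⬝ᵥ (antidiag k).mulVec (e t w) := by
  have hder : ∀ t ∈ I, HasDerivAt (fun s => e s u ⬝ᵥ (antidiag k).mulVec (e s w)) 0 t := by
    intro t ht
    set N := canonicalMatrix k (α t) fun i => κ i t with hN
    have hNJ : N.transpose * antidiag k = -(antidiag k * N) := by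
      have : N = canonicalMatrix k (α t) fun i => (-1) ^ (i + 1) * κ i t := by
        simp only [hN, canonicalMatrix]
        congr 1
        refine Finset.sum_congr rfl fun i hi => ?_
        rcases Nat.even_or_odd i with he | ho
        · rw [hκ t ht i (by simpa [Nat.lt_succ_iff] using hi) he]; simp
        · rw [(ho.add_odd odd_one).neg_one_pow, one_mul]
      conv_rhs => rw [this]
      exact transpose_canonicalMatrix_mul_antidiag _ _
    -- J is its own inverse up to sign, so conjugating the previous identity by J gives the one for
    -- the dual form.
    have hJN : antidiag k * N.transpose = -(N * antidiag k) := by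
      have h3 := congrArg (fun M => antidiag k * M * antidiag k) hNJ
      simp only [Matrix.mul_assoc, antidiag_mul_antidiag, Matrix.mul_neg, Matrix.neg_mul,
        Matrix.mul_smul, mul_one] at h3
      rw [← Matrix.mul_assoc (antidiag k) (antidiag k), antidiag_mul_antidiag] at h3
      have h4 := congrArg (fun M => (-1 : ℝ) ^ k • M) h3
      simpa [smul_smul, ← mul_pow] using h4
    have h1 : HasDerivAt (fun s => e s u ⬝ᵥ (antidiag k).mulVec (e s w))
        (N.transpose.mulVec (e t u) ⬝ᵥ (antidiag k).mulVec (e t w) +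
          e t u ⬝ᵥ (antidiag k).mulVec (N.transpose.mulVec (e t w))) t := by
      simp only [dotProduct]
      rw [← Finset.sum_add_distrib]
      refine HasDerivAt.fun_sum fun i _ => (hasDerivAt_pi.1 (h.hasDerivAt u t ht) i).mul ?_
      change HasDerivAt (fun s => ∑ j, antidiag k i j * e s w j)
        (∑ j, antidiag k i j * (N.transpose.mulVec (e t w)) j) t
      exact HasDerivAt.fun_sum fun j _ => (hasDerivAt_pi.1 (h.hasDerivAt w t ht) j).const_mul _
    convert h1 using 1
    rw [Matrix.mulVec_mulVec, hJN, Matrix.mulVec_transpose, ← Matrix.dotProduct_mulVec,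
      Matrix.mulVec_mulVec, Matrix.neg_mulVec, dotProduct_neg, add_neg_cancel]
  have hconst := hI.is_const_of_deriv_eq_zero hc.isPreconnected
    (f := fun s => e s u ⬝ᵥ (antidiag k).mulVec (e s w))
    (fun t ht => (hder t ht).differentiableAt.differentiableWithinAt)
    (fun t ht => (hder t ht).deriv) hs ht
  exact hconst

end AntidiagonalForm

/-! ### Components and higher derivatives of curves in a moving frame -/

section Lifts

variable {k : ℕ} {V : Type*} [AddCommGroup V] [Module ℝ V]

/-- Product rule for the components of a curve in a moving frame. -/
theorem HasCoordDerivAt.component {I : Set ℝ} {N : ℝ → Matrix (Fin (k + 1)) (Fin (k + 1)) ℝ}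
    {e : ℝ → V →ₗ[ℝ] (Fin (k + 1) → ℝ)} (h : IsMovingFrame I N e)
    {v : ℝ → V} {v' : V} {t : ℝ} (ht : t ∈ I) (hv : HasCoordDerivAt v v' t) (m : Fin (k + 1)) :
    HasDerivAt (fun s => e s (v s) m) ((N t).transpose.mulVec (e t (v t)) m + e t v' m) t := by
  have hexp : ∀ s x, e s x m = ∑ a, e t x a * e s (dualFrame e t a) m := by
    intro s x
    conv_lhs => rw [← h.sum_dualFrame ht x]
    simp
  have hcomp : ∀ i, HasDerivAt (fun s => e t (v s) i) (e t v' i) t := fun i =>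
    hv ((LinearMap.proj i).comp (e t))
  have h1 := HasDerivAt.fun_sum (u := Finset.univ) fun a _ =>
    (hcomp a).mul (hasDerivAt_pi.1 (h.hasDerivAt (dualFrame e t a) t ht) m)
  rw [Finset.sum_add_distrib, ← hexp] at h1
  have h2 : ∑ a, e t (v t) a * (N t).transpose.mulVec (e t (dualFrame e t a)) m =
      (N t).transpose.mulVec (e t (v t)) m := by
    simp only [h.apply_dualFrame ht, Matrix.mulVec_single_one, Matrix.col_transpose, Matrix.row]
    simp [Matrix.mulVec, dotProduct, mul_comm]
  rw [h2] at h1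
  exact (h1.congr_deriv (add_comm _ _)).congr_of_eventuallyEq
    (Eventually.of_forall fun s => hexp _ _)

theorem contDiffOn_iteratedDeriv {I : Set ℝ} (hI : IsOpen I) {g : ℝ → ℝ}
    (hg : ContDiffOn ℝ ∞ g I) (j : ℕ) : ContDiffOn ℝ ∞ (iteratedDeriv j g) I := by
  induction j with
  | zero => simpa using hg
  | succ j ih =>
    rw [iteratedDeriv_succ]
    exact ih.deriv_of_isOpen hI (by simp)

/-- The vectors of a dual frame have derivatives of all orders. -/
theorem IsMovingFrame.exists_derivatives {I : Set ℝ} (hI : IsOpen I) (hn : I.Nonempty)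
    {N : ℝ → Matrix (Fin (k + 1)) (Fin (k + 1)) ℝ} {e : ℝ → V →ₗ[ℝ] (Fin (k + 1) → ℝ)}
    (h : IsMovingFrame I N e) (a : Fin (k + 1)) :
    ∃ v : ℕ → ℝ → V, (∀ t, v 0 t = dualFrame e t a) ∧
      ∀ j, ∀ t ∈ I, HasCoordDerivAt (v j) (v (j + 1) t) t := by
  obtain ⟨t₀, ht₀⟩ := hn
  -- Coordinates with respect to the frame frozen at t₀; higher derivatives of the curve are
  -- iterated derivatives of these real functions.
  let g : Fin (k + 1) → ℝ → ℝ := fun m s => e t₀ (dualFrame e s a) m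
  have hg : ∀ m, ContDiffOn ℝ ∞ (g m) I := fun m =>
    h.contDiffOn_dualFrame ((LinearMap.proj m).comp (e t₀)) a
  refine ⟨fun j s => ∑ m, iteratedDeriv j (g m) s • dualFrame e t₀ m, fun t => ?_,
    fun j t ht φ => ?_⟩
  · simp only [iteratedDeriv_zero, g]
    exact h.sum_dualFrame ht₀ _
  · simp only [map_sum, map_smul, smul_eq_mul]
    refine HasDerivAt.fun_sum fun m _ => HasDerivAt.mul_const ?_ _
    rw [iteratedDeriv_succ]
    exact (((contDiffOn_iteratedDeriv hI (hg m) j).differentiableOn (by simp)).differentiableAt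
      (hI.mem_nhds ht)).hasDerivAt

end Lifts

/-! ### The tangent spaces of the solution space, their osculating flags and canonical frames -/

section SolutionSpace

variable {k : ℕ} {f : ℝ × (Fin (k + 1) → ℝ) → ℝ} {U : Set (ℝ × (Fin (k + 1) → ℝ))}

/-- The total derivative: the vector field on the jet space whose integral curves are the
solutions. -/
def jetField (f : ℝ × (Fin (k + 1) → ℝ) → ℝ) (q : ℝ × (Fin (k + 1) → ℝ)) :
    ℝ × (Fin (k + 1) → ℝ) :=
  (1, Fin.snoc (fun i : Fin k => q.2 i.succ) (f q))

theorem contDiffOn_jetField (hf : ContDiffOn ℝ ∞ f U) : ContDiffOn ℝ ∞ (jetField f) U := by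
  refine contDiffOn_const.prodMk (contDiffOn_pi.2 fun i => ?_)
  refine Fin.lastCases ?_ (fun i => ?_) i
  · simpa using hf
  · simp only [Fin.snoc_castSucc]
    fun_prop

theorem contDiffOn_partial (hU : IsOpen U) (hf : ContDiffOn ℝ ∞ f U) (i : Fin (k + 1)) :
    ContDiffOn ℝ ∞ (fun q => fderiv ℝ f q (0, Pi.single i 1)) U :=
  (hf.fderiv_of_isOpen hU (m := ∞) (by simp)).clm_apply contDiffOn_const

namespace Solution

theorem isOpen_dom (y : Solution f U) : IsOpen y.dom := y.isSolution.1

theorem ordConnected_dom (y : Solution f U) : y.dom.OrdConnected := y.isSolution.2.1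

theorem nonempty_dom (y : Solution f U) : y.dom.Nonempty := y.isSolution.2.2.1

theorem mem_domain (y : Solution f U) {t : ℝ} (ht : t ∈ y.dom) : (t, y.jet t) ∈ U :=
  (y.isSolution.2.2.2 t ht).1

theorem hasDerivAt_point (y : Solution f U) {t : ℝ} (ht : t ∈ y.dom) :
    HasDerivAt (fun s => (s, y.jet s)) (jetField f (t, y.jet t)) t := by
  obtain ⟨-, h1, h2⟩ := y.isSolution.2.2.2 t ht
  refine (hasDerivAt_id t).prodMk (hasDerivAt_pi.2 fun i => ?_)
  refine Fin.lastCases ?_ (fun i => ?_) i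
  · simpa using h2
  · simpa using h1 i

theorem contDiffOn_point (y : Solution f U) (hf : ContDiffOn ℝ ∞ f U) :
    ContDiffOn ℝ ∞ (fun s => (s, y.jet s)) y.dom := by
  refine contDiffOn_id.prodMk (contDiffOn_of_hasDerivAt (W := U)
    (G := fun i q => (jetField f q).2 i) (fun i => ?_) y.isOpen_dom (fun t ht => y.mem_domain ht)
    fun t ht i => ?_)
  · exact contDiffOn_pi.1 (contDiffOn_jetField hf).snd i
  · exact hasDerivAt_pi.1 (y.hasDerivAt_point ht).snd i

theorem contDiffOn_comp_point (y : Solution f U) (hf : ContDiffOn ℝ ∞ f U)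
    {g : ℝ × (Fin (k + 1) → ℝ) → ℝ} (hg : ContDiffOn ℝ ∞ g U) :
    ContDiffOn ℝ ∞ (fun s => g (s, y.jet s)) y.dom :=
  hg.comp (y.contDiffOn_point hf) fun _ ht => y.mem_domain ht

theorem contDiffOn_linCoeff (y : Solution f U) (hU : IsOpen U) (hf : ContDiffOn ℝ ∞ f U)
    (i : Fin (k + 1)) : ContDiffOn ℝ ∞ (y.linCoeff i) y.dom :=
  y.contDiffOn_comp_point hf (contDiffOn_partial hU hf i)

theorem hasDerivAt_tangent (y : Solution f U) (w : y.tangent) {t : ℝ} (ht : t ∈ y.dom) :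
    HasDerivAt w.1 ((companion k fun i => y.linCoeff i t).transpose.mulVec (w.1 t)) t :=
  hasDerivAt_companion_iff.2 (w.2.1 t ht)

/-- The jets at `t` of the solutions of the linearization form a moving frame of the cotangent
space. -/
theorem isMovingFrame_coord (y : Solution f U) (hU : IsOpen U) (hf : ContDiffOn ℝ ∞ f U) :
    IsMovingFrame y.dom (fun t => companion k fun i => y.linCoeff i t) y.coord where
  bijective t ht := by
    have hp : ∀ i, ContinuousOn (y.linCoeff i) y.dom := fun i =>
      (y.contDiffOn_linCoeff hU hf i).continuousOn
    constructor
    · intro u w huw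
      have h := eqOn_of_linear_system y.isOpen_dom y.ordConnected_dom
        (fun i j => continuousOn_companion hp j i) (fun t ht => y.hasDerivAt_tangent u ht)
        (fun t ht => y.hasDerivAt_tangent w ht) ht huw
      refine Subtype.ext (funext fun x => ?_)
      by_cases hx : x ∈ y.dom
      · exact h hx
      · rw [u.2.2 x hx, w.2.2 x hx]
    · intro a
      classical
      obtain ⟨w, hw0, hw⟩ := exists_solution_linear_equation y.isOpen_dom y.ordConnected_dom hp ht a
      let w' : ℝ → Fin (k + 1) → ℝ := fun x => if x ∈ y.dom then w x else 0
      have hw' : ∀ x ∈ y.dom, w' x = w x := fun x hx => if_pos hx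
      refine ⟨⟨w', fun x hx => hasDerivAt_companion_iff.1 ?_, fun x hx => if_neg hx⟩, ?_⟩
      · rw [hw' x hx]
        exact (hw x hx).congr_of_eventuallyEq ((y.isOpen_dom.eventually_mem hx).mono hw')
      · exact (hw' t ht).trans hw0
  smooth w := contDiffOn_of_linear_system y.isOpen_dom
    (fun i j => contDiffOn_companion (fun i => y.contDiffOn_linCoeff hU hf i) j i)
    fun t ht => y.hasDerivAt_tangent w ht
  hasDerivAt w t ht := y.hasDerivAt_tangent w ht

/-- The derivatives of a lift of the curve of a solution are triangular with respect to jets. -/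
theorem coord_lift (y : Solution f U) (hU : IsOpen U) (hf : ContDiffOn ℝ ∞ f U)
    {v : ℕ → ℝ → y.tangent} (hv : IsLift y.dom y.curve v) (j : ℕ) :
    ∀ t ∈ y.dom, ∀ m : Fin (k + 1), (m : ℕ) + j ≤ k →
      (v j t).1 t m = if (m : ℕ) + j = k then (-1) ^ j * (v 0 t).1 t (Fin.last k) else 0 := by
  have hF := y.isMovingFrame_coord hU hf
  induction j with
  | zero =>
    intro t ht m hm
    have h0 : v 0 t ∈ y.curve t := by
      rw [hv.1 t ht]; exact Submodule.mem_span_singleton_self _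
    refine Fin.lastCases (by simp) (fun m => ?_) m
    have : ¬ (m : ℕ) = k := by have := m.2; omega
    simpa [this] using h0 m
  | succ j ih =>
    intro t ht m hm
    have hmk : (m : ℕ) < k := by omega
    obtain ⟨m', rfl⟩ : ∃ m' : Fin k, m = m'.castSucc := ⟨⟨m, hmk⟩, rfl⟩
    -- The m-th jet component of v_j is identically zero because m + j < k. Its derivative is the (m
    -- + 1)-st component of v_j plus the m-th component of v_{j+1}, so the latter is determined up
    -- to a sign.
    have h1 := HasCoordDerivAt.component hF ht (hv.2 j t ht) m'.castSucc
    have h2 : HasDerivAt (fun s => y.coord s (v j s) m'.castSucc) 0 t := by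
      refine (hasDerivAt_const t (0 : ℝ)).congr_of_eventuallyEq ?_
      refine (y.isOpen_dom.eventually_mem ht).mono fun s hs => ?_
      refine (ih s hs m'.castSucc (by omega)).trans (if_neg (by omega))
    have h3 := h1.unique h2
    have h4 : (companion k fun i => y.linCoeff i t).transpose.mulVec (y.coord t (v j t))
        m'.castSucc = (v j t).1 t m'.succ :=
      (hasDerivAt_pi.1 (y.hasDerivAt_tangent (v j t) ht) m'.castSucc).unique
        (((v j t).2.1 t ht).1 m')
    rw [h4, ih t ht m'.succ (by simp at hm ⊢; omega)] at h3
    have h5 : (v (j + 1) t).1 t m'.castSucc = y.coord t (v (j + 1) t) m'.castSucc := rfl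
    rw [h5]
    have h6 : ((m'.succ : Fin (k + 1)) : ℕ) + j = m' + (j + 1) := by simp; omega
    rw [h6] at h3
    rw [Fin.val_castSucc]
    split_ifs at h3 ⊢ with h
    · rw [pow_succ]; linarith
    · linarith

/-- The osculating spaces of the curve of a solution, in terms of jets. -/
theorem mem_osculating_iff (y : Solution f U) (hU : IsOpen U) (hf : ContDiffOn ℝ ∞ f U)
    {t : ℝ} (ht : t ∈ y.dom) {i : ℕ} (hi : i ≤ k) (w : y.tangent) :
    w ∈ osculating y.dom y.curve i t ↔ ∀ m : Fin (k + 1), (m : ℕ) + i < k → w.1 t m = 0 := by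
  have hF := y.isMovingFrame_coord hU hf
  constructor
  · intro hw m hm
    refine Submodule.span_induction (p := fun w _ => w.1 t m = 0) ?_ rfl ?_ ?_ hw
    · rintro _ ⟨v, hv, j, hj, rfl⟩
      rw [y.coord_lift hU hf hv j t ht m (by omega), if_neg (by omega)]
    · intro u w _ _ hu hw
      simp [hu, hw]
    · intro c w _ hw
      simp [hw]
  -- The last dual frame vector is a lift of γ. Its j-th derivative has leading jet component ±1 in
  -- position k − j, so its first i + 1 derivatives fill the space by triangular elimination.
  · obtain ⟨v, hv0, hv⟩ := hF.exists_derivatives y.isOpen_dom y.nonempty_dom (Fin.last k)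
    have hlift : IsLift y.dom y.curve v := by
      refine ⟨fun s hs => ?_, hv⟩
      rw [hv0]
      ext u
      rw [Submodule.mem_span_singleton]
      constructor
      · intro hu
        refine ⟨u.1 s (Fin.last k), ?_⟩
        conv_rhs => rw [← hF.sum_dualFrame hs u, Fin.sum_univ_castSucc]
        have : ∀ i : Fin k, y.coord s u i.castSucc = 0 := hu
        simp only [this, zero_smul, Finset.sum_const_zero, zero_add]
        rfl
      · rintro ⟨c, rfl⟩ m
        have : (dualFrame y.coord s (Fin.last k)).1 s =
          (Pi.single (Fin.last k) 1 : Fin (k + 1) → ℝ) := hF.apply_dualFrame hs _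
        simp [this, (Fin.castSucc_lt_last m).ne]
    have hlast : (v 0 t).1 t (Fin.last k) = 1 := by
      rw [hv0]
      have : (dualFrame y.coord t (Fin.last k)).1 t =
        (Pi.single (Fin.last k) 1 : Fin (k + 1) → ℝ) := hF.apply_dualFrame ht _
      simp [this]
    have hmem : ∀ j i, j ≤ i → v j t ∈ osculating y.dom y.curve i t := fun j i hji =>
      Submodule.subset_span ⟨v, hlift, j, hji, rfl⟩
    have hmono : ∀ {i j}, i ≤ j → osculating y.dom y.curve i t ≤ osculating y.dom y.curve j t :=
      fun hij => Submodule.span_mono fun u ⟨v, hv, l, hl, hu⟩ => ⟨v, hv, l, hl.trans hij, hu⟩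
    induction i generalizing w with
    | zero =>
      intro hw
      have : w ∈ y.curve t := fun m => hw m.castSucc (by simp)
      rw [hlift.1 t ht, Submodule.mem_span_singleton] at this
      obtain ⟨c, rfl⟩ := this
      exact Submodule.smul_mem _ _ (hmem 0 0 le_rfl)
    | succ i ih =>
      intro hw
      let m₀ : Fin (k + 1) := ⟨k - (i + 1), by omega⟩
      have hv1 : (v (i + 1) t).1 t m₀ = (-1) ^ (i + 1) := by
        rw [y.coord_lift hU hf hlift (i + 1) t ht m₀ (by simp only [m₀]; omega),
          if_pos (by simp only [m₀]; omega), hlast, mul_one]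
      -- Chosen so that subtracting c times the (i + 1)-st derivative cancels the jet component k −
      -- (i + 1) of w.
      set c : ℝ := (-1) ^ (i + 1) * w.1 t m₀ with hc
      have hsub : w - c • v (i + 1) t ∈ osculating y.dom y.curve i t := by
        refine ih (by omega) _ fun m hm => ?_
        change w.1 t m - c * (v (i + 1) t).1 t m = 0
        by_cases h : m = m₀
        · subst h
          rw [hv1, hc, mul_right_comm, ← mul_pow]
          simp
        · have hne : (m : ℕ) ≠ k - (i + 1) := fun h' => h (Fin.ext h')
          rw [hw m (by omega), y.coord_lift hU hf hlift (i + 1) t ht m (by omega),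
            if_neg (by omega), mul_zero, sub_zero]
      have := add_mem (hmono (Nat.le_succ i) hsub)
        (Submodule.smul_mem _ c (hmem (i + 1) (i + 1) le_rfl))
      simpa using this

end Solution

/-- A matrix function on the jet space gives a frame of the cotangent space at a solution. -/
def gaugedCoord (y : Solution f U) (A : ℝ → Matrix (Fin (k + 1)) (Fin (k + 1)) ℝ) (t : ℝ) :
    y.tangent →ₗ[ℝ] (Fin (k + 1) → ℝ) :=
  (Matrix.mulVecLin (A t).transpose).comp (y.coord t)

theorem UpperDeg.det_eq_one {A : Matrix (Fin (k + 1)) (Fin (k + 1)) ℝ} (h : UpperDeg 1 (A - 1)) :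
    UpperDeg 0 A ∧ A.det = 1 := by
  have h0 : UpperDeg 0 A := by
    have := (h.mono (by omega : (0 : ℤ) ≤ 1)).add UpperDeg.one
    rwa [sub_add_cancel] at this
  refine ⟨h0, ?_⟩
  rw [Matrix.det_of_isUpperTriangular (upperDeg_zero_iff.1 h0)]
  refine Finset.prod_eq_one fun i _ => ?_
  have := h i i (by omega)
  rw [Matrix.sub_apply, Matrix.one_apply_eq] at this
  linarith

theorem UpperDeg.inv {A : Matrix (Fin (k + 1)) (Fin (k + 1)) ℝ} (h : UpperDeg 0 A)
    (hdet : A.det ≠ 0) : UpperDeg 0 A⁻¹ := by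
  have : Invertible A := A.invertibleOfIsUnitDet (isUnit_iff_ne_zero.2 hdet)
  exact upperDeg_zero_iff.2 (Matrix.blockTriangular_inv_of_blockTriangular (upperDeg_zero_iff.1 h))

/-- An upper triangular gauge transformation does not change the flag of the curve. -/
theorem coord_eq_zero_iff_gaugedCoord (y : Solution f U)
    {A : ℝ → Matrix (Fin (k + 1)) (Fin (k + 1)) ℝ} {t : ℝ} (hA : UpperDeg 0 (A t))
    (hdet : (A t).det ≠ 0) (w : y.tangent) (r : ℕ) :
    (∀ m : Fin (k + 1), (m : ℕ) < r → gaugedCoord y A t w m = 0) ↔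
      ∀ m : Fin (k + 1), (m : ℕ) < r → w.1 t m = 0 := by
  have aux : ∀ {B : Matrix (Fin (k + 1)) (Fin (k + 1)) ℝ} {z : Fin (k + 1) → ℝ}, UpperDeg 0 B →
      (∀ m : Fin (k + 1), (m : ℕ) < r → z m = 0) →
      ∀ m : Fin (k + 1), (m : ℕ) < r → B.transpose.mulVec z m = 0 := by
    intro B z hB hz m hm
    change ∑ l, B l m * z l = 0
    refine Finset.sum_eq_zero fun l _ => ?_
    by_cases hl : (l : ℕ) < r
    · rw [hz l hl, mul_zero]
    · rw [hB l m (by omega), zero_mul]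
  refine ⟨fun h => ?_, aux hA⟩
  have h1 := aux (hA.inv hdet) h
  have h2 : (A t)⁻¹.transpose.mulVec (gaugedCoord y A t w) = w.1 t := by
    change (A t)⁻¹.transpose.mulVec ((A t).transpose.mulVec (w.1 t)) = w.1 t
    rw [Matrix.mulVec_mulVec, ← Matrix.transpose_mul,
      Matrix.mul_nonsing_inv _ (isUnit_iff_ne_zero.2 hdet), Matrix.transpose_one,
      Matrix.one_mulVec]
  rwa [h2] at h1

/-- There is a smooth unipotent gauge transformation on the domain of the equation that reduces
the linearizations along all solutions to canonical form. -/
theorem exists_universal_gauge (hU : IsOpen U) (hf : ContDiffOn ℝ ∞ f U) :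
    ∃ (A : ℝ × (Fin (k + 1) → ℝ) → Matrix (Fin (k + 1)) (Fin (k + 1)) ℝ)
      (κ : ℕ → ℝ × (Fin (k + 1) → ℝ) → ℝ),
      (∀ i j, ContDiffOn ℝ ∞ (fun q => A q i j) U) ∧ (∀ i, ContDiffOn ℝ ∞ (κ i) U) ∧
      (∀ q, UpperDeg 1 (A q - 1)) ∧
      (∀ y : Solution f U, ∀ t ∈ y.dom, ∀ i j,
        HasDerivAt (fun s => A (s, y.jet s) i j)
          (lieDerivMatrix (jetField f) A (t, y.jet t) i j) t) ∧
      ∀ y : Solution f U, ∀ t ∈ y.dom, companion k (fun i => y.linCoeff i t) * A (t, y.jet t) +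
        lieDerivMatrix (jetField f) A (t, y.jet t) =
          A (t, y.jet t) * canonicalMatrix k 0 fun i => κ i (t, y.jet t) := by
  obtain ⟨A, κ, hA, hκ, hA1, heq⟩ := exists_canonical_gauge hU (contDiffOn_jetField hf)
    (contDiffOn_partial hU hf)
  refine ⟨A, κ, hA, hκ, hA1, fun y t ht i j => ?_, fun y t ht => heq _ (y.mem_domain ht)⟩
  have h1 := (((hA i j).differentiableOn (by simp)).differentiableAt
    (hU.mem_nhds (y.mem_domain ht))).hasFDerivAt
  exact h1.comp_hasDerivAt t (y.hasDerivAt_point ht)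

/-- The standard form of a canonical matrix. -/
theorem canonicalMatrix_eq (hk : 1 ≤ k) (α : ℝ) (κ : ℕ → ℝ) :
    canonicalMatrix k α κ = slX k + α • slH k + κ 1 • slY k +
      ∑ i ∈ Finset.Icc 2 k, κ i • slY k ^ i + κ 0 • 1 := by
  have : Finset.range (k + 1) = insert 0 (insert 1 (Finset.Icc 2 k)) := by
    ext i; simp; omega
  rw [canonicalMatrix, this, Finset.sum_insert (by simp), Finset.sum_insert (by simp)]
  simp only [pow_zero, pow_one]
  abel

/-- The linearization along a solution has Wilczynski invariants. -/
theorem exists_isWilczynskiSystem (hk : 1 ≤ k) (hU : IsOpen U) (hf : ContDiffOn ℝ ∞ f U)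
    (y : Solution f U) : ∃ θ, IsWilczynskiSystem y.dom y.linCoeff θ := by
  obtain ⟨A, κ, hA, hκ, hA1, hder, heq⟩ := exists_universal_gauge hU hf
  -- Rescaling the universal gauge by g with g' = −κ_0 g removes the scalar term κ_0. The factor g
  -- is found by integrating along this one solution.
  obtain ⟨g, hg, hg'⟩ := exists_integrating_factor y.isOpen_dom y.ordConnected_dom y.nonempty_dom
    (y.contDiffOn_comp_point hf (hκ 0)).neg
  refine ⟨fun i t => κ (i - 1) (t, y.jet t), fun t => g t • A (t, y.jet t), fun _ => 0,
    fun t => κ 1 (t, y.jet t), fun i j => hg.mul (y.contDiffOn_comp_point hf (hA i j)),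
    fun t ht => ?_⟩
  obtain ⟨hg0, hgd⟩ := hg' t ht
  set q := (t, y.jet t) with hq
  obtain ⟨hup, hdet⟩ := (hA1 q).det_eq_one
  have hW : (g t • A q).det ≠ 0 := by
    rw [Matrix.det_smul, hdet, mul_one]; exact pow_ne_zero _ hg0
  refine ⟨upperDeg_zero_iff.1 (hup.smul _), hW, ?_⟩
  have hd : Matrix.of (fun i j => deriv (fun s => (g s • A (s, y.jet s)) i j) t) =
      g t • lieDerivMatrix (jetField f) A q - (κ 0 q * g t) • A q := by
    ext i j
    have h1 : HasDerivAt (fun s => (g s • A (s, y.jet s)) i j) _ t := hgd.mul (hder y t ht i j)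
    rw [Matrix.of_apply, h1.deriv]
    simp only [Matrix.sub_apply, Matrix.smul_apply, smul_eq_mul, ← hq]
    ring
  have hcan : (companion k (fun i => y.linCoeff i t) * (g t • A q) +
      (g t • lieDerivMatrix (jetField f) A q - (κ 0 q * g t) • A q)) =
      (g t • A q) * (canonicalMatrix k 0 (fun i => κ i q) - κ 0 q • 1) := by
    rw [mul_sub, Matrix.smul_mul, ← heq y t ht, Matrix.mul_smul, Matrix.mul_smul, mul_one,
      smul_add, smul_smul]
    abel
  rw [hd, Matrix.mul_assoc, ← mul_add, hcan, ← Matrix.mul_assoc,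
    Matrix.nonsing_inv_mul _ (isUnit_iff_ne_zero.2 hW), one_mul, canonicalMatrix_eq hk]
  simp [hq]

/-- The coefficients of the canonical Maurer-Cartan matrix that belongs to the
generalized Wilczynski invariants. -/
def wilczynskiCoeff (y : Solution f U) (β : ℝ → ℝ) (i : ℕ) (t : ℝ) : ℝ :=
  if i = 0 then 0 else if i = 1 then β t else genWilczynski y (i + 1) t

/-- A canonical frame of the cotangent space at a solution that realizes the generalized
Wilczynski invariants. -/
theorem exists_wilczynski_frame (hk : 1 ≤ k) (hU : IsOpen U) (hf : ContDiffOn ℝ ∞ f U)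
    (y : Solution f U) :
    ∃ (A : ℝ → Matrix (Fin (k + 1)) (Fin (k + 1)) ℝ) (α β : ℝ → ℝ),
      (∀ t ∈ y.dom, UpperDeg 0 (A t) ∧ (A t).det ≠ 0) ∧
      IsMovingFrame y.dom (fun t => canonicalMatrix k (α t) fun i => wilczynskiCoeff y β i t)
        (gaugedCoord y A) := by
  -- Existence is all that is required: whichever system the choice operator selects, its frame is
  -- canonical and the rigidity theorems apply to it.
  have hspec : IsWilczynskiSystem y.dom y.linCoeff (genWilczynski y) :=
    Classical.epsilon_spec (exists_isWilczynskiSystem hk hU hf y)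
  obtain ⟨A, α, β, hA, h⟩ := hspec
  refine ⟨A, α, β, fun t ht => ⟨upperDeg_zero_iff.2 (h t ht).1, (h t ht).2.1⟩, ?_⟩
  refine (y.isMovingFrame_coord hU hf).change hA
    (A' := fun t => Matrix.of fun i j => deriv (fun s => A s i j) t)
    (fun t ht i j => (((hA i j).differentiableOn (by simp)).differentiableAt
      (y.isOpen_dom.mem_nhds ht)).hasDerivAt) (fun t ht => (h t ht).2.1) fun t ht => ?_
  obtain ⟨-, hdet, heq⟩ := h t ht
  have hcan : (canonicalMatrix k (α t) fun i => wilczynskiCoeff y β i t) =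
      slX k + α t • slH k + β t • slY k +
        ∑ i ∈ Finset.Icc 2 k, genWilczynski y (i + 1) t • slY k ^ i := by
    rw [canonicalMatrix_eq hk]
    have : ∀ i ∈ Finset.Icc 2 k, wilczynskiCoeff y β i t • slY k ^ i =
        genWilczynski y (i + 1) t • slY k ^ i := by
      intro i hi
      have := (Finset.mem_Icc.1 hi).1
      rw [wilczynskiCoeff, if_neg (by omega), if_neg (by omega)]
    rw [Finset.sum_congr rfl this]
    simp [wilczynskiCoeff]
  rw [hcan, ← heq, mul_add, ← Matrix.mul_assoc, ← Matrix.mul_assoc, ← Matrix.mul_assoc,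
    Matrix.mul_nonsing_inv _ (isUnit_iff_ne_zero.2 hdet), one_mul, one_mul]

/-- A canonical frame at every solution that depends smoothly on jets. -/
theorem exists_universal_frame (hU : IsOpen U) (hf : ContDiffOn ℝ ∞ f U) :
    ∃ (A : ℝ × (Fin (k + 1) → ℝ) → Matrix (Fin (k + 1)) (Fin (k + 1)) ℝ)
      (κ : ℕ → ℝ × (Fin (k + 1) → ℝ) → ℝ),
      (∀ i j, ContDiffOn ℝ ∞ (fun q => A q i j) U) ∧
      (∀ q, UpperDeg 0 (A q) ∧ (A q).det ≠ 0) ∧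
      ∀ y : Solution f U, IsMovingFrame y.dom
        (fun t => canonicalMatrix k 0 fun i => κ i (t, y.jet t))
        (gaugedCoord y fun t => A (t, y.jet t)) := by
  obtain ⟨A, κ, hA, -, hA1, hder, heq⟩ := exists_universal_gauge hU hf
  refine ⟨A, κ, hA, fun q => ⟨(hA1 q).det_eq_one.1, by simp [(hA1 q).det_eq_one.2]⟩, fun y => ?_⟩
  exact (y.isMovingFrame_coord hU hf).change (fun i j => y.contDiffOn_comp_point hf (hA i j))
    (hder y) (fun t _ => by simp [(hA1 (t, y.jet t)).det_eq_one.2]) (heq y)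

end SolutionSpace

/-! ### Compatible bilinear forms at a solution -/

section BilinearForms

variable {k : ℕ}

/-- The bilinear form with antidiagonal matrix in the coordinates changed by `A`. -/
def gaugedForm (A : Matrix (Fin (k + 1)) (Fin (k + 1)) ℝ) :
    LinearMap.BilinForm ℝ (Fin (k + 1) → ℝ) :=
  Matrix.toBilin' (A * antidiag k * A.transpose)

theorem gaugedForm_apply (A : Matrix (Fin (k + 1)) (Fin (k + 1)) ℝ) (u w : Fin (k + 1) → ℝ) :
    gaugedForm A u w =
      A.transpose.mulVec u ⬝ᵥ (antidiag k).mulVec (A.transpose.mulVec w) := by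
  rw [gaugedForm, Matrix.toBilin'_apply', Matrix.mulVec_mulVec, Matrix.mulVec_transpose A u,
    ← Matrix.dotProduct_mulVec, Matrix.mulVec_mulVec, ← Matrix.mul_assoc]

/-- Transposition exchanges the signs (−1)^i and (−1)^{k−i}. This separates the conformal case (k
even) from the symplectic one (k odd). -/
theorem antidiag_transpose : (antidiag k).transpose = (-1 : ℝ) ^ k • antidiag k := by
  ext i j
  have hi := i.2
  have hj := j.2
  simp only [antidiag, Matrix.transpose_apply, Matrix.of_apply, Matrix.smul_apply, smul_eq_mul]
  by_cases h : i = j.rev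
  · subst h
    rw [if_pos (by simp), if_pos rfl, ← pow_add, Fin.val_rev]
    obtain ⟨d, hd⟩ : ∃ d, k = j + d := ⟨k - j, by omega⟩
    have : k + (k + 1 - ((j : ℕ) + 1)) = j + 2 * d := by omega
    rw [this, pow_add, pow_mul]; simp
  · rw [if_neg h, if_neg (by rintro rfl; simp at h), mul_zero]

theorem antidiag_symm (u w : Fin (k + 1) → ℝ) :
    u ⬝ᵥ (antidiag k).mulVec w = (-1) ^ k * (w ⬝ᵥ (antidiag k).mulVec u) := by
  rw [Matrix.dotProduct_mulVec, ← Matrix.mulVec_transpose, antidiag_transpose, Matrix.smul_mulVec,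
    smul_dotProduct, dotProduct_comm, smul_eq_mul]

theorem gaugedForm_symm (A : Matrix (Fin (k + 1)) (Fin (k + 1)) ℝ) (u w : Fin (k + 1) → ℝ) :
    gaugedForm A u w = (-1) ^ k * gaugedForm A w u := by
  rw [gaugedForm_apply, gaugedForm_apply, antidiag_symm]

theorem det_antidiag_ne_zero : (antidiag k).det ≠ 0 := by
  intro h
  have := congrArg Matrix.det (antidiag_mul_antidiag (k := k))
  rw [Matrix.det_mul, h, zero_mul, Matrix.det_smul, Matrix.det_one, mul_one] at this
  exact pow_ne_zero _ (pow_ne_zero _ (by norm_num)) this.symm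

theorem gaugedForm_nondegenerate {A : Matrix (Fin (k + 1)) (Fin (k + 1)) ℝ} (hA : A.det ≠ 0) :
    (gaugedForm A).Nondegenerate := by
  rw [gaugedForm, LinearMap.BilinForm.nondegenerate_toBilin'_iff_det_ne_zero, Matrix.det_mul,
    Matrix.det_mul, Matrix.det_transpose]
  exact mul_ne_zero (mul_ne_zero hA det_antidiag_ne_zero) hA

theorem contDiffOn_gaugedForm {E : Type*} [NormedAddCommGroup E] [NormedSpace ℝ E] {W : Set E}
    {A : E → Matrix (Fin (k + 1)) (Fin (k + 1)) ℝ}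
    (hA : ∀ i j, ContDiffOn ℝ ∞ (fun q => A q i j) W) (u w : Fin (k + 1) → ℝ) :
    ContDiffOn ℝ ∞ (fun q => gaugedForm (A q) u w) W := by
  simp only [gaugedForm, Matrix.toBilin'_apply]
  refine ContDiffOn.sum fun i _ => ContDiffOn.sum fun j _ =>
    (contDiffOn_const.mul ?_).mul contDiffOn_const
  exact contDiffOn_matrix_mul (M := fun q => A q * antidiag k) (N := fun q => (A q).transpose)
    (contDiffOn_matrix_mul (N := fun _ => antidiag k) hA fun _ _ => contDiffOn_const)
    (fun a b => hA b a) i j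

variable {f : ℝ × (Fin (k + 1) → ℝ) → ℝ} {U : Set (ℝ × (Fin (k + 1) → ℝ))}

theorem gaugedForm_comp_coord (y : Solution f U) (A : ℝ → Matrix (Fin (k + 1)) (Fin (k + 1)) ℝ)
    (t : ℝ) (u w : y.tangent) :
    (gaugedForm (A t)).comp (y.coord t) (y.coord t) u w =
      gaugedCoord y A t u ⬝ᵥ (antidiag k).mulVec (gaugedCoord y A t w) := by
  rw [LinearMap.BilinForm.comp_apply, gaugedForm_apply]
  rfl

/-- A bilinear form compatible with the curve of a solution is proportional to the antidiagonal
form in every canonical frame. -/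
theorem exists_eq_smul_of_compatibleBilin (hU : IsOpen U) (hf : ContDiffOn ℝ ∞ f U)
    (y : Solution f U) {b : LinearMap.BilinForm ℝ y.tangent}
    (hb : CompatibleBilin k y.dom y.curve b) {A : ℝ → Matrix (Fin (k + 1)) (Fin (k + 1)) ℝ}
    (hA : ∀ t ∈ y.dom, UpperDeg 0 (A t) ∧ (A t).det ≠ 0) {α : ℝ → ℝ} {κ : ℕ → ℝ → ℝ}
    (hF : IsMovingFrame y.dom (fun t => canonicalMatrix k (α t) fun i => κ i t)
      (gaugedCoord y A)) {t : ℝ} (ht : t ∈ y.dom) :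
    ∃ c : ℝ, b = c • (gaugedForm (A t)).comp (y.coord t) (y.coord t) ∧
      ∀ i, 1 ≤ i → i ≤ k → Even i → c * κ i t = 0 := by
  have hosc : ∀ t ∈ y.dom, ∀ a : Fin (k + 1), ∀ i, i ≤ k → k ≤ i + a →
      dualFrame (gaugedCoord y A) t a ∈ osculating y.dom y.curve i t := by
    intro t ht a i hi hia
    rw [y.mem_osculating_iff hU hf ht hi]
    have := (coord_eq_zero_iff_gaugedCoord y (hA t ht).1 (hA t ht).2
      (dualFrame (gaugedCoord y A) t a) (k - i)).1 fun m hm => by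
        rw [hF.apply_dualFrame ht, Pi.single_eq_of_ne]
        rintro rfl; omega
    exact fun m hm => this m (by omega)
  -- If i + j > k, then ε_i lies in γ^{(k−i)} and ε_j in γ^{(i−1)}, whose orders add up to k − 1.
  -- Since j ≤ k, the index i − 1 is not truncated.
  obtain ⟨c, hc, hκ⟩ := hF.bilin_rigidity y.isOpen_dom (b := b) (fun s hs i j hij => by
    have hi := i.2
    have hj := j.2
    exact hb s hs (k - i) (i - 1) (by omega) _ (hosc s hs i _ (by omega) (by omega)) _
      (hosc s hs j _ (by omega) (by omega))) ht
  refine ⟨c, ?_, hκ⟩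
  ext u w
  rw [hc, LinearMap.smul_apply, LinearMap.smul_apply, smul_eq_mul, gaugedForm_comp_coord]

theorem compatibleBilin_smul {y : Solution f U} {b : LinearMap.BilinForm ℝ y.tangent} (c : ℝ)
    (hb : CompatibleBilin k y.dom y.curve b) : CompatibleBilin k y.dom y.curve (c • b) := by
  intro t ht i j hij u hu w hw
  rw [LinearMap.smul_apply, LinearMap.smul_apply, hb t ht i j hij u hu w hw, smul_zero]

/-- If the invariants of odd index vanish, there is a compatible bilinear form. -/
theorem exists_compatibleBilin (hk : 1 ≤ k) (hU : IsOpen U) (hf : ContDiffOn ℝ ∞ f U)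
    (y : Solution f U) (hΘ : ∀ i : ℕ, 1 ≤ i → 2 * i + 1 ≤ k + 1 →
      ∀ x ∈ y.dom, genWilczynski y (2 * i + 1) x = 0) :
    ∃ b : LinearMap.BilinForm ℝ y.tangent, b ≠ 0 ∧ CompatibleBilin k y.dom y.curve b := by
  obtain ⟨A, α, β, hA, hF⟩ := exists_wilczynski_frame hk hU hf y
  have hκ : ∀ t ∈ y.dom, ∀ i, i ≤ k → Even i → wilczynskiCoeff y β i t = 0 := by
    rintro t ht i hi ⟨j, rfl⟩
    rcases Nat.eq_zero_or_pos j with rfl | hj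
    · simp [wilczynskiCoeff]
    · rw [wilczynskiCoeff, if_neg (by omega), if_neg (by omega), ← two_mul]
      exact hΘ j hj (by omega) t ht
  obtain ⟨s, hs⟩ := y.nonempty_dom
  -- The form J of the frame at one time s. As it has the same expression at every t, compatibility
  -- can be checked at each t in the frame at t.
  refine ⟨(gaugedForm (A s)).comp (y.coord s) (y.coord s), fun h0 => ?_, ?_⟩
  · have h1 := gaugedForm_comp_coord y A s (dualFrame (gaugedCoord y A) s 0)
      (dualFrame (gaugedCoord y A) s (Fin.last k))
    rw [h0, hF.apply_dualFrame hs, hF.apply_dualFrame hs] at h1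
    simp [antidiag] at h1
  · intro t ht i j hij u hu w hw
    rw [gaugedForm_comp_coord,
      hF.antidiag_const y.isOpen_dom y.ordConnected_dom hκ hs ht u w]
    have hu' := (coord_eq_zero_iff_gaugedCoord y (hA t ht).1 (hA t ht).2 u (k - i)).2
      fun m hm => (y.mem_osculating_iff hU hf ht (by omega) u).1 hu m (by omega)
    have hw' := (coord_eq_zero_iff_gaugedCoord y (hA t ht).1 (hA t ht).2 w (k - j)).2
      fun m hm => (y.mem_osculating_iff hU hf ht (by omega) w).1 hw m (by omega)
    simp only [dotProduct, Matrix.mulVec]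
    refine Finset.sum_eq_zero fun a _ => ?_
    by_cases ha : (a : ℕ) < k - i
    · rw [hu' a ha, zero_mul]
    · rw [Finset.sum_eq_zero fun c _ => ?_, mul_zero]
      by_cases hc : (c : ℕ) < k - j
      · rw [hw' c hc, mul_zero]
      -- Here a ≥ k − i and c ≥ k − j, so a + c ≥ k + 1, while J is supported on a + c = k.
      · have : a ≠ c.rev := by rintro rfl; rw [Fin.val_rev] at ha; omega
        simp [antidiag, this]

/-- A non-zero compatible bilinear form spans the line of the antidiagonal form in a canonical
frame. -/
theorem span_eq_of_compatibleBilin (hU : IsOpen U) (hf : ContDiffOn ℝ ∞ f U)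
    (y : Solution f U) {b : LinearMap.BilinForm ℝ y.tangent} (hb0 : b ≠ 0)
    (hb : CompatibleBilin k y.dom y.curve b) {A : ℝ → Matrix (Fin (k + 1)) (Fin (k + 1)) ℝ}
    (hA : ∀ t ∈ y.dom, UpperDeg 0 (A t) ∧ (A t).det ≠ 0) {α : ℝ → ℝ} {κ : ℕ → ℝ → ℝ}
    (hF : IsMovingFrame y.dom (fun t => canonicalMatrix k (α t) fun i => κ i t)
      (gaugedCoord y A)) {t : ℝ} (ht : t ∈ y.dom) :
    Submodule.span ℝ {b} =
      Submodule.span ℝ {(gaugedForm (A t)).comp (y.coord t) (y.coord t)} := by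
  obtain ⟨c, hc, -⟩ := exists_eq_smul_of_compatibleBilin hU hf y hb hA hF ht
  have hc0 : c ≠ 0 := by rintro rfl; rw [zero_smul] at hc; exact hb0 hc
  rw [hc]
  exact Submodule.span_singleton_smul_eq (isUnit_iff_ne_zero.2 hc0) _

/-- The natural line of bilinear forms at every solution, with smooth generators on charts. -/
theorem exists_natural_line (hk : 1 ≤ k) (hU : IsOpen U) (hf : ContDiffOn ℝ ∞ f U)
    (hΘ : ∀ i : ℕ, 1 ≤ i → 2 * i + 1 ≤ k + 1 → GenWilczynskiVanishes f U (2 * i + 1)) :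
    ∃ (line : ∀ y : Solution f U, Submodule ℝ (LinearMap.BilinForm ℝ y.tangent))
      (A : ℝ × (Fin (k + 1) → ℝ) → Matrix (Fin (k + 1)) (Fin (k + 1)) ℝ),
      (∀ i j, ContDiffOn ℝ ∞ (fun q => A q i j) U) ∧ (∀ q, (A q).det ≠ 0) ∧
      (∀ (y : Solution f U) (x₀ : ℝ), x₀ ∈ y.dom → line y = Submodule.span ℝ
        {(gaugedForm (A (x₀, y.jet x₀))).comp (y.coord x₀) (y.coord x₀)}) ∧
      ∀ y, ∀ b ∈ line y, CompatibleBilin k y.dom y.curve b := by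
  obtain ⟨A, κ, hA, hA1, hF⟩ := exists_universal_frame hU hf
  -- The form b comes from a Wilczynski frame chosen separately at each solution, with no control
  -- across solutions. By rigidity its line is also spanned by J in the universal frame, which is
  -- smooth on charts.
  choose b hb0 hb using fun y : Solution f U =>
    exists_compatibleBilin hk hU hf y fun i h1 h2 => hΘ i h1 h2 y
  refine ⟨fun y => Submodule.span ℝ {b y}, A, hA, fun q => (hA1 q).2, fun y x₀ hx₀ => ?_,
    fun y b' hb' => ?_⟩
  · exact span_eq_of_compatibleBilin hU hf y (hb0 y) (hb y) (fun t _ => hA1 (t, y.jet t)) (hF y) hx₀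
  · obtain ⟨c, rfl⟩ := Submodule.mem_span_singleton.1 hb'
    exact compatibleBilin_smul c (hb y)

theorem contDiffOn_initialValues {g : ℝ × (Fin (k + 1) → ℝ) → ℝ} (hg : ContDiffOn ℝ ∞ g U)
    (x₀ : ℝ) : ContDiffOn ℝ ∞ (fun a => g (x₀, a)) (initialValues U x₀) :=
  hg.comp (contDiffOn_const.prodMk contDiffOn_id) fun _ ha => ha

theorem comp_coord_ne_zero (hU : IsOpen U) (hf : ContDiffOn ℝ ∞ f U) (y : Solution f U) {x₀ : ℝ}
    (hx₀ : x₀ ∈ y.dom) {g : LinearMap.BilinForm ℝ (Fin (k + 1) → ℝ)} (hg : g.Nondegenerate) :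
    g.comp (y.coord x₀) (y.coord x₀) ≠ 0 := by
  intro h
  have hsurj := ((y.isMovingFrame_coord hU hf).bijective x₀ hx₀).2
  have h0 : (1 : Fin (k + 1) → ℝ) = 0 := by
    refine hg.1 _ fun w => ?_
    obtain ⟨u', hu⟩ := hsurj 1
    obtain ⟨w', hw⟩ := hsurj w
    rw [← hu, ← hw]
    exact LinearMap.congr_fun₂ h u' w'
  simpa using congrFun h0 0

/-- Consequences of the existence of a non-zero compatible form of parity `ε` at a solution. -/
theorem vanishing_of_compatibleBilin (hk : 1 ≤ k) (hU : IsOpen U) (hf : ContDiffOn ℝ ∞ f U)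
    (y : Solution f U) {b : LinearMap.BilinForm ℝ y.tangent} (hb0 : b ≠ 0)
    (hb : CompatibleBilin k y.dom y.curve b) :
    (∀ i : ℕ, 1 ≤ i → 2 * i + 1 ≤ k + 1 → ∀ x ∈ y.dom, genWilczynski y (2 * i + 1) x = 0) ∧
      ∀ ε : ℝ, (∀ u w, b u w = ε * b w u) → ε = (-1) ^ k := by
  obtain ⟨A, α, β, hA, hF⟩ := exists_wilczynski_frame hk hU hf y
  have hrig := fun {t} ht => exists_eq_smul_of_compatibleBilin hU hf y hb hA hF (t := t) ht
  refine ⟨fun i hi hik x hx => ?_, fun ε hε => ?_⟩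
  · obtain ⟨c, hc, hκ⟩ := hrig hx
    have hc0 : c ≠ 0 := by rintro rfl; rw [zero_smul] at hc; exact hb0 hc
    have := (mul_eq_zero.1 (hκ (2 * i) (by omega) (by omega) (even_two_mul i))).resolve_left hc0
    rwa [wilczynskiCoeff, if_neg (by omega), if_neg (by omega)] at this
  · obtain ⟨t, ht⟩ := y.nonempty_dom
    obtain ⟨c, hc, -⟩ := hrig ht
    have hc0 : c ≠ 0 := by rintro rfl; rw [zero_smul] at hc; exact hb0 hc
    -- The pair (ε_0, ε_k) is tested: J takes the values 1 and (−1)^k on its two orders.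
    have h1 := hε (dualFrame (gaugedCoord y A) t 0) (dualFrame (gaugedCoord y A) t (Fin.last k))
    simp only [hc, LinearMap.smul_apply, gaugedForm_comp_coord, hF.apply_dualFrame ht] at h1
    simp [antidiag] at h1
    have h2 := congrArg (· * (-1 : ℝ) ^ k) h1
    simp only [mul_assoc, ← pow_add, (Even.add_self k).neg_one_pow, mul_one] at h2
    exact mul_right_cancel₀ hc0 (h2.symm.trans (mul_comm _ _))

end BilinearForms

/-! ### Natural pseudo-conformal and pseudo-symplectic structures -/

section Theorems

variable {k : ℕ} {f : ℝ × (Fin (k + 1) → ℝ) → ℝ} {U : Set (ℝ × (Fin (k + 1) → ℝ))}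

/-- Without any solution, naturality would be vacuous and would not restrict k. -/
theorem exists_solution (hU : IsOpen U) (hne : U.Nonempty) (hf : ContDiffOn ℝ ∞ f U) :
    Nonempty (Solution f U) := by
  obtain ⟨⟨x₀, a⟩, ha⟩ := hne
  exact ⟨(exists_solution_through hU hf ha).choose⟩

theorem exists_natural_pseudoConformal_iff (hk : 1 ≤ k) (hU : IsOpen U) (hne : U.Nonempty)
    (hf : ContDiffOn ℝ ∞ f U) :
    (∃ S : PseudoConformalStructure f U, S.IsNatural) ↔
      Even k ∧ ∀ i : ℕ, 1 ≤ i → 2 * i + 1 ≤ k + 1 → GenWilczynskiVanishes f U (2 * i + 1) := by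
  constructor
  · rintro ⟨S, hS⟩
    have key : ∀ y : Solution f U, (∀ i : ℕ, 1 ≤ i → 2 * i + 1 ≤ k + 1 →
        ∀ x ∈ y.dom, genWilczynski y (2 * i + 1) x = 0) ∧ (1 : ℝ) = (-1) ^ k := by
      intro y
      obtain ⟨x₀, hx₀⟩ := y.nonempty_dom
      obtain ⟨g, -, hg, hline⟩ := S.exists_metric x₀
      obtain ⟨hsym, hnd⟩ := hg _ (y.mem_domain hx₀)
      obtain ⟨h1, h2⟩ := vanishing_of_compatibleBilin hk hU hf y
        (comp_coord_ne_zero hU hf y hx₀ hnd) (hS y _ (by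
          rw [hline y hx₀]; exact Submodule.mem_span_singleton_self _))
      exact ⟨h1, h2 1 fun u w => by
        rw [one_mul, LinearMap.BilinForm.comp_apply, LinearMap.BilinForm.comp_apply]
        exact hsym.eq _ _⟩
    obtain ⟨y⟩ := exists_solution hU hne hf
    refine ⟨?_, fun i h1 h2 y => (key y).1 i h1 h2⟩
    by_contra hodd
    have := (key y).2
    rw [(Nat.not_even_iff_odd.1 hodd).neg_one_pow] at this
    norm_num at this
  · rintro ⟨hev, hΘ⟩
    obtain ⟨line, A, hA, hdet, hline, hnat⟩ := exists_natural_line hk hU hf hΘ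
    refine ⟨⟨line, fun x₀ => ⟨fun a => gaugedForm (A (x₀, a)), fun u w =>
      contDiffOn_initialValues (contDiffOn_gaugedForm hA u w) x₀, fun a _ => ⟨⟨fun u w => ?_⟩,
      gaugedForm_nondegenerate (hdet _)⟩, fun y hx₀ => hline y x₀ hx₀⟩⟩, hnat⟩
    rw [gaugedForm_symm, hev.neg_one_pow, one_mul]

theorem exists_natural_pseudoSymplectic_iff (hk : 1 ≤ k) (hU : IsOpen U) (hne : U.Nonempty)
    (hf : ContDiffOn ℝ ∞ f U) :
    (∃ S : PseudoSymplecticStructure f U, S.IsNatural) ↔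
      Odd k ∧ ∀ i : ℕ, 1 ≤ i → 2 * i + 1 ≤ k + 1 → GenWilczynskiVanishes f U (2 * i + 1) := by
  constructor
  · rintro ⟨S, hS⟩
    have key : ∀ y : Solution f U, (∀ i : ℕ, 1 ≤ i → 2 * i + 1 ≤ k + 1 →
        ∀ x ∈ y.dom, genWilczynski y (2 * i + 1) x = 0) ∧ (-1 : ℝ) = (-1) ^ k := by
      intro y
      obtain ⟨x₀, hx₀⟩ := y.nonempty_dom
      obtain ⟨g, -, hg, hline⟩ := S.exists_twoForm x₀
      obtain ⟨halt, hnd⟩ := hg _ (y.mem_domain hx₀)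
      obtain ⟨h1, h2⟩ := vanishing_of_compatibleBilin hk hU hf y
        (comp_coord_ne_zero hU hf y hx₀ hnd) (hS y _ (by
          rw [hline y hx₀]; exact Submodule.mem_span_singleton_self _))
      exact ⟨h1, h2 (-1) fun u w => by
        rw [LinearMap.BilinForm.comp_apply, LinearMap.BilinForm.comp_apply, neg_one_mul]
        exact (LinearMap.IsAlt.neg halt _ _).symm⟩
    obtain ⟨y⟩ := exists_solution hU hne hf
    refine ⟨?_, fun i h1 h2 y => (key y).1 i h1 h2⟩
    by_contra hodd
    have := (key y).2
    rw [(Nat.not_odd_iff_even.1 hodd).neg_one_pow] at this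
    norm_num at this
  · rintro ⟨hodd, hΘ⟩
    obtain ⟨line, A, hA, hdet, hline, hnat⟩ := exists_natural_line hk hU hf hΘ
    refine ⟨⟨line, fun x₀ => ⟨fun a => gaugedForm (A (x₀, a)), fun u w =>
      contDiffOn_initialValues (contDiffOn_gaugedForm hA u w) x₀, fun a _ => ⟨fun u => ?_,
      gaugedForm_nondegenerate (hdet _)⟩, fun y hx₀ => hline y x₀ hx₀⟩⟩, hnat⟩
    have := gaugedForm_symm (A (x₀, a)) u u
    rw [hodd.neg_one_pow] at this
    linarith

/-- Non-degenerate compatible forms at a solution are proportional. -/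
theorem span_eq_span_of_compatibleBilin (hU : IsOpen U) (hf : ContDiffOn ℝ ∞ f U)
    (y : Solution f U) {b b' : LinearMap.BilinForm ℝ y.tangent} (hb0 : b ≠ 0) (hb0' : b' ≠ 0)
    (hb : CompatibleBilin k y.dom y.curve b) (hb' : CompatibleBilin k y.dom y.curve b') :
    Submodule.span ℝ {b} = Submodule.span ℝ {b'} := by
  obtain ⟨A, κ, -, hA1, hF⟩ := exists_universal_frame hU hf
  obtain ⟨t, ht⟩ := y.nonempty_dom
  rw [span_eq_of_compatibleBilin hU hf y hb0 hb (fun t _ => hA1 (t, y.jet t)) (hF y) ht,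
    span_eq_of_compatibleBilin hU hf y hb0' hb' (fun t _ => hA1 (t, y.jet t)) (hF y) ht]

theorem PseudoConformalStructure.eq_of_isNatural (hU : IsOpen U) (hf : ContDiffOn ℝ ∞ f U)
    (S S' : PseudoConformalStructure f U) (hS : S.IsNatural) (hS' : S'.IsNatural) : S = S' := by
  ext1
  funext y
  obtain ⟨x₀, hx₀⟩ := y.nonempty_dom
  obtain ⟨g, -, hg, hline⟩ := S.exists_metric x₀
  obtain ⟨g', -, hg', hline'⟩ := S'.exists_metric x₀
  have h := hS y
  have h' := hS' y
  rw [hline y hx₀] at h ⊢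
  rw [hline' y hx₀] at h' ⊢
  exact span_eq_span_of_compatibleBilin hU hf y
    (comp_coord_ne_zero hU hf y hx₀ (hg _ (y.mem_domain hx₀)).2)
    (comp_coord_ne_zero hU hf y hx₀ (hg' _ (y.mem_domain hx₀)).2)
    (h _ (Submodule.mem_span_singleton_self _)) (h' _ (Submodule.mem_span_singleton_self _))

theorem PseudoSymplecticStructure.eq_of_isNatural (hU : IsOpen U) (hf : ContDiffOn ℝ ∞ f U)
    (S S' : PseudoSymplecticStructure f U) (hS : S.IsNatural) (hS' : S'.IsNatural) : S = S' := by
  ext1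
  funext y
  obtain ⟨x₀, hx₀⟩ := y.nonempty_dom
  obtain ⟨g, -, hg, hline⟩ := S.exists_twoForm x₀
  obtain ⟨g', -, hg', hline'⟩ := S'.exists_twoForm x₀
  have h := hS y
  have h' := hS' y
  rw [hline y hx₀] at h ⊢
  rw [hline' y hx₀] at h' ⊢
  exact span_eq_span_of_compatibleBilin hU hf y
    (comp_coord_ne_zero hU hf y hx₀ (hg _ (y.mem_domain hx₀)).2)
    (comp_coord_ne_zero hU hf y hx₀ (hg' _ (y.mem_domain hx₀)).2)
    (h _ (Submodule.mem_span_singleton_self _)) (h' _ (Submodule.mem_span_singleton_self _))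

end Theorems

/-! ### 3-forms as trilinear maps -/

section TrilinearForms

variable {V : Type*} [AddCommGroup V] [Module ℝ V]

/-- The bilinear form `Ω(x, ·, ·)`. -/
def contraction (Ω : V [⋀^Fin 3]→ₗ[ℝ] ℝ) (x : V) : LinearMap.BilinForm ℝ V :=
  LinearMap.mk₂ ℝ (fun u w => (((Ω.curryLeft x).curryLeft u).curryLeft w) ![])
    (fun u u' w => by simp only [map_add, AlternatingMap.curryLeft_add, LinearMap.add_apply,
      AlternatingMap.add_apply])
    (fun c u w => by simp only [map_smul, AlternatingMap.curryLeft_smul, LinearMap.smul_apply,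
      AlternatingMap.smul_apply])
    (fun u w w' => by simp only [map_add, AlternatingMap.add_apply])
    (fun c u w => by simp only [map_smul, AlternatingMap.smul_apply])

theorem contraction_add (Ω : V [⋀^Fin 3]→ₗ[ℝ] ℝ) (x x' : V) :
    contraction Ω (x + x') = contraction Ω x + contraction Ω x' := by
  ext u w
  simp [contraction]

theorem contraction_smul (Ω : V [⋀^Fin 3]→ₗ[ℝ] ℝ) (c : ℝ) (x : V) :
    contraction Ω (c • x) = c • contraction Ω x := by
  ext u w
  simp [contraction]

/-- A `3`-form as a trilinear map. -/
def trilinear (Ω : V [⋀^Fin 3]→ₗ[ℝ] ℝ) : V →ₗ[ℝ] LinearMap.BilinForm ℝ V where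
  toFun := contraction Ω
  map_add' := contraction_add Ω
  map_smul' := contraction_smul Ω

theorem trilinear_apply (Ω : V [⋀^Fin 3]→ₗ[ℝ] ℝ) (x u w : V) :
    trilinear Ω x u w = Ω ![x, u, w] := rfl

theorem trilinear_swap_left (Ω : V [⋀^Fin 3]→ₗ[ℝ] ℝ) (x u w : V) :
    trilinear Ω x u w = -trilinear Ω u x w := by
  rw [trilinear_apply, trilinear_apply,
    ← Ω.map_swap ![u, x, w] (show (0 : Fin 3) ≠ 1 by decide)]
  congr 1
  ext i
  fin_cases i <;> rfl

theorem trilinear_swap_right (Ω : V [⋀^Fin 3]→ₗ[ℝ] ℝ) (x u w : V) :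
    trilinear Ω x u w = -trilinear Ω x w u := by
  rw [trilinear_apply, trilinear_apply,
    ← Ω.map_swap ![x, w, u] (show (1 : Fin 3) ≠ 2 by decide)]
  congr 1
  ext i
  fin_cases i <;> rfl

/-- Product rule for a `3`-form along curves in a space with a moving frame. -/
theorem HasCoordDerivAt.trilin {k : ℕ} {I : Set ℝ}
    {N : ℝ → Matrix (Fin (k + 1)) (Fin (k + 1)) ℝ} {e : ℝ → V →ₗ[ℝ] (Fin (k + 1) → ℝ)}
    (h : IsMovingFrame I N e) {u v w : ℝ → V} {u' v' w' : V} {t : ℝ} (ht : t ∈ I)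
    (hu : HasCoordDerivAt u u' t) (hv : HasCoordDerivAt v v' t) (hw : HasCoordDerivAt w w' t)
    (T : V →ₗ[ℝ] LinearMap.BilinForm ℝ V) :
    HasDerivAt (fun s => T (u s) (v s) (w s))
      (T u' (v t) (w t) + T (u t) v' (w t) + T (u t) (v t) w') t := by
  have hexp : ∀ x y z : V, T x y z = ∑ i, e t x i * T (dualFrame e t i) y z := by
    intro x y z
    conv_lhs => rw [← h.sum_dualFrame ht x]
    simp
  have hcomp : ∀ i, HasDerivAt (fun s => e t (u s) i) (e t u' i) t := fun i =>
    hu ((LinearMap.proj i).comp (e t))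
  have h1 := HasDerivAt.fun_sum (u := Finset.univ) fun i _ =>
    (hcomp i).mul (HasCoordDerivAt.bilin h ht hv hw (T (dualFrame e t i)))
  simp only [mul_add, Finset.sum_add_distrib] at h1
  rw [← hexp, ← hexp, ← hexp, ← add_assoc] at h1
  exact h1.congr_of_eventuallyEq (Eventually.of_forall fun s => hexp _ _ _)

end TrilinearForms

/-! ### The invariant 3-form in dimension 7 and its stabilizer -/

/-- The `3 × 3` minor of three vectors with the given columns. -/
def minorForm (p q r : Fin 7) : (Fin 7 → ℝ) [⋀^Fin 3]→ₗ[ℝ] ℝ :=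
  Matrix.detRowAlternating.compLinearMap (LinearMap.funLeft ℝ ℝ ![p, q, r])

theorem minorForm_apply (p q r : Fin 7) (u v w : Fin 7 → ℝ) :
    minorForm p q r ![u, v, w] = u p * v q * w r - u p * v r * w q - u q * v p * w r
      + u q * v r * w p + u r * v p * w q - u r * v q * w p := by
  change Matrix.det (Matrix.of fun i => LinearMap.funLeft ℝ ℝ ![p, q, r] (![u, v, w] i)) = _
  rw [Matrix.det_fin_three]
  simp [LinearMap.funLeft]

/-- The `3`-form on the irreducible representation of `sl₂` of dimension 7 that is invariant under
`sl₂` and `y ^ 5`. -/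
def invariantForm : (Fin (6 + 1) → ℝ) [⋀^Fin 3]→ₗ[ℝ] ℝ :=
  minorForm 0 3 6 - minorForm 0 4 5 + minorForm 1 3 5 - (2 : ℝ) • minorForm 1 2 6
    - minorForm 2 3 4

theorem invariantForm_apply (u v w : Fin (6 + 1) → ℝ) :
    invariantForm ![u, v, w] = minorForm 0 3 6 ![u, v, w] - minorForm 0 4 5 ![u, v, w]
      + minorForm 1 3 5 ![u, v, w] - 2 * minorForm 1 2 6 ![u, v, w]
      - minorForm 2 3 4 ![u, v, w] := rfl

/-- The isomorphism follows H-weights. The scalar part has weight 0, the entries of v have weights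
6, −2, −4 with sum zero, and those of w the opposite weights, as for an element of sl₃ ⊂ g₂. The
factors 2 and the sign match the coefficients. -/
theorem isG2Form_invariantForm : IsG2Form invariantForm := by
  let e : (Fin (6 + 1) → ℝ) ≃ₗ[ℝ] ImOctonion :=
    { toFun := fun u => (u 3, ![u 0, u 4, 2 * u 5], ![2 * u 6, 2 * u 2, -u 1])
      map_add' := fun u v => by
        ext i <;> [skip; fin_cases i; fin_cases i] <;> simp <;> ring
      map_smul' := fun c u => by
        ext i <;> [skip; fin_cases i; fin_cases i] <;> simp <;> ring
      invFun := fun z => ![z.2.1 0, -z.2.2 2, z.2.2 1 / 2, z.1, z.2.1 1, z.2.1 2 / 2, z.2.2 0 / 2]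
      left_inv := fun u => by ext i; fin_cases i <;> simp
      right_inv := fun z => by
        ext i <;> [skip; fin_cases i; fin_cases i] <;> simp <;> ring }
  refine ⟨e, fun u v w => ?_⟩
  rw [invariantForm_apply]
  simp only [minorForm_apply]
  simp [e, splitForm, ImOctonion.incl, SplitOctonion.mul, SplitOctonion.scalarPart, crossProduct]
  ring

/-- Only one superdiagonal of a power of `y` is non-zero. -/
theorem slY_pow_eq (k d : ℕ) (i j : Fin (k + 1)) : (slY k ^ d) i j =
    if (j : ℕ) = i + d then
      ∏ l ∈ Finset.range d, (((i : ℝ) + l + 1) * ((k : ℝ) - i - l)) else 0 := by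
  induction d generalizing j with
  | zero =>
    by_cases h : i = j
    · subst h; simp
    · rw [pow_zero, Matrix.one_apply_ne h, if_neg fun h' => h (Fin.ext h'.symm)]
  | succ d ih =>
    split_ifs with h
    · have hj := j.2
      set l₀ : Fin (k + 1) := ⟨i + d, by omega⟩
      rw [pow_succ, Matrix.mul_apply, Finset.sum_eq_single l₀, ih, if_pos rfl,
        Finset.prod_range_succ]
      · have h1 : (j : ℕ) = (l₀ : ℕ) + 1 := h
        have h2 : ((j : ℕ) : ℝ) = i + d + 1 := by rw [h]; push_cast; ring
        simp only [slY, Matrix.of_apply, if_pos h1, h2]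
        ring
      · intro l _ hl
        rw [ih, if_neg fun h => hl (Fin.ext h), zero_mul]
      · simp
    · exact (slY_pow_apply (d + 1) i j).1 h

/-- Together with the three analogous identities this places X, H, Y and Y^5 in the stabilizer
algebra of the form, a copy of g₂. Hence Θ_6, the coefficient of Y^5, is unrestricted. -/
theorem trilinear_invariantForm_slX (u v w : Fin (6 + 1) → ℝ) :
    trilinear invariantForm ((slX 6).transpose.mulVec u) v w
      + trilinear invariantForm u ((slX 6).transpose.mulVec v) w
      + trilinear invariantForm u v ((slX 6).transpose.mulVec w) = 0 := by
  have h : ∀ u : Fin (6 + 1) → ℝ, (slX 6).transpose.mulVec u =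
      ![u 1, u 2, u 3, u 4, u 5, u 6, 0] := by
    intro u
    ext i
    fin_cases i <;> simp [Matrix.mulVec, dotProduct, slX, Fin.sum_univ_succ]
  simp only [h, trilinear_apply, invariantForm_apply, minorForm_apply]
  simp
  ring

theorem trilinear_invariantForm_slH (u v w : Fin (6 + 1) → ℝ) :
    trilinear invariantForm ((slH 6).transpose.mulVec u) v w
      + trilinear invariantForm u ((slH 6).transpose.mulVec v) w
      + trilinear invariantForm u v ((slH 6).transpose.mulVec w) = 0 := by
  have h : ∀ u : Fin (6 + 1) → ℝ, (slH 6).transpose.mulVec u =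
      ![6 * u 0, 4 * u 1, 2 * u 2, 0, -2 * u 4, -4 * u 5, -6 * u 6] := by
    intro u
    ext i
    fin_cases i <;> simp [slH, Matrix.mulVec_diagonal] <;> norm_num
  simp only [h, trilinear_apply, invariantForm_apply, minorForm_apply]
  simp
  ring

theorem trilinear_invariantForm_slY (u v w : Fin (6 + 1) → ℝ) :
    trilinear invariantForm ((slY 6).transpose.mulVec u) v w
      + trilinear invariantForm u ((slY 6).transpose.mulVec v) w
      + trilinear invariantForm u v ((slY 6).transpose.mulVec w) = 0 := by
  have h : ∀ u : Fin (6 + 1) → ℝ, (slY 6).transpose.mulVec u =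
      ![0, 6 * u 0, 10 * u 1, 12 * u 2, 12 * u 3, 10 * u 4, 6 * u 5] := by
    intro u
    ext i
    fin_cases i <;> simp [Matrix.mulVec, dotProduct, slY, Fin.sum_univ_succ] <;> norm_num
  simp only [h, trilinear_apply, invariantForm_apply, minorForm_apply]
  simp
  ring

theorem trilinear_invariantForm_slY_pow_five (u v w : Fin (6 + 1) → ℝ) :
    trilinear invariantForm ((slY 6 ^ 5).transpose.mulVec u) v w
      + trilinear invariantForm u ((slY 6 ^ 5).transpose.mulVec v) w
      + trilinear invariantForm u v ((slY 6 ^ 5).transpose.mulVec w) = 0 := by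
  have h : ∀ u : Fin (6 + 1) → ℝ, (slY 6 ^ 5).transpose.mulVec u =
      ![0, 0, 0, 0, 0, 86400 * u 0, 86400 * u 1] := by
    intro u
    ext i
    fin_cases i <;> simp [Matrix.mulVec, dotProduct, slY_pow_eq, Fin.sum_univ_succ,
      Finset.prod_range_succ] <;> norm_num
  simp only [h, trilinear_apply, invariantForm_apply, minorForm_apply]
  simp
  ring

/-! ### Components of trilinear forms and the action of matrices on them -/

section Components

/-- The action of a matrix on the components of a trilinear form. -/
def act {n : ℕ} (M : Matrix (Fin n) (Fin n) ℝ) (η : Fin n → Fin n → Fin n → ℝ) (a b c : Fin n) :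
    ℝ :=
  ∑ m, M a m * η m b c + ∑ m, M b m * η a m c + ∑ m, M c m * η a b m

variable {n : ℕ} (M M' : Matrix (Fin n) (Fin n) ℝ) (η : Fin n → Fin n → Fin n → ℝ)

theorem act_add (a b c : Fin n) : act (M + M') η a b c = act M η a b c + act M' η a b c := by
  simp only [act, Matrix.add_apply, add_mul, Finset.sum_add_distrib]
  ring

theorem act_smul (r : ℝ) (a b c : Fin n) : act (r • M) η a b c = r * act M η a b c := by
  simp only [act, Matrix.smul_apply, smul_eq_mul, mul_add, Finset.mul_sum, mul_assoc]

theorem act_sum {ι : Type*} (s : Finset ι) (F : ι → Matrix (Fin n) (Fin n) ℝ) (a b c : Fin n) :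
    act (∑ i ∈ s, F i) η a b c = ∑ i ∈ s, act (F i) η a b c := by
  classical
  induction s using Finset.induction_on with
  | empty => simp [act]
  | insert i s hi ih => rw [Finset.sum_insert hi, Finset.sum_insert hi, act_add, ih]

theorem act_const_mul (r : ℝ) (a b c : Fin n) :
    act M (fun a b c => r * η a b c) a b c = r * act M η a b c := by
  simp only [act, mul_add, Finset.mul_sum, mul_left_comm]

theorem act_one (a b c : Fin n) : act 1 η a b c = 3 * η a b c := by
  simp only [act, Matrix.one_apply, ite_mul, one_mul, zero_mul, Finset.sum_ite_eq,
    Finset.mem_univ, if_true]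
  ring

/-- An upper triangular matrix replaces an index only by an equal or larger one, so its action on
components of weight at least s never involves lower weights. -/
theorem act_congr {k : ℕ} {M : Matrix (Fin (k + 1)) (Fin (k + 1)) ℝ} (hM : UpperDeg 0 M)
    {η η' : Fin (k + 1) → Fin (k + 1) → Fin (k + 1) → ℝ} {s : ℕ}
    (h : ∀ a b c : Fin (k + 1), s ≤ (a : ℕ) + b + c → η a b c = η' a b c) {a b c : Fin (k + 1)}
    (hs : s ≤ (a : ℕ) + b + c) : act M η a b c = act M η' a b c := by
  have aux : ∀ (g g' : Fin (k + 1) → ℝ) (x : Fin (k + 1)),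
      (∀ m : Fin (k + 1), (x : ℕ) ≤ m → g m = g' m) → ∑ m, M x m * g m = ∑ m, M x m * g' m := by
    intro g g' x hg
    refine Finset.sum_congr rfl fun m _ => ?_
    by_cases hm : (x : ℕ) ≤ m
    · rw [hg m hm]
    · rw [hM x m (by omega), zero_mul, zero_mul]
  simp only [act]
  rw [aux _ (fun m => η' m b c) a fun m hm => h m b c (by omega),
    aux _ (fun m => η' a m c) b fun m hm => h a m c (by omega),
    aux _ (fun m => η' a b m) c fun m hm => h a b m (by omega)]

theorem eq_of_sorted {f g : Fin n → Fin n → Fin n → ℝ} (hf1 : ∀ a b c, f a b c = -f b a c)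
    (hf2 : ∀ a b c, f a b c = -f a c b) (hg1 : ∀ a b c, g a b c = -g b a c)
    (hg2 : ∀ a b c, g a b c = -g a c b) {s : ℕ}
    (h : ∀ a b c : Fin n, a < b → b < c → (a : ℕ) + b + c = s → f a b c = g a b c)
    (a b c : Fin n) (hs : (a : ℕ) + b + c = s) : f a b c = g a b c := by
  have hz1 : ∀ (f : Fin n → Fin n → Fin n → ℝ), (∀ a b c, f a b c = -f b a c) →
      ∀ a b, f a a b = 0 := fun f hf a b => by have := hf a a b; linarith
  have hz2 : ∀ (f : Fin n → Fin n → Fin n → ℝ), (∀ a b c, f a b c = -f a c b) →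
      ∀ a b, f a b b = 0 := fun f hf a b => by have := hf a b b; linarith
  have two : ∀ a b c : Fin n, a < b → (a : ℕ) + b + c = s → f a b c = g a b c := by
    intro a b c hab hs
    rcases lt_trichotomy b c with hbc | rfl | hbc
    · exact h a b c hab hbc hs
    · rw [hz2 f hf2, hz2 g hg2]
    · rw [hf2, hg2]
      rcases lt_trichotomy a c with hac | rfl | hac
      · rw [h a c b hac hbc (by omega)]
      · rw [hz1 f hf1, hz1 g hg1]
      · rw [hf1, hg1, h c a b hac hab (by omega)]
  rcases lt_trichotomy a b with hab | rfl | hab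
  · exact two a b c hab hs
  · rw [hz1 f hf1, hz1 g hg1]
  · rw [hf1, hg1, two b a c hab (by omega)]

end Components

/-! ### Components of the invariant 3-form, by weight -/

section InvariantComponents

/-- The components of the invariant `3`-form. -/
def invCoeff (a b c : Fin (6 + 1)) : ℝ :=
  trilinear invariantForm (Pi.single a 1) (Pi.single b 1) (Pi.single c 1)

theorem act_invCoeff (M : Matrix (Fin (6 + 1)) (Fin (6 + 1)) ℝ) (a b c : Fin (6 + 1)) :
    act M invCoeff a b c =
      trilinear invariantForm (M.transpose.mulVec (Pi.single a 1)) (Pi.single b 1) (Pi.single c 1)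
      + trilinear invariantForm (Pi.single a 1) (M.transpose.mulVec (Pi.single b 1))
        (Pi.single c 1)
      + trilinear invariantForm (Pi.single a 1) (Pi.single b 1)
        (M.transpose.mulVec (Pi.single c 1)) := by
  have h : ∀ a, M.transpose.mulVec (Pi.single a 1) =
      ∑ m, M a m • (Pi.single m 1 : Fin (6 + 1) → ℝ) := by
    intro a
    ext i
    simp [Pi.single_apply]
  simp only [h, map_sum, map_smul, LinearMap.sum_apply, LinearMap.smul_apply, smul_eq_mul]
  rfl

/-- H multiplies the component (a, b, c) by 18 − 2(a + b + c), and the form is H-invariant. -/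
theorem invCoeff_eq_zero {a b c : Fin (6 + 1)} (h : (a : ℕ) + b + c ≠ 9) : invCoeff a b c = 0 := by
  have h1 := trilinear_invariantForm_slH (Pi.single a 1) (Pi.single b 1) (Pi.single c 1)
  have h2 : ∀ a : Fin (6 + 1), (slH 6).transpose.mulVec (Pi.single a 1) =
      ((6 : ℝ) - 2 * (a : ℕ)) • (Pi.single a 1 : Fin (6 + 1) → ℝ) := by
    intro a
    rw [slH, Matrix.diagonal_transpose, Matrix.mulVec_single_one]
    ext i
    by_cases hi : i = a
    · subst hi; simp
    · simp [hi]
  rw [h2, h2, h2] at h1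
  simp only [map_smul, LinearMap.smul_apply, smul_eq_mul] at h1
  change _ * invCoeff a b c + _ * invCoeff a b c + _ * invCoeff a b c = 0 at h1
  have h3 : ((a : ℕ) : ℝ) + (b : ℕ) + (c : ℕ) - 9 ≠ 0 := by
    intro h4
    apply h
    have : ((a : ℕ) : ℝ) + (b : ℕ) + (c : ℕ) = 9 := by linarith
    exact_mod_cast this
  have h5 : (((a : ℕ) : ℝ) + (b : ℕ) + (c : ℕ) - 9) * invCoeff a b c = 0 := by linarith
  exact (mul_eq_zero.1 h5).resolve_left h3

theorem act_slY_pow_invCoeff_eq_zero {i : ℕ} {a b c : Fin (6 + 1)} (h : (a : ℕ) + b + c + i ≠ 9) :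
    act (slY 6 ^ i) invCoeff a b c = 0 := by
  have aux : ∀ (g : Fin (6 + 1) → ℝ) (x : Fin (6 + 1)),
      (∀ m : Fin (6 + 1), (m : ℕ) = x + i → g m = 0) → ∑ m, (slY 6 ^ i) x m * g m = 0 := by
    intro g x hg
    refine Finset.sum_eq_zero fun m _ => ?_
    by_cases hm : (m : ℕ) = x + i
    · rw [hg m hm, mul_zero]
    · rw [(slY_pow_apply i x m).1 hm, zero_mul]
  rw [act, aux _ a fun m hm => invCoeff_eq_zero (by omega),
    aux _ b fun m hm => invCoeff_eq_zero (by omega),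
    aux _ c fun m hm => invCoeff_eq_zero (by omega)]
  norm_num

theorem act_slX_apply (η : Fin (6 + 1) → Fin (6 + 1) → Fin (6 + 1) → ℝ) (a b c : Fin (6 + 1)) :
    act (slX 6) η a b c = (if a = 0 then 0 else η (a - 1) b c) +
      (if b = 0 then 0 else η a (b - 1) c) + (if c = 0 then 0 else η a b (c - 1)) := by
  have aux : ∀ (g : Fin (6 + 1) → ℝ) (x : Fin (6 + 1)),
      ∑ m, slX 6 x m * g m = if x = 0 then 0 else g (x - 1) := by
    intro g x
    fin_cases x <;> simp [Fin.sum_univ_succ, slX]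
  rw [act, aux (fun m => η m b c), aux (fun m => η a m c), aux (fun m => η a b m)]

theorem act_slY_pow_apply (η : Fin (6 + 1) → Fin (6 + 1) → Fin (6 + 1) → ℝ) (i : ℕ)
    (a b c : Fin (6 + 1)) :
    act (slY 6 ^ i) η a b c =
      (∏ l ∈ Finset.range i, (((a : ℕ) : ℝ) + l + 1) * (6 - (a : ℕ) - l)) *
        (if h : (a : ℕ) + i < 7 then η ⟨a + i, h⟩ b c else 0) +
      (∏ l ∈ Finset.range i, (((b : ℕ) : ℝ) + l + 1) * (6 - (b : ℕ) - l)) *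
        (if h : (b : ℕ) + i < 7 then η a ⟨b + i, h⟩ c else 0) +
      (∏ l ∈ Finset.range i, (((c : ℕ) : ℝ) + l + 1) * (6 - (c : ℕ) - l)) *
        (if h : (c : ℕ) + i < 7 then η a b ⟨c + i, h⟩ else 0) := by
  have aux : ∀ (g : Fin (6 + 1) → ℝ) (x : Fin (6 + 1)), ∑ m, (slY 6 ^ i) x m * g m =
      (∏ l ∈ Finset.range i, (((x : ℕ) : ℝ) + l + 1) * (6 - (x : ℕ) - l)) *
        (if h : (x : ℕ) + i < 7 then g ⟨x + i, h⟩ else 0) := by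
    intro g x
    split_ifs with h
    · rw [Finset.sum_eq_single (⟨x + i, h⟩ : Fin (6 + 1)), slY_pow_eq, if_pos rfl]
      · norm_num
      · intro m _ hm
        rw [slY_pow_eq, if_neg fun h => hm (Fin.ext h), zero_mul]
      · simp
    · rw [mul_zero]
      refine Finset.sum_eq_zero fun m _ => ?_
      rw [slY_pow_eq, if_neg (by have := m.2; omega), zero_mul]
  rw [act, aux (fun m => η m b c), aux (fun m => η a m c), aux (fun m => η a b m)]

/-- These values, and those for the exponents 3, 4 and 6, are the inhomogeneous terms of the linear
systems in the descent. They are incompatible with a non-zero coefficient μ, which is how the four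
obstructions arise. -/
theorem act_slY_pow_two : act (slY 6 ^ 2) invCoeff 0 1 6 = 240 ∧
    act (slY 6 ^ 2) invCoeff 0 2 5 = -144 ∧ act (slY 6 ^ 2) invCoeff 0 3 4 = 120 ∧
    act (slY 6 ^ 2) invCoeff 1 2 4 = 0 := by
  simp only [act_slY_pow_apply, Finset.prod_range_succ, Finset.prod_range_zero]
  simp [invCoeff, trilinear_apply, invariantForm_apply, minorForm_apply]
  norm_num

theorem act_slY_pow_three : act (slY 6 ^ 3) invCoeff 0 1 5 = -2160 ∧
    act (slY 6 ^ 3) invCoeff 0 2 4 = 2160 ∧ act (slY 6 ^ 3) invCoeff 1 2 3 = -4320 := by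
  simp only [act_slY_pow_apply, Finset.prod_range_succ, Finset.prod_range_zero]
  simp [invCoeff, trilinear_apply, invariantForm_apply, minorForm_apply]
  norm_num

theorem act_slY_pow_four : act (slY 6 ^ 4) invCoeff 0 1 4 = 14400 ∧
    act (slY 6 ^ 4) invCoeff 0 2 3 = -17280 := by
  simp only [act_slY_pow_apply, Finset.prod_range_succ, Finset.prod_range_zero]
  simp [invCoeff, trilinear_apply, invariantForm_apply, minorForm_apply]
  norm_num

theorem act_slY_pow_six : act (slY 6 ^ 6) invCoeff 0 1 2 = -1036800 := by
  simp only [act_slY_pow_apply, Finset.prod_range_succ, Finset.prod_range_zero]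
  simp [invCoeff, trilinear_apply, invariantForm_apply, minorForm_apply]
  norm_num

theorem invCoeff_values : invCoeff 0 3 6 = 1 ∧ invCoeff 0 4 5 = -1 ∧ invCoeff 1 2 6 = -2 ∧
    invCoeff 1 3 5 = 1 ∧ invCoeff 2 3 4 = -1 := by
  simp [invCoeff, trilinear_apply, invariantForm_apply, minorForm_apply]

theorem invCoeff_swap_left (a b c : Fin (6 + 1)) : invCoeff a b c = -invCoeff b a c :=
  trilinear_swap_left _ _ _ _

theorem invCoeff_swap_right (a b c : Fin (6 + 1)) : invCoeff a b c = -invCoeff a c b :=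
  trilinear_swap_right _ _ _ _

end InvariantComponents

/-! ### Structure equations in a fixed weight -/

section Rigidity

variable {I : Set ℝ} {η : ℝ → Fin (6 + 1) → Fin (6 + 1) → Fin (6 + 1) → ℝ} {α : ℝ → ℝ}
  {κ : ℕ → ℝ → ℝ}

/-- If the components of weight at least `s` are those of a multiple of the invariant form, then
the structure equations of weight `s` only involve the components of weight `s - 1` and one
invariant. -/
theorem weight_equation (hI : IsOpen I) (hw : ∀ t ∈ I, ∀ a b c, HasDerivAt (fun s => η s a b c)
      (-act (canonicalMatrix 6 (α t) fun i => κ i t) (η t) a b c) t) {s : ℕ} (hs3 : 3 ≤ s)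
    (hs : ∀ t ∈ I, ∀ a b c : Fin (6 + 1), s ≤ (a : ℕ) + b + c →
      η t a b c = η t 0 3 6 * invCoeff a b c) {t : ℝ} (ht : t ∈ I) :
    ∃ μ : ℝ, (∀ i, 1 ≤ i → s + i = 9 → μ = η t 0 3 6 * κ i t) ∧
      ∀ a b c : Fin (6 + 1), (a : ℕ) + b + c = s →
        act (slX 6) (η t) a b c + μ * act (slY 6 ^ (9 - s)) invCoeff a b c = 0 := by
  set r := η t 0 3 6 with hr
  set r' := -act (canonicalMatrix 6 (α t) fun i => κ i t) (η t) 0 3 6 with hr'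
  -- Y^i lowers the weight at which the invariant form is seen by i, so in weight s only i = 9 − s
  -- contributes. In weight 9 the derivative r' of the factor also enters; it is absorbed as r'/3
  -- because the identity Y^0 acts on 3-forms as 3.
  refine ⟨r * κ (9 - s) t + if s = 9 then r' / 3 else 0, fun i hi hsi => ?_, fun a b c habc => ?_⟩
  · have : 9 - s = i := by omega
    rw [this, if_neg (by omega), add_zero]
  have h1 : -act (canonicalMatrix 6 (α t) fun i => κ i t) (η t) a b c = r' * invCoeff a b c := by
    refine (hw t ht a b c).unique ?_
    refine ((hw t ht 0 3 6).mul_const (invCoeff a b c)).congr_of_eventuallyEq ?_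
    exact (hI.eventually_mem ht).mono fun x hx => hs x hx a b c habc.ge
  have hH : act (slH 6) (η t) a b c = 0 := by
    rw [act_congr UpperDeg.of_slH (hs t ht) habc.ge, act_const_mul, act_invCoeff,
      trilinear_invariantForm_slH, mul_zero]
  have hY : ∀ i, act (slY 6 ^ i) (η t) a b c = r * act (slY 6 ^ i) invCoeff a b c := by
    intro i
    rw [act_congr ((UpperDeg.slY_pow i).mono (by omega)) (hs t ht) habc.ge, act_const_mul]
  have hsum : ∑ i ∈ Finset.range (6 + 1), κ i t * (r * act (slY 6 ^ i) invCoeff a b c) =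
      r * κ (9 - s) t * act (slY 6 ^ (9 - s)) invCoeff a b c := by
    by_cases h9 : s ≤ 9
    · rw [Finset.sum_eq_single (9 - s)]
      · ring
      · intro i _ hi
        rw [act_slY_pow_invCoeff_eq_zero (by omega), mul_zero, mul_zero]
      · intro h; simp at h; omega
    · rw [Finset.sum_eq_zero fun i _ => by
        rw [act_slY_pow_invCoeff_eq_zero (by omega), mul_zero, mul_zero],
        act_slY_pow_invCoeff_eq_zero (by omega), mul_zero]
  have hone : (if s = 9 then r' / 3 else 0) * act (slY 6 ^ (9 - s)) invCoeff a b c =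
      r' * invCoeff a b c := by
    split_ifs with h9
    · subst h9
      rw [Nat.sub_self, pow_zero, act_one]
      ring
    · rw [zero_mul, invCoeff_eq_zero (by omega), mul_zero]
  rw [canonicalMatrix, act_add, act_add, act_smul, hH, act_sum] at h1
  simp only [act_smul, hY] at h1
  rw [hsum] at h1
  rw [add_mul, hone]
  linarith

/-- In these weights the term with Y^{9−s} drops out. Above 9 the truncated exponent is 0 and the
invariant form has no component there; for s = 8 and s = 4 the powers Y and Y^5 annihilate the form.
-/
theorem act_slX_eq_zero (hI : IsOpen I) (hw : ∀ t ∈ I, ∀ a b c, HasDerivAt (fun s => η s a b c)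
      (-act (canonicalMatrix 6 (α t) fun i => κ i t) (η t) a b c) t) {s : ℕ} (hs3 : 3 ≤ s)
    (hs : ∀ t ∈ I, ∀ a b c : Fin (6 + 1), s ≤ (a : ℕ) + b + c →
      η t a b c = η t 0 3 6 * invCoeff a b c) (hs9 : 9 < s ∨ s = 8 ∨ s = 4) {t : ℝ} (ht : t ∈ I)
    (a b c : Fin (6 + 1)) (habc : (a : ℕ) + b + c = s) : act (slX 6) (η t) a b c = 0 := by
  obtain ⟨μ, -, h⟩ := weight_equation hI hw hs3 hs ht
  have h1 := h a b c habc
  have h2 : act (slY 6 ^ (9 - s)) invCoeff a b c = 0 := by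
    rcases hs9 with hs9 | rfl | rfl
    · exact act_slY_pow_invCoeff_eq_zero (by omega)
    · rw [show 9 - 8 = 1 from rfl, pow_one, act_invCoeff, trilinear_invariantForm_slY]
    · rw [act_invCoeff, trilinear_invariantForm_slY_pow_five]
  rwa [h2, mul_zero, add_zero] at h1

end Rigidity

/-! ### Descending induction on the weight -/

section Descent

variable {I : Set ℝ} {η : ℝ → Fin (6 + 1) → Fin (6 + 1) → Fin (6 + 1) → ℝ} {α : ℝ → ℝ}
  {κ : ℕ → ℝ → ℝ}

theorem sorted_of_thirteen_le : ∀ a b c : Fin (6 + 1), a < b → b < c → 13 ≤ (a : ℕ) + b + c →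
    (b = 4 ∨ b = 5) ∧ c = 6 := by decide

theorem sorted_of_weight_12 : ∀ a b c : Fin (6 + 1), a < b → b < c → (a : ℕ) + b + c = 12 →
    a = 1 ∧ b = 5 ∧ c = 6 ∨
    a = 2 ∧ b = 4 ∧ c = 6 ∨
    a = 3 ∧ b = 4 ∧ c = 5 := by decide

theorem sorted_of_weight_11 : ∀ a b c : Fin (6 + 1), a < b → b < c → (a : ℕ) + b + c = 11 →
    a = 0 ∧ b = 5 ∧ c = 6 ∨
    a = 1 ∧ b = 4 ∧ c = 6 ∨
    a = 2 ∧ b = 3 ∧ c = 6 ∨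
    a = 2 ∧ b = 4 ∧ c = 5 := by decide

theorem sorted_of_weight_10 : ∀ a b c : Fin (6 + 1), a < b → b < c → (a : ℕ) + b + c = 10 →
    a = 0 ∧ b = 4 ∧ c = 6 ∨
    a = 1 ∧ b = 3 ∧ c = 6 ∨
    a = 1 ∧ b = 4 ∧ c = 5 ∨
    a = 2 ∧ b = 3 ∧ c = 5 := by decide

theorem sorted_of_weight_9 : ∀ a b c : Fin (6 + 1), a < b → b < c → (a : ℕ) + b + c = 9 →
    a = 0 ∧ b = 3 ∧ c = 6 ∨
    a = 0 ∧ b = 4 ∧ c = 5 ∨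
    a = 1 ∧ b = 2 ∧ c = 6 ∨
    a = 1 ∧ b = 3 ∧ c = 5 ∨
    a = 2 ∧ b = 3 ∧ c = 4 := by decide

theorem sorted_of_weight_8 : ∀ a b c : Fin (6 + 1), a < b → b < c → (a : ℕ) + b + c = 8 →
    a = 0 ∧ b = 2 ∧ c = 6 ∨
    a = 0 ∧ b = 3 ∧ c = 5 ∨
    a = 1 ∧ b = 2 ∧ c = 5 ∨
    a = 1 ∧ b = 3 ∧ c = 4 := by decide

theorem sorted_of_weight_7 : ∀ a b c : Fin (6 + 1), a < b → b < c → (a : ℕ) + b + c = 7 →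
    a = 0 ∧ b = 1 ∧ c = 6 ∨
    a = 0 ∧ b = 2 ∧ c = 5 ∨
    a = 0 ∧ b = 3 ∧ c = 4 ∨
    a = 1 ∧ b = 2 ∧ c = 4 := by decide

theorem sorted_of_weight_6 : ∀ a b c : Fin (6 + 1), a < b → b < c → (a : ℕ) + b + c = 6 →
    a = 0 ∧ b = 1 ∧ c = 5 ∨
    a = 0 ∧ b = 2 ∧ c = 4 ∨
    a = 1 ∧ b = 2 ∧ c = 3 := by decide

theorem sorted_of_weight_5 : ∀ a b c : Fin (6 + 1), a < b → b < c → (a : ℕ) + b + c = 5 →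
    a = 0 ∧ b = 1 ∧ c = 4 ∨
    a = 0 ∧ b = 2 ∧ c = 3 := by decide

theorem sorted_of_weight_4 : ∀ a b c : Fin (6 + 1), a < b → b < c → (a : ℕ) + b + c = 4 →
    a = 0 ∧ b = 1 ∧ c = 3 := by decide

theorem sorted_of_weight_3 : ∀ a b c : Fin (6 + 1), a < b → b < c → (a : ℕ) + b + c = 3 →
    a = 0 ∧ b = 1 ∧ c = 2 := by decide

/-- The components of a compatible `3`-form in a canonical frame are those of a multiple of the
invariant form, and four invariants vanish if it is non-zero. -/
theorem eq_mul_invCoeff (hI : IsOpen I) (hw : ∀ t ∈ I, ∀ a b c, HasDerivAt (fun s => η s a b c)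
      (-act (canonicalMatrix 6 (α t) fun i => κ i t) (η t) a b c) t)
    (hl : ∀ t a b c, η t a b c = -η t b a c) (hr : ∀ t a b c, η t a b c = -η t a c b)
    (h5 : ∀ t ∈ I, ∀ a, η t a 5 6 = 0) (h4 : ∀ t ∈ I, ∀ a, η t a 4 6 = 0) :
    ∀ t ∈ I, (∀ a b c, η t a b c = η t 0 3 6 * invCoeff a b c) ∧
      η t 0 3 6 * κ 2 t = 0 ∧ η t 0 3 6 * κ 3 t = 0 ∧ η t 0 3 6 * κ 4 t = 0 ∧
      η t 0 3 6 * κ 6 t = 0 := by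
  have z1 : ∀ t a b, η t a a b = 0 := fun t a b => by have := hl t a a b; linarith
  have z2 : ∀ t a b, η t a b b = 0 := fun t a b => by have := hr t a b b; linarith
  have step : ∀ s t, (∀ a b c : Fin (6 + 1), a < b → b < c → (a : ℕ) + b + c = s →
      η t a b c = η t 0 3 6 * invCoeff a b c) → ∀ a b c : Fin (6 + 1), (a : ℕ) + b + c = s →
      η t a b c = η t 0 3 6 * invCoeff a b c := by
    intro s t h a b c
    refine eq_of_sorted (g := fun a b c => η t 0 3 6 * invCoeff a b c) (hl t) (hr t)
      (fun a b c => ?_) (fun a b c => ?_) h a b c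
    · rw [invCoeff_swap_left, mul_neg]
    · rw [invCoeff_swap_right, mul_neg]
  have down : ∀ s, (∀ t ∈ I, ∀ a b c : Fin (6 + 1), s + 1 ≤ (a : ℕ) + b + c →
      η t a b c = η t 0 3 6 * invCoeff a b c) → (∀ t ∈ I, ∀ a b c : Fin (6 + 1), a < b → b < c →
      (a : ℕ) + b + c = s → η t a b c = η t 0 3 6 * invCoeff a b c) →
      ∀ t ∈ I, ∀ a b c : Fin (6 + 1), s ≤ (a : ℕ) + b + c →
      η t a b c = η t 0 3 6 * invCoeff a b c := by
    intro s h h' t ht a b c habc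
    rcases habc.eq_or_lt with h1 | h1
    · exact step s t (h' t ht) a b c h1.symm
    · exact h t ht a b c h1
  have zero : ∀ s, s ≠ 9 → (∀ t ∈ I, ∀ a b c : Fin (6 + 1), s + 1 ≤ (a : ℕ) + b + c →
      η t a b c = η t 0 3 6 * invCoeff a b c) → (∀ t ∈ I, ∀ a b c : Fin (6 + 1), a < b → b < c →
      (a : ℕ) + b + c = s → η t a b c = 0) →
      ∀ t ∈ I, ∀ a b c : Fin (6 + 1), s ≤ (a : ℕ) + b + c →
      η t a b c = η t 0 3 6 * invCoeff a b c := by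
    intro s hs h h'
    refine down s h fun t ht a b c h1 h2 h3 => ?_
    rw [h' t ht a b c h1 h2 h3, invCoeff_eq_zero (by omega), mul_zero]
  -- A sorted triple of weight at least 13 ends in (4, 6) or (5, 6), so compatibility kills it.
  have w13 : ∀ t ∈ I, ∀ a b c : Fin (6 + 1), 13 ≤ (a : ℕ) + b + c →
      η t a b c = η t 0 3 6 * invCoeff a b c := by
    intro t ht a b c habc
    refine step _ t (fun a' b' c' h1 h2 h3 => ?_) a b c rfl
    rw [invCoeff_eq_zero (by omega), mul_zero]
    obtain ⟨rfl | rfl, rfl⟩ := sorted_of_thirteen_le a' b' c' h1 h2 (h3.symm ▸ habc)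
    · exact h4 t ht a'
    · exact h5 t ht a'
  have w12 := zero 12 (by norm_num) w13 (by
    intro t ht a b c h1 h2 h3
    have he := act_slX_eq_zero hI hw (by norm_num) w13 (by norm_num) ht
    have e1 := he 3 4 6 rfl
    simp [act_slX_apply, z1, h4 t ht] at e1
    obtain ⟨rfl, rfl, rfl⟩ | ⟨rfl, rfl, rfl⟩ | ⟨rfl, rfl, rfl⟩ :=
      sorted_of_weight_12 a b c h1 h2 h3
    · exact h5 t ht _
    · exact h4 t ht _
    · linarith)
  have w11 := zero 11 (by norm_num) w12 (by
    intro t ht a b c h1 h2 h3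
    have he := act_slX_eq_zero hI hw (by norm_num) w12 (by norm_num) ht
    have e1 := he 3 4 5 rfl
    have e2 := he 2 4 6 rfl
    simp [act_slX_apply, z1, z2, h4 t ht] at e1 e2
    obtain ⟨rfl, rfl, rfl⟩ | ⟨rfl, rfl, rfl⟩ | ⟨rfl, rfl, rfl⟩ | ⟨rfl, rfl, rfl⟩ :=
      sorted_of_weight_11 a b c h1 h2 h3
    · exact h5 t ht _
    · exact h4 t ht _
    · linarith
    · linarith)
  have w10 := zero 10 (by norm_num) w11 (by
    intro t ht a b c h1 h2 h3
    have he := act_slX_eq_zero hI hw (by norm_num) w11 (by norm_num) ht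
    have e1 := he 1 4 6 rfl
    have e2 := he 2 3 6 rfl
    have e3 := he 2 4 5 rfl
    simp [act_slX_apply, z1, z2, h4 t ht] at e1 e2 e3
    obtain ⟨rfl, rfl, rfl⟩ | ⟨rfl, rfl, rfl⟩ | ⟨rfl, rfl, rfl⟩ | ⟨rfl, rfl, rfl⟩ :=
      sorted_of_weight_10 a b c h1 h2 h3
    · exact h4 t ht _
    · linarith
    · linarith
    · linarith)
  -- Four equations of weight 10 for five components of weight 9: the solutions form a line, spanned
  -- by the invariant form and parametrized by η_{036}.
  have w9 := down 9 w10 (by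
    intro t ht a b c h1 h2 h3
    have he := act_slX_eq_zero hI hw (by norm_num) w10 (by norm_num) ht
    have e1 := he 0 4 6 rfl
    have e2 := he 1 3 6 rfl
    have e3 := he 1 4 5 rfl
    have e4 := he 2 3 5 rfl
    obtain ⟨v1, v2, v3, v4, v5⟩ := invCoeff_values
    simp [act_slX_apply, z1, z2] at e1 e2 e3 e4
    obtain ⟨rfl, rfl, rfl⟩ | ⟨rfl, rfl, rfl⟩ | ⟨rfl, rfl, rfl⟩ |
        ⟨rfl, rfl, rfl⟩ | ⟨rfl, rfl, rfl⟩ :=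
      sorted_of_weight_9 a b c h1 h2 h3
    · rw [v1]; linarith
    · rw [v2]; linarith
    · rw [v3]; linarith
    · rw [v4]; linarith
    · rw [v5]; linarith)
  -- From here on the equations of weight s have as unknowns the components of weight s − 1 and,
  -- unless Y^{9−s} annihilates the form, the coefficient μ. In each weight from 9 down to 4 there
  -- are as many equations as unknowns, and the system has only the zero solution.
  have w8 := zero 8 (by norm_num) w9 (by
    intro t ht a b c h1 h2 h3
    obtain ⟨μ, -, he⟩ := weight_equation hI hw (by norm_num) w9 ht
    have e1 := he 0 3 6 rfl
    have e2 := he 0 4 5 rfl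
    have e3 := he 1 2 6 rfl
    have e4 := he 1 3 5 rfl
    have e5 := he 2 3 4 rfl
    obtain ⟨v1, v2, v3, v4, v5⟩ := invCoeff_values
    simp [act_slX_apply, act_one, v1, v2, v3, v4, v5, z1, z2] at e1 e2 e3 e4 e5
    obtain ⟨rfl, rfl, rfl⟩ | ⟨rfl, rfl, rfl⟩ | ⟨rfl, rfl, rfl⟩ | ⟨rfl, rfl, rfl⟩ :=
      sorted_of_weight_8 a b c h1 h2 h3
    · linarith
    · linarith
    · linarith
    · linarith)
  have w7 := zero 7 (by norm_num) w8 (by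
    intro t ht a b c h1 h2 h3
    have he := act_slX_eq_zero hI hw (by norm_num) w8 (by norm_num) ht
    have e1 := he 0 2 6 rfl
    have e2 := he 0 3 5 rfl
    have e3 := he 1 2 5 rfl
    have e4 := he 1 3 4 rfl
    simp [act_slX_apply, z1, z2] at e1 e2 e3 e4
    obtain ⟨rfl, rfl, rfl⟩ | ⟨rfl, rfl, rfl⟩ | ⟨rfl, rfl, rfl⟩ | ⟨rfl, rfl, rfl⟩ :=
      sorted_of_weight_7 a b c h1 h2 h3
    · linarith
    · linarith
    · linarith
    · linarith)
  have w6 := zero 6 (by norm_num) w7 (by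
    intro t ht a b c h1 h2 h3
    obtain ⟨μ, -, he⟩ := weight_equation hI hw (by norm_num) w7 ht
    have e1 := he 0 1 6 rfl
    have e2 := he 0 2 5 rfl
    have e3 := he 0 3 4 rfl
    have e4 := he 1 2 4 rfl
    obtain ⟨v1, v2, v3, v4⟩ := act_slY_pow_two
    simp [act_slX_apply, v1, v2, v3, v4, z1, z2] at e1 e2 e3 e4
    obtain ⟨rfl, rfl, rfl⟩ | ⟨rfl, rfl, rfl⟩ | ⟨rfl, rfl, rfl⟩ := sorted_of_weight_6 a b c h1 h2 h3
    · linarith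
    · linarith
    · linarith)
  have w5 := zero 5 (by norm_num) w6 (by
    intro t ht a b c h1 h2 h3
    obtain ⟨μ, -, he⟩ := weight_equation hI hw (by norm_num) w6 ht
    have e1 := he 0 1 5 rfl
    have e2 := he 0 2 4 rfl
    have e3 := he 1 2 3 rfl
    obtain ⟨v1, v2, v3⟩ := act_slY_pow_three
    simp [act_slX_apply, v1, v2, v3, z1, z2] at e1 e2 e3
    obtain ⟨rfl, rfl, rfl⟩ | ⟨rfl, rfl, rfl⟩ := sorted_of_weight_5 a b c h1 h2 h3
    · linarith
    · linarith)
  have w4 := zero 4 (by norm_num) w5 (by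
    intro t ht a b c h1 h2 h3
    obtain ⟨μ, -, he⟩ := weight_equation hI hw (by norm_num) w5 ht
    have e1 := he 0 1 4 rfl
    have e2 := he 0 2 3 rfl
    obtain ⟨v1, v2⟩ := act_slY_pow_four
    simp [act_slX_apply, v1, v2, z1, z2] at e1 e2
    obtain ⟨rfl, rfl, rfl⟩ := sorted_of_weight_4 a b c h1 h2 h3
    · linarith)
  have w3 := zero 3 (by norm_num) w4 (by
    intro t ht a b c h1 h2 h3
    have he := act_slX_eq_zero hI hw (by norm_num) w4 (by norm_num) ht
    have e1 := he 0 1 3 rfl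
    simp [act_slX_apply, z1] at e1
    obtain ⟨rfl, rfl, rfl⟩ := sorted_of_weight_3 a b c h1 h2 h3
    · linarith)
  intro t ht
  refine ⟨fun a b c => ?_, ?_, ?_, ?_, ?_⟩
  · by_cases h : 3 ≤ (a : ℕ) + b + c
    · exact w3 t ht a b c h
    · exact step _ t (fun a' b' c' h1 h2 h3 => absurd h3 (by omega)) a b c rfl
  -- The systems of weights 7, 6, 5 and 3 are now solved for μ, which is the multiple η_{036} of
  -- κ_2, κ_3, κ_4 and κ_6 respectively.
  · obtain ⟨μ, hμ, he⟩ := weight_equation hI hw (by norm_num) w7 ht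
    have e1 := he 0 1 6 rfl
    have e2 := he 0 2 5 rfl
    have e3 := he 0 3 4 rfl
    have e4 := he 1 2 4 rfl
    obtain ⟨v1, v2, v3, v4⟩ := act_slY_pow_two
    simp [act_slX_apply, v1, v2, v3, v4, z1, z2] at e1 e2 e3 e4
    rw [← hμ 2 (by norm_num) rfl]
    linarith
  · obtain ⟨μ, hμ, he⟩ := weight_equation hI hw (by norm_num) w6 ht
    have e1 := he 0 1 5 rfl
    have e2 := he 0 2 4 rfl
    have e3 := he 1 2 3 rfl
    obtain ⟨v1, v2, v3⟩ := act_slY_pow_three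
    simp [act_slX_apply, v1, v2, v3, z1, z2] at e1 e2 e3
    rw [← hμ 3 (by norm_num) rfl]
    linarith
  · obtain ⟨μ, hμ, he⟩ := weight_equation hI hw (by norm_num) w5 ht
    have e1 := he 0 1 4 rfl
    have e2 := he 0 2 3 rfl
    obtain ⟨v1, v2⟩ := act_slY_pow_four
    simp [act_slX_apply, v1, v2, z1, z2] at e1 e2
    rw [← hμ 4 (by norm_num) rfl]
    linarith
  · obtain ⟨μ, hμ, he⟩ := weight_equation hI hw (by norm_num) w3 ht
    have e1 := he 0 1 2 rfl
    have v1 := act_slY_pow_six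
    simp [act_slX_apply, v1, z1, z2] at e1
    rw [← hμ 6 (by norm_num) rfl]
    linarith

end Descent

/-! ### Rigidity and constancy of the invariant 3-form in canonical frames -/

section MovingFrames

variable {V : Type*} [AddCommGroup V] [Module ℝ V] {I : Set ℝ} {α : ℝ → ℝ} {κ : ℕ → ℝ → ℝ}
  {e : ℝ → V →ₗ[ℝ] (Fin (6 + 1) → ℝ)}

/-- A `3`-form that is compatible in a canonical frame is proportional to the invariant form. -/
theorem IsMovingFrame.trilin_rigidity (hI : IsOpen I)
    (h : IsMovingFrame I (fun t => canonicalMatrix 6 (α t) fun i => κ i t) e)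
    {Ω : V [⋀^Fin 3]→ₗ[ℝ] ℝ}
    (h5 : ∀ t ∈ I, ∀ z, Ω ![dualFrame e t 6, dualFrame e t 5, z] = 0)
    (h4 : ∀ t ∈ I, ∀ z, Ω ![dualFrame e t 6, dualFrame e t 4, z] = 0) {t : ℝ} (ht : t ∈ I) :
    ∃ c : ℝ, Ω = c • invariantForm.compLinearMap (e t) ∧
      c * κ 2 t = 0 ∧ c * κ 3 t = 0 ∧ c * κ 4 t = 0 ∧ c * κ 6 t = 0 := by
  let η : ℝ → Fin (6 + 1) → Fin (6 + 1) → Fin (6 + 1) → ℝ := fun t a b c =>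
    trilinear Ω (dualFrame e t a) (dualFrame e t b) (dualFrame e t c)
  have hl : ∀ t a b c, η t a b c = -η t b a c := fun t a b c => trilinear_swap_left _ _ _ _
  have hr : ∀ t a b c, η t a b c = -η t a c b := fun t a b c => trilinear_swap_right _ _ _ _
  have hw : ∀ t ∈ I, ∀ a b c, HasDerivAt (fun s => η s a b c)
      (-act (canonicalMatrix 6 (α t) fun i => κ i t) (η t) a b c) t := by
    intro t ht a b c
    refine (HasCoordDerivAt.trilin h ht (h.hasDerivAt_dualFrame hI ht a)
      (h.hasDerivAt_dualFrame hI ht b) (h.hasDerivAt_dualFrame hI ht c)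
      (trilinear Ω)).congr_deriv ?_
    simp only [map_neg, map_sum, map_smul, LinearMap.neg_apply, LinearMap.sum_apply,
      LinearMap.smul_apply, smul_eq_mul, act, neg_add]
    rfl
  have hrot : ∀ t a b c, η t a b c = -η t c b a := fun t a b c => by
    rw [hl, hr, hl t b c a, neg_neg]
  obtain ⟨h1, h2⟩ := eq_mul_invCoeff hI hw hl hr
    (fun t ht a => by rw [hrot]; exact neg_eq_zero.2 (h5 t ht _))
    (fun t ht a => by rw [hrot]; exact neg_eq_zero.2 (h4 t ht _)) t ht
  refine ⟨η t 0 3 6, ?_, h2⟩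
  ext v
  have hv : v = ![v 0, v 1, v 2] := by ext i; fin_cases i <;> rfl
  have h3 : trilinear Ω (v 0) (v 1) (v 2) =
      η t 0 3 6 * trilinear invariantForm (e t (v 0)) (e t (v 1)) (e t (v 2)) := by
    have hs : ∀ u : Fin (6 + 1) → ℝ, u = ∑ a, u a • (Pi.single a 1 : Fin (6 + 1) → ℝ) := by
      intro u
      ext i
      simp [Finset.sum_apply, Pi.single_apply]
    conv_lhs => rw [← h.sum_dualFrame ht (v 0), ← h.sum_dualFrame ht (v 1),
      ← h.sum_dualFrame ht (v 2)]
    conv_rhs => rw [hs (e t (v 0)), hs (e t (v 1)), hs (e t (v 2))]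
    simp only [map_sum, map_smul, LinearMap.sum_apply, LinearMap.smul_apply, smul_eq_mul,
      Finset.mul_sum]
    refine Finset.sum_congr rfl fun a _ => Finset.sum_congr rfl fun b _ =>
      Finset.sum_congr rfl fun c _ => ?_
    have h4 : trilinear Ω (dualFrame e t c) (dualFrame e t b) (dualFrame e t a) =
        η t 0 3 6 * trilinear invariantForm (Pi.single c 1) (Pi.single b 1) (Pi.single a 1) :=
      h1 c b a
    rw [h4]
    ring
  rw [hv]
  exact h3

/-- If four invariants vanish, the invariant form in a canonical frame is constant. -/
theorem IsMovingFrame.invariantForm_const (hI : IsOpen I) (hc : I.OrdConnected)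
    (h : IsMovingFrame I (fun t => canonicalMatrix 6 (α t) fun i => κ i t) e)
    (hκ : ∀ t ∈ I, κ 0 t = 0 ∧ κ 2 t = 0 ∧ κ 3 t = 0 ∧ κ 4 t = 0 ∧ κ 6 t = 0) {s t : ℝ}
    (hs : s ∈ I) (ht : t ∈ I) (u v w : V) :
    invariantForm ![e s u, e s v, e s w] = invariantForm ![e t u, e t v, e t w] := by
  have hder : ∀ t ∈ I, HasDerivAt
      (fun s => trilinear invariantForm (e s u) (e s v) (e s w)) 0 t := by
    intro t ht
    obtain ⟨h0, h2, h3, h4, h6⟩ := hκ t ht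
    -- The curves e(u), e(v), e(w) run in ℝ^7 itself, so the product rule is applied with the
    -- constant frame there.
    have hid : IsMovingFrame I (fun _ => (0 : Matrix (Fin (6 + 1)) (Fin (6 + 1)) ℝ))
        fun _ => (LinearMap.id : (Fin (6 + 1) → ℝ) →ₗ[ℝ] _) :=
      ⟨fun _ _ => Function.bijective_id, fun _ => contDiffOn_const, fun w t _ => by
        simpa using hasDerivAt_const t w⟩
    have he : ∀ w, HasCoordDerivAt (fun s => e s w)
        ((canonicalMatrix 6 (α t) fun i => κ i t).transpose.mulVec (e t w)) t := fun w φ =>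
      φ.toContinuousLinearMap.hasFDerivAt.comp_hasDerivAt t (h.hasDerivAt w t ht)
    refine (HasCoordDerivAt.trilin hid ht (he u) (he v) (he w)
      (trilinear invariantForm)).congr_deriv ?_
    -- Only elements annihilating the invariant form remain. The condition κ_0 = 0 matters, since
    -- the identity would scale the form.
    have hN : (canonicalMatrix 6 (α t) fun i => κ i t) =
        slX 6 + α t • slH 6 + (κ 1 t • slY 6 + κ 5 t • slY 6 ^ 5) := by
      simp [canonicalMatrix, Finset.sum_range_succ, h0, h2, h3, h4, h6]
    simp only [hN, Matrix.transpose_add, Matrix.transpose_smul, Matrix.add_mulVec,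
      Matrix.smul_mulVec, map_add, map_smul, LinearMap.add_apply, LinearMap.smul_apply,
      smul_eq_mul]
    linear_combination trilinear_invariantForm_slX (e t u) (e t v) (e t w) +
      α t * trilinear_invariantForm_slH (e t u) (e t v) (e t w) +
      κ 1 t * trilinear_invariantForm_slY (e t u) (e t v) (e t w) +
      κ 5 t * trilinear_invariantForm_slY_pow_five (e t u) (e t v) (e t w)
  exact hI.is_const_of_deriv_eq_zero hc.isPreconnected
    (f := fun s => trilinear invariantForm (e s u) (e s v) (e s w))
    (fun t ht => (hder t ht).differentiableAt.differentiableWithinAt)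
    (fun t ht => (hder t ht).deriv) hs ht

end MovingFrames

/-! ### Compatible 3-forms at a solution -/

section ThreeForms

/-- The invariant `3`-form in the coordinates changed by `A`. -/
def gaugedThreeForm (A : Matrix (Fin (6 + 1)) (Fin (6 + 1)) ℝ) :
    (Fin (6 + 1) → ℝ) [⋀^Fin 3]→ₗ[ℝ] ℝ :=
  invariantForm.compLinearMap A.transpose.mulVecLin

theorem IsG2Form.compLinearEquiv {V W : Type*} [AddCommGroup V] [Module ℝ V] [AddCommGroup W]
    [Module ℝ W] {Ω : W [⋀^Fin 3]→ₗ[ℝ] ℝ} (hΩ : IsG2Form Ω) (e : V ≃ₗ[ℝ] W) :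
    IsG2Form (Ω.compLinearMap e.toLinearMap) := by
  obtain ⟨e', h⟩ := hΩ
  refine ⟨e.trans e', fun u v w => ?_⟩
  refine Eq.trans ?_ (h (e u) (e v) (e w))
  rw [AlternatingMap.compLinearMap_apply]
  congr 1
  ext1 i
  fin_cases i <;> rfl

theorem IsG2Form.ne_zero {V : Type*} [AddCommGroup V] [Module ℝ V] {Ω : V [⋀^Fin 3]→ₗ[ℝ] ℝ}
    (hΩ : IsG2Form Ω) : Ω ≠ 0 := by
  rintro rfl
  obtain ⟨e, h⟩ := hΩ
  have h1 := h (e.symm (1, 0, 0)) (e.symm (0, ![1, 0, 0], 0)) (e.symm (0, 0, ![1, 0, 0]))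
  simp [splitForm, ImOctonion.incl, SplitOctonion.mul, SplitOctonion.scalarPart] at h1
  norm_num at h1

theorem IsG2Form.eq_six {k : ℕ} {Ω : (Fin (k + 1) → ℝ) [⋀^Fin 3]→ₗ[ℝ] ℝ} (hΩ : IsG2Form Ω) :
    k = 6 := by
  obtain ⟨e, -⟩ := hΩ
  have := e.finrank_eq
  simp at this
  omega

theorem isG2Form_gaugedThreeForm {A : Matrix (Fin (6 + 1)) (Fin (6 + 1)) ℝ} (hA : A.det ≠ 0) :
    IsG2Form (gaugedThreeForm A) :=
  isG2Form_invariantForm.compLinearEquiv (LinearEquiv.ofInjectiveEndo A.transpose.mulVecLin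
    (Matrix.mulVec_injective_iff_isUnit.2 ((Matrix.isUnit_iff_isUnit_det _).2
      (by rwa [Matrix.det_transpose, isUnit_iff_ne_zero]))))

theorem contDiffOn_gaugedThreeForm {E : Type*} [NormedAddCommGroup E] [NormedSpace ℝ E] {W : Set E}
    {A : E → Matrix (Fin (6 + 1)) (Fin (6 + 1)) ℝ}
    (hA : ∀ i j, ContDiffOn ℝ ∞ (fun q => A q i j) W) (u : Fin 3 → Fin (6 + 1) → ℝ) :
    ContDiffOn ℝ ∞ (fun q => gaugedThreeForm (A q) u) W := by
  have hu : ∀ i p, ContDiffOn ℝ ∞ (fun q => (A q).transpose.mulVec (u i) p) W := by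
    intro i p
    change ContDiffOn ℝ ∞ (fun q => ∑ j, A q j p * u i j) W
    exact ContDiffOn.sum fun j _ => (hA j p).mul contDiffOn_const
  have hm : ∀ p q r, ContDiffOn ℝ ∞
      (fun x => minorForm p q r fun i => (A x).transpose.mulVec (u i)) W := fun p q r =>
    contDiffOn_det (M := fun x => Matrix.of fun i j => (A x).transpose.mulVec (u i) (![p, q, r] j))
      fun i j => hu i _
  exact ((((hm 0 3 6).sub (hm 0 4 5)).add (hm 1 3 5)).sub (contDiffOn_const.mul (hm 1 2 6))).sub
    (hm 2 3 4)

/-- u is supported on the index 6 and w on 4, 5, 6. By alternation only index triples containing 6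
together with 4 or 5 could contribute, and their weight exceeds 9. -/
theorem invariantForm_eq_zero {u w : Fin (6 + 1) → ℝ}
    (hu : ∀ m : Fin (6 + 1), (m : ℕ) < 6 → u m = 0)
    (hw : ∀ m : Fin (6 + 1), (m : ℕ) < 4 → w m = 0) (z : Fin (6 + 1) → ℝ) :
    invariantForm ![u, w, z] = 0 := by
  have u0 := hu 0 (by decide)
  have u1 := hu 1 (by decide)
  have u2 := hu 2 (by decide)
  have u3 := hu 3 (by decide)
  have u4 := hu 4 (by decide)
  have u5 := hu 5 (by decide)
  have w0 := hw 0 (by decide)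
  have w1 := hw 1 (by decide)
  have w2 := hw 2 (by decide)
  have w3 := hw 3 (by decide)
  simp [invariantForm_apply, minorForm_apply, u0, u1, u2, u3, u4, u5, w0, w1, w2, w3]

variable {f : ℝ × (Fin (6 + 1) → ℝ) → ℝ} {U : Set (ℝ × (Fin (6 + 1) → ℝ))}

/-- A `3`-form compatible with the curve of a solution is proportional to the invariant form in
every canonical frame. -/
theorem exists_eq_smul_of_compatibleThreeForm (hU : IsOpen U) (hf : ContDiffOn ℝ ∞ f U)
    (y : Solution f U) {Ω : y.tangent [⋀^Fin 3]→ₗ[ℝ] ℝ}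
    (hΩ : CompatibleThreeForm y.dom y.curve Ω) {A : ℝ → Matrix (Fin (6 + 1)) (Fin (6 + 1)) ℝ}
    (hA : ∀ t ∈ y.dom, UpperDeg 0 (A t) ∧ (A t).det ≠ 0) {α : ℝ → ℝ} {κ : ℕ → ℝ → ℝ}
    (hF : IsMovingFrame y.dom (fun t => canonicalMatrix 6 (α t) fun i => κ i t)
      (gaugedCoord y A)) {t : ℝ} (ht : t ∈ y.dom) :
    ∃ c : ℝ, Ω = c • (gaugedThreeForm (A t)).compLinearMap (y.coord t) ∧
      c * κ 2 t = 0 ∧ c * κ 3 t = 0 ∧ c * κ 4 t = 0 ∧ c * κ 6 t = 0 := by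
  have hzero : ∀ t ∈ y.dom, ∀ (a : Fin (6 + 1)) (m : Fin (6 + 1)), m < a →
      (dualFrame (gaugedCoord y A) t a).1 t m = 0 := by
    intro t ht a m hm
    refine (coord_eq_zero_iff_gaugedCoord y (hA t ht).1 (hA t ht).2
      (dualFrame (gaugedCoord y A) t a) a).1 (fun m hm => ?_) m hm
    rw [hF.apply_dualFrame ht, Pi.single_eq_of_ne]
    rintro rfl; omega
  have hγ : ∀ t ∈ y.dom, dualFrame (gaugedCoord y A) t 6 ∈ y.curve t := fun t ht i =>
    hzero t ht 6 i.castSucc i.2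
  have hosc : ∀ t ∈ y.dom, ∀ a : Fin (6 + 1), 4 ≤ (a : ℕ) →
      dualFrame (gaugedCoord y A) t a ∈ osculating y.dom y.curve 2 t := by
    intro t ht a ha
    rw [y.mem_osculating_iff hU hf ht (by norm_num)]
    exact fun m hm => hzero t ht a m (Fin.lt_def.2 (by omega))
  exact hF.trilin_rigidity y.isOpen_dom
    (fun t ht z => hΩ t ht _ (hγ t ht) _ (hosc t ht 5 (by decide)) z)
    (fun t ht z => hΩ t ht _ (hγ t ht) _ (hosc t ht 4 (by decide)) z) ht

/-- If four invariants vanish, there is a compatible `3`-form. -/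
theorem exists_compatibleThreeForm (hU : IsOpen U) (hf : ContDiffOn ℝ ∞ f U) (y : Solution f U)
    (h3 : ∀ x ∈ y.dom, genWilczynski y 3 x = 0) (h4 : ∀ x ∈ y.dom, genWilczynski y 4 x = 0)
    (h5 : ∀ x ∈ y.dom, genWilczynski y 5 x = 0) (h7 : ∀ x ∈ y.dom, genWilczynski y 7 x = 0) :
    ∃ Ω : y.tangent [⋀^Fin 3]→ₗ[ℝ] ℝ, Ω ≠ 0 ∧ CompatibleThreeForm y.dom y.curve Ω := by
  obtain ⟨A, α, β, hA, hF⟩ := exists_wilczynski_frame (by norm_num) hU hf y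
  obtain ⟨s, hs⟩ := y.nonempty_dom
  -- As for bilinear forms, the invariant form is frozen at one time s, and constancy allows
  -- compatibility to be checked in the frame at each t.
  refine ⟨invariantForm.compLinearMap (gaugedCoord y A s), fun h0 => ?_,
    fun t ht u hu w hw z => ?_⟩
  · apply isG2Form_invariantForm.ne_zero
    ext v
    choose w hw using fun i => (hF.bijective s hs).2 (v i)
    rw [← funext hw]
    exact congrArg (fun T : y.tangent [⋀^Fin 3]→ₗ[ℝ] ℝ => T w) h0
  · have hcomp : ∀ r, invariantForm.compLinearMap (gaugedCoord y A r) ![u, w, z] =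
        invariantForm ![gaugedCoord y A r u, gaugedCoord y A r w, gaugedCoord y A r z] := by
      intro r
      rw [AlternatingMap.compLinearMap_apply]
      congr 1
      ext1 i
      fin_cases i <;> rfl
    rw [hcomp, hF.invariantForm_const y.isOpen_dom y.ordConnected_dom (fun t ht => ⟨rfl, h3 t ht,
      h4 t ht, h5 t ht, h7 t ht⟩) hs ht]
    refine invariantForm_eq_zero ?_ ?_ _
    · exact (coord_eq_zero_iff_gaugedCoord y (hA t ht).1 (hA t ht).2 u 6).2 fun m hm =>
        hu ⟨m, hm⟩
    · exact (coord_eq_zero_iff_gaugedCoord y (hA t ht).1 (hA t ht).2 w 4).2 fun m hm =>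
        (y.mem_osculating_iff hU hf ht (by norm_num) w).1 hw m (by omega)

/-- A non-zero compatible `3`-form spans the line of the invariant form in a canonical frame. -/
theorem span_eq_of_compatibleThreeForm (hU : IsOpen U) (hf : ContDiffOn ℝ ∞ f U)
    (y : Solution f U) {Ω : y.tangent [⋀^Fin 3]→ₗ[ℝ] ℝ} (hΩ0 : Ω ≠ 0)
    (hΩ : CompatibleThreeForm y.dom y.curve Ω) {A : ℝ → Matrix (Fin (6 + 1)) (Fin (6 + 1)) ℝ}
    (hA : ∀ t ∈ y.dom, UpperDeg 0 (A t) ∧ (A t).det ≠ 0) {α : ℝ → ℝ} {κ : ℕ → ℝ → ℝ}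
    (hF : IsMovingFrame y.dom (fun t => canonicalMatrix 6 (α t) fun i => κ i t)
      (gaugedCoord y A)) {t : ℝ} (ht : t ∈ y.dom) :
    Submodule.span ℝ {Ω} =
      Submodule.span ℝ {(gaugedThreeForm (A t)).compLinearMap (y.coord t)} := by
  obtain ⟨c, hc, -⟩ := exists_eq_smul_of_compatibleThreeForm hU hf y hΩ hA hF ht
  have hc0 : c ≠ 0 := by rintro rfl; rw [zero_smul] at hc; exact hΩ0 hc
  rw [hc]
  exact Submodule.span_singleton_smul_eq (isUnit_iff_ne_zero.2 hc0) _

/-- A non-zero compatible `3`-form at a solution forces four invariants to vanish. -/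
theorem vanishing_of_compatibleThreeForm (hU : IsOpen U) (hf : ContDiffOn ℝ ∞ f U)
    (y : Solution f U) {Ω : y.tangent [⋀^Fin 3]→ₗ[ℝ] ℝ} (hΩ0 : Ω ≠ 0)
    (hΩ : CompatibleThreeForm y.dom y.curve Ω) {t : ℝ} (ht : t ∈ y.dom) :
    genWilczynski y 3 t = 0 ∧ genWilczynski y 4 t = 0 ∧ genWilczynski y 5 t = 0 ∧
      genWilczynski y 7 t = 0 := by
  obtain ⟨A, α, β, hA, hF⟩ := exists_wilczynski_frame (by norm_num) hU hf y
  obtain ⟨c, hc, h2, h3, h4, h6⟩ := exists_eq_smul_of_compatibleThreeForm hU hf y hΩ hA hF ht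
  have hc0 : c ≠ 0 := by rintro rfl; rw [zero_smul] at hc; exact hΩ0 hc
  exact ⟨(mul_eq_zero.1 h2).resolve_left hc0, (mul_eq_zero.1 h3).resolve_left hc0,
    (mul_eq_zero.1 h4).resolve_left hc0, (mul_eq_zero.1 h6).resolve_left hc0⟩

theorem compLinearMap_coord_ne_zero (hU : IsOpen U) (hf : ContDiffOn ℝ ∞ f U) (y : Solution f U)
    {x₀ : ℝ} (hx₀ : x₀ ∈ y.dom) {Ω : (Fin (6 + 1) → ℝ) [⋀^Fin 3]→ₗ[ℝ] ℝ} (hΩ : IsG2Form Ω) :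
    Ω.compLinearMap (y.coord x₀) ≠ 0 := by
  intro h
  apply hΩ.ne_zero
  ext v
  choose w hw using fun i => ((y.isMovingFrame_coord hU hf).bijective x₀ hx₀).2 (v i)
  rw [← funext hw]
  exact congrArg (fun T : y.tangent [⋀^Fin 3]→ₗ[ℝ] ℝ => T w) h

end ThreeForms

/-! ### Natural G₂-structures -/

section Theorems

variable {k : ℕ} {f : ℝ × (Fin (k + 1) → ℝ) → ℝ} {U : Set (ℝ × (Fin (k + 1) → ℝ))}

theorem G2Structure.eq_six (S : G2Structure f U) (y : Solution f U) : k = 6 := by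
  obtain ⟨x₀, hx₀⟩ := y.nonempty_dom
  obtain ⟨Ω, -, hΩ, -⟩ := S.exists_threeForm x₀
  exact (hΩ _ (y.mem_domain hx₀)).eq_six

theorem exists_natural_g2Structure_iff (hU : IsOpen U) (hne : U.Nonempty)
    (hf : ContDiffOn ℝ ∞ f U) :
    (∃ S : G2Structure f U, S.IsNatural) ↔
      k = 6 ∧ GenWilczynskiVanishes f U 3 ∧ GenWilczynskiVanishes f U 4 ∧
        GenWilczynskiVanishes f U 5 ∧ GenWilczynskiVanishes f U 7 := by
  constructor
  · rintro ⟨S, hS⟩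
    obtain ⟨y₀⟩ := exists_solution hU hne hf
    obtain rfl := S.eq_six y₀
    have key : ∀ y : Solution f U, ∀ x ∈ y.dom, genWilczynski y 3 x = 0 ∧
        genWilczynski y 4 x = 0 ∧ genWilczynski y 5 x = 0 ∧ genWilczynski y 7 x = 0 := by
      intro y x₀ hx₀
      obtain ⟨Ω, -, hΩ, hline⟩ := S.exists_threeForm x₀
      exact vanishing_of_compatibleThreeForm hU hf y
        (compLinearMap_coord_ne_zero hU hf y hx₀ (hΩ _ (y.mem_domain hx₀)))
        (hS y _ (by rw [hline y hx₀]; exact Submodule.mem_span_singleton_self _)) hx₀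
    exact ⟨rfl, fun y x hx => (key y x hx).1, fun y x hx => (key y x hx).2.1,
      fun y x hx => (key y x hx).2.2.1, fun y x hx => (key y x hx).2.2.2⟩
  · rintro ⟨rfl, h3, h4, h5, h7⟩
    obtain ⟨A, κ, hA, hA1, hF⟩ := exists_universal_frame hU hf
    choose Ω hΩ0 hΩ using fun y : Solution f U =>
      exists_compatibleThreeForm hU hf y (h3 y) (h4 y) (h5 y) (h7 y)
    refine ⟨⟨fun y => Submodule.span ℝ {Ω y}, fun x₀ => ⟨fun a => gaugedThreeForm (A (x₀, a)),
      fun u => contDiffOn_initialValues (contDiffOn_gaugedThreeForm hA u) x₀,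
      fun a _ => isG2Form_gaugedThreeForm (hA1 _).2, fun y hx₀ => ?_⟩⟩, fun y Ω' hΩ' => ?_⟩
    · exact span_eq_of_compatibleThreeForm hU hf y (hΩ0 y) (hΩ y) (fun t _ => hA1 (t, y.jet t))
        (hF y) hx₀
    · obtain ⟨c, rfl⟩ := Submodule.mem_span_singleton.1 hΩ'
      intro t ht u hu w hw z
      rw [AlternatingMap.smul_apply, hΩ y t ht u hu w hw z, smul_zero]

theorem G2Structure.eq_of_isNatural (hU : IsOpen U) (hf : ContDiffOn ℝ ∞ f U)
    (S S' : G2Structure f U) (hS : S.IsNatural) (hS' : S'.IsNatural) : S = S' := by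
  ext1
  funext y
  obtain rfl := S.eq_six y
  obtain ⟨x₀, hx₀⟩ := y.nonempty_dom
  obtain ⟨Ω, -, hΩ, hline⟩ := S.exists_threeForm x₀
  obtain ⟨Ω', -, hΩ', hline'⟩ := S'.exists_threeForm x₀
  have h := hS y
  have h' := hS' y
  rw [hline y hx₀] at h ⊢
  rw [hline' y hx₀] at h' ⊢
  obtain ⟨A, κ, -, hA1, hF⟩ := exists_universal_frame hU hf
  rw [span_eq_of_compatibleThreeForm hU hf y
      (compLinearMap_coord_ne_zero hU hf y hx₀ (hΩ _ (y.mem_domain hx₀)))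
      (h _ (Submodule.mem_span_singleton_self _)) (fun t _ => hA1 (t, y.jet t)) (hF y) hx₀,
    span_eq_of_compatibleThreeForm hU hf y
      (compLinearMap_coord_ne_zero hU hf y hx₀ (hΩ' _ (y.mem_domain hx₀)))
      (h' _ (Submodule.mem_span_singleton_self _)) (fun t _ => hA1 (t, y.jet t)) (hF y) hx₀]

end Theorems

end ODEGeometry

end

theorem theorem2 (k : ℕ) (hk : 2 ≤ k) (U : Set (ℝ × (Fin (k + 1) → ℝ))) (hU : IsOpen U)
    (hne : U.Nonempty) (f : ℝ × (Fin (k + 1) → ℝ) → ℝ) (hf : ContDiffOn ℝ ∞ f U) :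
    ((∃ S : ODEGeometry.PseudoConformalStructure f U, S.IsNatural) ↔
      Even k ∧ ∀ i : ℕ, 1 ≤ i → 2 * i + 1 ≤ k + 1 →
        ODEGeometry.GenWilczynskiVanishes f U (2 * i + 1)) ∧
    ((∃ S : ODEGeometry.PseudoSymplecticStructure f U, S.IsNatural) ↔
      Odd k ∧ ∀ i : ℕ, 1 ≤ i → 2 * i + 1 ≤ k + 1 →
        ODEGeometry.GenWilczynskiVanishes f U (2 * i + 1)) ∧
    ((∃ S : ODEGeometry.G2Structure f U, S.IsNatural) ↔
      k = 6 ∧ ODEGeometry.GenWilczynskiVanishes f U 3 ∧ ODEGeometry.GenWilczynskiVanishes f U 4 ∧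
        ODEGeometry.GenWilczynskiVanishes f U 5 ∧ ODEGeometry.GenWilczynskiVanishes f U 7) ∧
    (∀ S S' : ODEGeometry.PseudoConformalStructure f U, S.IsNatural → S'.IsNatural → S = S') ∧
    (∀ S S' : ODEGeometry.PseudoSymplecticStructure f U, S.IsNatural → S'.IsNatural → S = S') ∧
    (∀ S S' : ODEGeometry.G2Structure f U, S.IsNatural → S'.IsNatural → S = S') := by
  have hk1 : 1 ≤ k := by omega
  exact ⟨ODEGeometry.exists_natural_pseudoConformal_iff hk1 hU hne hf,
    ODEGeometry.exists_natural_pseudoSymplectic_iff hk1 hU hne hf,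
    ODEGeometry.exists_natural_g2Structure_iff hU hne hf,
    ODEGeometry.PseudoConformalStructure.eq_of_isNatural hU hf,
    ODEGeometry.PseudoSymplecticStructure.eq_of_isNatural hU hf,
    ODEGeometry.G2Structure.eq_of_isNatural hU hf⟩
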